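/- For all positive integers $m$ and $n$, let $X_m \le \mathrm{Sym}(m)$ and $Y_n \le \mathrm{Sym}(n)$ be permutation groups, given by generators: there are polynomial-time algorithms which, on input $m$ (respectively $n$) in unary, output a list of permutations generating $X_m$ (respectively $Y_n$). Assume that both families have polynomial index, i.e. there are polynomials $p, q$ such that $|\mathrm{Sym}(m) : X_m| < p(m)$ and $|\mathrm{Sym}(n) : Y_n| < q(n)$ for all $m, n \ge 1$. Let $G_{m,n} = X_m \times Y_n$ act component-wise on $[m] \times [n]$. A complete symmetry breaking circuit with additional variables for a permutation group $G \le \mathrm{Sym}(\Omega)$ is a Boolean circuit $\psi$ (with AND, OR and NOT gates), whose variables are elements of $\Omega$ and possibly further additional variables, such that every orbit $O$ of $G$ on the set of all assignments $\Omega \to \{0,1\}$ contains an assignment $\tau'$ for which $\psi[\tau']$ is satisfiable (by some assignment of the additional variables), while $\psi[\tau'']$ is unsatisfiable for every $\tau'' \in O$ with $\tau'' \neq \tau'$. Suppose that there is a polynomial-time algorithm which, on input $m, n \ge 1$ in unary, outputs a complete symmetry breaking circuit with additional variables for $G_{m,n}$. Then the graph isomorphism problem GI (given two finite simple graphs by their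 adjacency matrices, decide whether they are isomorphic) is in $\mathsf{coNP}$. -/

import Mathlib

namespace SymmetryBreaking

/-! ### Words -/

/-- A natural number in unary, followed by a delimiter. -/
def natWord (k : ℕ) : List Bool := Computability.unaryEncodeNat k ++ [false]

/-- A list of objects, each written by `enc` after a marker bit `true`; the bit `false` ends it. -/
def listWord {α : Type} (enc : α → List Bool) (l : List α) : List Bool :=
  l.flatMap (fun a => true :: enc a) ++ [false]

/-! ### Polynomial time, NP and coNP -/

/-- `f` is computed by a polynomial-time (multi-stack) Turing machine, with respect to the
encodings `ea` of its arguments and `eb` of its values. -/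
def PolyTimeComputable {α β Γ₀ Γ₁ : Type} (ea : α → List Γ₀) (eb : β → List Γ₁) (f : α → β) :
    Prop :=
  Nonempty (Turing.TM2ComputableInPolyTime ea eb f)

/-- The encoding of an instance together with a certificate; the letters of the two words are
kept apart by using disjoint copies of the binary alphabet. -/
def certWord {α : Type} (enc : α → List Bool) (x : α × List Bool) : List (Bool ⊕ Bool) :=
  (enc x.1).map Sum.inl ++ x.2.map Sum.inr

/-- The decision problem `L` on instances of type `α`, encoded by `enc`, is in NP: it has a
polynomial-time verifier for certificates of polynomial length. -/
def InNP {α : Type} (enc : α → List Bool) (L : Set α) : Prop :=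
  ∃ (p : Polynomial ℕ) (V : α × List Bool → Bool),
    PolyTimeComputable (certWord enc) Computability.encodeBool V ∧
    ∀ x : α, x ∈ L ↔ ∃ w : List Bool, w.length ≤ p.eval (enc x).length ∧ V (x, w) = true

/-- The decision problem `L` is in coNP: its complement is in NP. -/
def InCoNP {α : Type} (enc : α → List Bool) (L : Set α) : Prop :=
  InNP enc Lᶜ

/-! ### Graph isomorphism -/

/-- A finite simple graph on the vertices `0, …, n - 1`. -/
structure FinGraph where
  n : ℕ
  graph : SimpleGraph (Fin n)

open Classical in
/-- The number of vertices in unary, followed by the adjacency matrix, row by row. -/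
noncomputable def graphWord (Γ : FinGraph) : List Bool :=
  natWord Γ.n ++
    (List.finRange Γ.n).flatMap fun i => (List.finRange Γ.n).map fun j => decide (Γ.graph.Adj i j)

noncomputable def graphPairWord (P : FinGraph × FinGraph) : List Bool :=
  graphWord P.1 ++ graphWord P.2

/-- The graph isomorphism problem. -/
def GI : Set (FinGraph × FinGraph) :=
  {P | Nonempty (P.1.graph ≃g P.2.graph)}

/-! ### Boolean circuits -/

/-- A gate of a circuit with variables in `V`; numbers refer to positions in the list of gates. -/
inductive Gate (V : Type) : Type
  | input (v : V)
  | not (i : ℕ)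
  | and (i j : ℕ)
  | or (i j : ℕ)

/-- A Boolean circuit: its gates in a topological order. The last gate is the output gate. -/
abbrev Circuit (V : Type) : Type := List (Gate V)

/-- All gates referred to by the gate `g` have positions below `k`. -/
def Gate.RefsBelow {V : Type} (k : ℕ) : Gate V → Prop
  | .input _ => True
  | .not i => i < k
  | .and i j => i < k ∧ j < k
  | .or i j => i < k ∧ j < k

/-- There is an output gate, and every gate refers only to earlier gates. -/
def Circuit.WellFormed {V : Type} (c : Circuit V) : Prop :=
  c ≠ [] ∧ ∀ (k : ℕ) (hk : k < c.length), (c.get ⟨k, hk⟩).RefsBelow k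

/-- The value of a gate under the assignment `θ`, given the values of the earlier gates. -/
def Gate.eval {V : Type} (θ : V → Bool) (vals : List Bool) : Gate V → Bool
  | .input v => θ v
  | .not i => !(vals.getD i false)
  | .and i j => vals.getD i false && vals.getD j false
  | .or i j => vals.getD i false || vals.getD j false

/-- The values of all gates, in order. -/
def Circuit.values {V : Type} (θ : V → Bool) (c : Circuit V) : List Bool :=
  c.foldl (fun vals g => vals ++ [g.eval θ vals]) []

/-- The value of the output gate. -/
def Circuit.eval {V : Type} (θ : V → Bool) (c : Circuit V) : Bool :=
  (Circuit.values θ c).getLastD false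

/-! ### Complete symmetry breaking with additional variables -/

/-- The orbit of a complete assignment `τ` of `Ω` under `G ≤ Sym(Ω)`. -/
def assignmentOrbit {Ω : Type} (G : Subgroup (Equiv.Perm Ω)) (τ : Ω → Bool) : Set (Ω → Bool) :=
  {τ' | ∃ g ∈ G, τ' = τ ∘ ⇑g⁻¹}

/-- The circuit `c`, in the variables `Ω` and additional variables from the supply `ℕ`, is
satisfiable once the variables in `Ω` are assigned by `τ`. -/
def SatisfiableAt {Ω : Type} (c : Circuit (Ω ⊕ ℕ)) (τ : Ω → Bool) : Prop :=
  ∃ y : ℕ → Bool, Circuit.eval (Sum.elim τ y) c = true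

/-- `c` is a complete symmetry breaking circuit with additional variables for `G ≤ Sym(Ω)`. -/
def IsCompleteSymmetryBreaking {Ω : Type} (G : Subgroup (Equiv.Perm Ω)) (c : Circuit (Ω ⊕ ℕ)) :
    Prop :=
  c.WellFormed ∧
    ∀ τ : Ω → Bool, ∃ τ' ∈ assignmentOrbit G τ, SatisfiableAt c τ' ∧
      ∀ τ'' ∈ assignmentOrbit G τ, τ'' ≠ τ' → ¬ SatisfiableAt c τ''

/-! ### The groups `X × Y` acting on a grid -/

/-- `Sym(A) × Sym(B)` acting component-wise on `A × B`. -/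
def gridHom (A B : Type) : Equiv.Perm A × Equiv.Perm B →* Equiv.Perm (A × B) where
  toFun g := Equiv.prodCongr g.1 g.2
  map_one' := rfl
  map_mul' _ _ := rfl

/-- The permutation group `X × Y` acting component-wise on `A × B`. -/
def gridGroup {A B : Type} (X : Subgroup (Equiv.Perm A)) (Y : Subgroup (Equiv.Perm B)) :
    Subgroup (Equiv.Perm (A × B)) :=
  (X.prod Y).map (gridHom A B)

/-! ### Families of groups -/

/-- A family of permutation groups `X n ≤ Sym(n)`, for the positive integers `n`. -/
abbrev PermFamily : Type := (n : ℕ+) → Subgroup (Equiv.Perm (Fin n))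

/-- The index of `X n` in `Sym(n)` is bounded by a polynomial in `n`. -/
def PermFamily.HasPolynomialIndex (X : PermFamily) : Prop :=
  ∃ p : Polynomial ℕ, ∀ n : ℕ+, (X n).index < p.eval (n : ℕ)

/-- A permutation of `{0, …, n - 1}` as the list of its values, in unary. -/
def permWord {n : ℕ} (g : Equiv.Perm (Fin n)) : List Bool :=
  (List.finRange n).flatMap fun i => natWord (g i)

/-- The groups of the family are given by generators that are computable in time polynomial
in `n`. -/
def PermFamily.IsGivenByGenerators (X : PermFamily) : Prop :=
  ∃ gens : (n : ℕ+) → List (Equiv.Perm (Fin n)),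
    (∀ n, Subgroup.closure {g | g ∈ gens n} = X n) ∧
    PolyTimeComputable (fun n : ℕ+ => natWord n) id (fun n => listWord permWord (gens n))

/-- The encoding of a gate: a tag, and then positions and indices of variables in unary. -/
def gateWord {m n : ℕ} : Gate ((Fin m × Fin n) ⊕ ℕ) → List Bool
  | .input (.inl ij) => [false, false, false] ++ natWord ij.1 ++ natWord ij.2
  | .input (.inr k) => [false, false, true] ++ natWord k
  | .not i => [false, true] ++ natWord i
  | .and i j => [true, false] ++ natWord i ++ natWord j
  | .or i j => [true, true] ++ natWord i ++ natWord j

def circuitWord {m n : ℕ} (c : Circuit ((Fin m × Fin n) ⊕ ℕ)) : List Bool :=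
  listWord gateWord c

/-- Efficient complete symmetry breaking with additional variables for the family of the groups
`X m × Y n`, acting on the grid of size `m × n`: on input `(m, n)`, written in unary, a
polynomial-time algorithm outputs a complete symmetry breaking circuit with additional variables
for `X m × Y n`. -/
def EfficientCompleteSymmetryBreaking (X Y : PermFamily) : Prop :=
  ∃ c : (s : ℕ+ × ℕ+) → Circuit ((Fin s.1 × Fin s.2) ⊕ ℕ),
    (∀ s, IsCompleteSymmetryBreaking (gridGroup (X s.1) (Y s.2)) (c s)) ∧
    PolyTimeComputable (fun s : ℕ+ × ℕ+ => natWord s.1 ++ natWord s.2) id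
      (fun s => circuitWord (c s))

end SymmetryBreaking

/-! Give a graph on n vertices the incidence matrix with n rows and n² columns, one column for each
ordered pair of vertices. Distinct vertices are adjacent iff their rows share a column, so two
graphs are isomorphic iff their matrices α, β lie in the same orbit of Sym(n) × Sym(n²)
(`nonempty_iso_iff`). A coNP algorithm for GI thus needs short certificates that α and β lie in
different orbits.

Put X = X_n and Y = Y_{n²}. The circuit for X × Y singles out exactly one satisfiable matrix in
every X × Y-orbit, and satisfiability has short witnesses. The full orbit of α splits into at most
|Sym(n) : X| · |Sym(n²) : Y| orbits of X × Y, hence polynomially many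
(`IsCompleteSymmetryBreaking.ncard_le`). A certificate lists a set S consisting of the
representatives of all of them, and the representative E of β, which is not in S. The verifier
checks that the members of S and E are satisfiable, that S meets the X × Y-orbit of α, and that
exchanging two rows or two columns of a member of S leads back to S up to X × Y. As transpositions
generate the symmetric groups, S then meets every X × Y-orbit inside the full orbit of α
(`exists_comp_gridHom_eq`). If β were in that orbit, uniqueness of representatives would put E into
S (`ne_comp_gridHom_of_check`).

"Up to X × Y" requires evidence that certain permutations belong to groups known by generators only.
The reachability lemma of Babai and Szemerédi (`exists_derivation`) supplies it: every element of a
finite group has a derivation from the generators of length polynomial in the logarithm of the group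
order, and a derivation is checked line by line.

Polynomial time is defined by Turing machines, so the verifier has to become one. A small stack
language is compiled to `TM2` machines, and its closure properties yield a calculus `Poly` of
polynomial-time functions in which `fun_prop` does the routine work. In the opposite direction, the
machines given by the hypotheses are simulated inside the calculus
(`PolyTimeComputable.exists_poly`). Input words, generator words and circuit words are never parsed:
the certificate contains the decoded objects, the verifier encodes them again and compares, and
injectivity of the encodings gives soundness. -/

namespace SymmetryBreaking

/-! ### A stack language and its compilation to Turing machines -/

open Function

/-! ### A structured language for four stacks -/

/-- The common alphabet of the work stacks: `inl b` is a bit, `inr b` is a marker. -/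
abbrev Letter : Type := Bool ⊕ Bool

abbrev Store : Type := Fin 4 → List Letter

/-- All control flow is by popping a letter. Popping an empty stack, or a marker in `case`, has no
rule in `Exec`, so a derivation of `Exec` also shows that this never happens. -/
inductive Cmd : Type
  | skip
  | push (k : Fin 4) (s : Letter)
  | seq (c d : Cmd)
  | case (k : Fin 4) (cF cT : Cmd)
  | loop (k : Fin 4) (cF cT : Cmd)

/-- `Exec c S S' t`: the command `c` leads from `S` to `S'` in at most `t` steps. A loop pops bits
from its stack until it finds a marker. -/
inductive Exec : Cmd → Store → Store → ℕ → Prop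
  | mono {c S S' t t'} : Exec c S S' t → t ≤ t' → Exec c S S' t'
  | skip (S) : Exec .skip S S 1
  | push (k s S) : Exec (.push k s) S (update S k (s :: S k)) 1
  | seq {c d S S' S'' t t'} : Exec c S S' t → Exec d S' S'' t' → Exec (.seq c d) S S'' (t + t')
  | case_false {k cF cT S S' t l} : S k = .inl false :: l → Exec cF (update S k l) S' t →
      Exec (.case k cF cT) S S' (t + 1)
  | case_true {k cF cT S S' t l} : S k = .inl true :: l → Exec cT (update S k l) S' t →
      Exec (.case k cF cT) S S' (t + 1)
  | loop_end {k cF cT S l b} : S k = .inr b :: l → Exec (.loop k cF cT) S (update S k l) 1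
  | loop_false {k cF cT S S' S'' t t' l} : S k = .inl false :: l → Exec cF (update S k l) S' t →
      Exec (.loop k cF cT) S' S'' t' → Exec (.loop k cF cT) S S'' (t + 1 + t')
  | loop_true {k cF cT S S' S'' t t' l} : S k = .inl true :: l → Exec cT (update S k l) S' t →
      Exec (.loop k cF cT) S' S'' t' → Exec (.loop k cF cT) S S'' (t + 1 + t')

/-! ### Compilation to instructions with jumps -/

inductive Instr : Type
  | jump (a : ℕ)
  | push (k : Fin 4) (s : Letter) (a : ℕ)
  | pop (k : Fin 4) (aF aT aE : ℕ)

def Cmd.size : Cmd → ℕ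
  | .skip => 1
  | .push _ _ => 1
  | .seq c d => c.size + d.size
  | .case _ c d => 1 + c.size + d.size
  | .loop _ c d => 1 + c.size + d.size

/-- The code of a command that starts at the address `pc` and continues at the address `nx`. -/
def Cmd.compile : Cmd → ℕ → ℕ → List Instr
  | .skip, _, nx => [.jump nx]
  | .push k s, _, nx => [.push k s nx]
  | .seq c d, pc, nx => c.compile pc (pc + c.size) ++ d.compile (pc + c.size) nx
  | .case k c d, pc, nx =>
      .pop k (pc + 1) (pc + 1 + c.size) nx ::
        (c.compile (pc + 1) nx ++ d.compile (pc + 1 + c.size) nx)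
  | .loop k c d, pc, nx =>
      .pop k (pc + 1) (pc + 1 + c.size) nx ::
        (c.compile (pc + 1) pc ++ d.compile (pc + 1 + c.size) pc)

theorem Cmd.length_compile (c : Cmd) (pc nx : ℕ) : (c.compile pc nx).length = c.size := by
  induction c generalizing pc nx <;> simp_all [Cmd.compile, Cmd.size] <;> omega

def CodeAt (P : List Instr) (pc : ℕ) (C : List Instr) : Prop :=
  ∃ l r, P = l ++ C ++ r ∧ l.length = pc

theorem CodeAt.left {P pc C D} (h : CodeAt P pc (C ++ D)) : CodeAt P pc C := by
  obtain ⟨l, r, rfl, h⟩ := h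
  exact ⟨l, D ++ r, by simp, h⟩

theorem CodeAt.right {P pc C D} (h : CodeAt P pc (C ++ D)) : CodeAt P (pc + C.length) D := by
  obtain ⟨l, r, rfl, h⟩ := h
  exact ⟨l ++ C, r, by simp, by simp [h]⟩

theorem CodeAt.head {P pc i D} (h : CodeAt P pc (i :: D)) : P[pc]? = some i := by
  obtain ⟨l, r, rfl, rfl⟩ := h
  simp

theorem CodeAt.tail {P pc i D} (h : CodeAt P pc (i :: D)) : CodeAt P (pc + 1) D :=
  CodeAt.right (C := [i]) h

/-! ### The machine that runs the code -/

/-- The index `none` is the output stack, `some none` the input stack, and the others are the work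
stacks. -/
abbrev machineAlphabet : Option (Option (Fin 4)) → Type
  | none => Bool
  | some _ => Letter

/-- The label `none` starts the machine by pushing the code of the empty list, `some none` reads the
input, and the remaining labels are addresses. The extra address `P.length`, where there is no
instruction, is where the output is written. -/
abbrev MachineLabel (P : List Instr) : Type := Option (Option (Fin (P.length + 1)))

abbrev MachineStmt (P : List Instr) : Type :=
  Turing.TM2.Stmt machineAlphabet (MachineLabel P) (Option Letter)

def addr (P : List Instr) (a : ℕ) : MachineLabel P := some (some (Fin.ofNat _ a))

/-- The letters of a word that represents an input letter, see `encLetter`. -/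
def letterCode (s : Letter) : List Letter :=
  let b : Bool × Bool := s.elim (fun b => (false, b)) (fun b => (true, b))
  [.inl true, .inl true, .inl b.1, .inl !b.1, .inl false, .inl false,
    .inl true, .inl b.2, .inl !b.2, .inl false, .inl false]

/-- The positions are pushed in descending order, so that the code of the letter can be read from
the top of the stack. -/
def pushCode (P : List Instr) (q : MachineStmt P) : ℕ → MachineStmt P
  | 0 => q
  | i + 1 => .push (some (some 0))
      (fun v => (letterCode (v.getD (.inl false))).getD i (.inl false)) (pushCode P q i)

def Instr.stmt (P : List Instr) : Instr → MachineStmt P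
  | .jump a => .goto fun _ => addr P a
  | .push k s a => .push (some (some k)) (fun _ => s) (.goto fun _ => addr P a)
  | .pop k aF aT aE => .pop (some (some k)) (fun _ s => s) (.goto fun v =>
      match v with
      | some (.inl false) => addr P aF
      | some (.inl true) => addr P aT
      | _ => addr P aE)

/-- The top letter alone determines the answer. The further pops and the final `load` only empty the
main stack and reset the register, as a halting configuration in the sense of `Turing.haltList`
requires. -/
def outputStmt (P : List Instr) : MachineStmt P :=
  .pop (some (some 0)) (fun _ s => s) <|
  .push none (fun v => v.elim false fun s => s.elim id fun _ => false) <|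
  .pop (some (some 0)) (fun v _ => v) <| .pop (some (some 0)) (fun v _ => v) <|
  .load (fun _ => none) .halt

def machineProgram (P : List Instr) : MachineLabel P → MachineStmt P
  | none => .push (some (some 0)) (fun _ => .inl false) (.goto fun _ => some none)
  | some none => .pop (some none) (fun _ s => s) <|
      .branch (fun v => v.isSome)
        (pushCode P (.push (some (some 0)) (fun _ => .inl true) (.goto fun _ => some none)) 11)
        (.goto fun _ => addr P 0)
  | some (some i) => match P[i.val]? with
      | some c => c.stmt P
      | none => outputStmt P

def machine (P : List Instr) : Turing.FinTM2 where
  K := Option (Option (Fin 4))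
  k₀ := some none
  k₁ := none
  Γ := machineAlphabet
  Λ := MachineLabel P
  main := none
  σ := Option Letter
  initialState := none
  Γk₀Fin := (inferInstance : Fintype Letter)
  m := machineProgram P

abbrev MachineCfg (P : List Instr) : Type :=
  Turing.TM2.Cfg machineAlphabet (MachineLabel P) (Option Letter)

/-- The stacks of the machine, with an empty output stack. -/
def machineStk (w : List Letter) (S : Store) : (k : Option (Option (Fin 4))) →
    List (machineAlphabet k)
  | none => []
  | some none => w
  | some (some k) => S k

theorem update_machineStk (w : List Letter) (S : Store) (k : Fin 4) (l : List Letter) :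
    update (machineStk w S) (some (some k)) l = machineStk w (update S k l) := by
  funext j
  rcases j with _ | _ | j
  · rfl
  · rfl
  · by_cases h : j = k
    · subst h; simp [machineStk]
    · simp [machineStk, h]

theorem update_machineStk_input (w w' : List Letter) (S : Store) :
    update (machineStk w S) (some none) w' = machineStk w' S := by
  funext j
  rcases j with _ | _ | j <;> simp [machineStk]

def Steps {P : List Instr} (n : ℕ) (c d : MachineCfg P) : Prop :=
  (flip bind (Turing.TM2.step (machineProgram P)))^[n] (some c) = some d

theorem Steps.trans {P : List Instr} {m n : ℕ} {c d e : MachineCfg P} (h : Steps m c d)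
    (h' : Steps n d e) : Steps (m + n) c e := by
  unfold Steps at *
  rw [add_comm, iterate_add_apply, h, h']

theorem Steps.single {P : List Instr} {c d : MachineCfg P}
    (h : Turing.TM2.step (machineProgram P) c = some d) : Steps 1 c d := h

theorem step_addr {P : List Instr} {a : ℕ} {c : Instr} (h : P[a]? = some c) (v : Option Letter)
    (S : ∀ k, List (machineAlphabet k)) :
    Turing.TM2.step (machineProgram P) ⟨some (addr P a), v, S⟩ =
      some (Turing.TM2.stepAux (c.stmt P) v S) := by
  have ha : a < P.length := (List.getElem?_eq_some_iff.1 h).1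
  have : (Fin.ofNat (P.length + 1) a).val = a := Nat.mod_eq_of_lt (by omega)
  simp only [addr, Turing.TM2.step, machineProgram, this, h]

theorem steps_jump {P : List Instr} {a b : ℕ} (h : P[a]? = some (.jump b)) (v : Option Letter)
    (S : Store) : Steps (P := P) 1 ⟨some (addr P a), v, machineStk [] S⟩
      ⟨some (addr P b), v, machineStk [] S⟩ :=
  Steps.single (step_addr h _ _)

theorem steps_push {P : List Instr} {a b : ℕ} {k : Fin 4} {s : Letter}
    (h : P[a]? = some (.push k s b)) (v : Option Letter) (S : Store) :
    Steps (P := P) 1 ⟨some (addr P a), v, machineStk [] S⟩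
      ⟨some (addr P b), v, machineStk [] (update S k (s :: S k))⟩ := by
  refine Steps.single ((step_addr h _ _).trans ?_)
  rw [← update_machineStk]
  rfl

theorem steps_pop {P : List Instr} {a aF aT aE : ℕ} {k : Fin 4} {s : Letter} {l : List Letter}
    (h : P[a]? = some (.pop k aF aT aE)) (v : Option Letter) (S : Store) (hS : S k = s :: l) :
    Steps (P := P) 1 ⟨some (addr P a), v, machineStk [] S⟩
      ⟨some (addr P (match s with
        | .inl false => aF | .inl true => aT | .inr _ => aE)), some s,
        machineStk [] (update S k l)⟩ := by
  refine Steps.single ((step_addr h _ _).trans ?_)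
  rw [← update_machineStk]
  simp only [Instr.stmt, Turing.TM2.stepAux, machineStk, hS, List.head?_cons, List.tail_cons]
  rcases s with (_ | _) | s <;> rfl

/-- Correctness of the compiler, by induction on the run. The branches of a loop are compiled with
the address of the loop as their continuation, so the second induction hypothesis applies to the
same piece of code. The register may hold anything, since a jump only looks at what was popped just
before. -/
theorem Exec.steps {P : List Instr} {c : Cmd} {S S' : Store} {t : ℕ} (h : Exec c S S' t) :
    ∀ (pc nx : ℕ), CodeAt P pc (c.compile pc nx) → ∀ v, ∃ n ≤ t, ∃ v',
      Steps (P := P) n ⟨some (addr P pc), v, machineStk [] S⟩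
        ⟨some (addr P nx), v', machineStk [] S'⟩ := by
  induction h with
  | mono _ ht ih =>
    intro pc nx hc v
    obtain ⟨n, hn, h⟩ := ih pc nx hc v
    exact ⟨n, hn.trans ht, h⟩
  | skip S => exact fun pc nx hc v => ⟨1, le_rfl, v, steps_jump hc.head v S⟩
  | push k s S => exact fun pc nx hc v => ⟨1, le_rfl, v, steps_push hc.head v S⟩
  | seq _ _ ih ih' =>
    intro pc nx hc v
    obtain ⟨n, hn, v', h⟩ := ih pc _ hc.left v
    have hr := hc.right
    rw [Cmd.length_compile] at hr
    obtain ⟨n', hn', v'', h'⟩ := ih' _ nx hr v'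
    exact ⟨n + n', by omega, v'', h.trans h'⟩
  | case_false hS _ ih =>
    intro pc nx hc v
    obtain ⟨n, hn, v', h⟩ := ih _ nx hc.tail.left _
    exact ⟨1 + n, by omega, v', (steps_pop hc.head v _ hS).trans h⟩
  | case_true hS _ ih =>
    intro pc nx hc v
    have hr := hc.tail.right
    rw [Cmd.length_compile] at hr
    obtain ⟨n, hn, v', h⟩ := ih _ nx hr _
    exact ⟨1 + n, by omega, v', (steps_pop hc.head v _ hS).trans h⟩
  | loop_end hS => exact fun pc nx hc v => ⟨1, le_rfl, _, steps_pop hc.head v _ hS⟩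
  | loop_false hS _ _ ih ih' =>
    intro pc nx hc v
    obtain ⟨n, hn, v', h⟩ := ih _ pc hc.tail.left _
    obtain ⟨n', hn', v'', h'⟩ := ih' _ nx hc v'
    exact ⟨1 + n + n', by omega, v'', ((steps_pop hc.head v _ hS).trans h).trans h'⟩
  | loop_true hS _ _ ih ih' =>
    intro pc nx hc v
    have hr := hc.tail.right
    rw [Cmd.length_compile] at hr
    obtain ⟨n, hn, v', h⟩ := ih _ pc hr _
    obtain ⟨n', hn', v'', h'⟩ := ih' _ nx hc v'
    exact ⟨1 + n + n', by omega, v'', ((steps_pop hc.head v _ hS).trans h).trans h'⟩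

/-- The input word, reversed, as it arrives on the main stack. -/
def inputCode (w : List Letter) (r : List Letter) : List Letter :=
  w.foldl (fun r s => .inl true :: (letterCode s ++ r)) r

abbrev mainStore (l : List Letter) : Store := update (fun _ => []) 0 l

theorem stepAux_pushCode (P : List Instr) (q : MachineStmt P) (s : Letter) (w r : List Letter) :
    Turing.TM2.stepAux (pushCode P q 11) (some s) (machineStk w (mainStore r)) =
      Turing.TM2.stepAux q (some s) (machineStk w (mainStore (letterCode s ++ r))) := by
  simp [pushCode, update_machineStk, machineStk, letterCode]

/-- Reading a letter and pushing its whole code is a single statement, hence one step per letter,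
and one more to notice the end of the input. -/
theorem steps_read (P : List Instr) (w r : List Letter) (v : Option Letter) :
    Steps (P := P) (w.length + 1) ⟨some (some none), v, machineStk w (mainStore r)⟩
      ⟨some (addr P 0), none, machineStk [] (mainStore (inputCode w r))⟩ := by
  induction w generalizing r v with
  | nil =>
    refine Steps.single ?_
    simp only [Turing.TM2.step, machineProgram, Turing.TM2.stepAux]
    rw [show (machineStk [] (mainStore r) (some none)) = [] from rfl]
    simp [update_machineStk_input, inputCode]
  | cons s w ih =>
    rw [List.length_cons, add_comm]
    refine Steps.trans (Steps.single ?_) (ih (.inl true :: (letterCode s ++ r)) (some s))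
    simp only [Turing.TM2.step, machineProgram, Turing.TM2.stepAux]
    rw [show (machineStk (s :: w) (mainStore r) (some none)) = s :: w from rfl]
    simp only [List.head?_cons, Option.isSome_some, cond_true, List.tail_cons,
      update_machineStk_input, stepAux_pushCode, Turing.TM2.stepAux, update_machineStk]
    simp [machineStk]

theorem steps_output (P : List Instr) (b : Bool) (v : Option Letter) :
    Turing.TM2.step (machineProgram P) ⟨some (addr P P.length), v, machineStk []
      (mainStore (if b then [.inl true, .inl false, .inl false] else [.inl false]))⟩ =
      some (Turing.haltList (machine P) [b]) := by
  have : (Fin.ofNat (P.length + 1) P.length).val = P.length := Nat.mod_eq_of_lt (by omega)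
  simp only [addr, Turing.TM2.step, machineProgram, this, le_refl, List.getElem?_eq_none,
    outputStmt, Turing.TM2.stepAux, Turing.haltList]
  congr 2
  funext k
  rcases k with _ | _ | k
  · cases b <;> rfl
  · rfl
  · cases b <;> fin_cases k <;> rfl

/-- A command that maps the main stack with the (reversed) input word to a code of the answer
yields a polynomial-time machine. -/
theorem polyTimeComputable_of_exec {α : Type} {ea : α → List Letter} {V : α → Bool} (c : Cmd)
    (p : Polynomial ℕ)
    (h : ∀ a, Exec c (mainStore (inputCode (ea a) [.inl false]))
      (mainStore (if V a then [.inl true, .inl false, .inl false] else [.inl false]))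
      (p.eval (ea a).length)) :
    PolyTimeComputable ea Computability.encodeBool V := by
  let P := c.compile 0 c.size
  have hP : P.length = c.size := Cmd.length_compile _ _ _
  -- One step to start, length + 1 steps to read, at most `p` steps for the command, one step to
  -- write the output.
  refine ⟨⟨⟨machine P, Equiv.refl _, Equiv.refl _⟩, p + Polynomial.X + 3, fun a => ?_⟩⟩
  refine Classical.choice ?_
  have hinit : Turing.initList (machine P) (ea a) =
      (⟨some none, none, machineStk (ea a) (fun _ => [])⟩ : MachineCfg P) := by
    unfold Turing.initList
    change Turing.TM2.Cfg.mk _ _ _ = _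
    congr 1
    funext k
    rcases k with _ | _ | k <;> rfl
  have h0 : Steps (P := P) 1 ⟨some none, none, machineStk (ea a) (fun _ => [])⟩
      ⟨some (some none), none, machineStk (ea a) (mainStore [.inl false])⟩ := by
    refine Steps.single ?_
    simp only [Turing.TM2.step, machineProgram, Turing.TM2.stepAux, update_machineStk]
    simp [machineStk]
  have hcode : CodeAt P 0 (c.compile 0 c.size) := ⟨[], [], by simp [P], rfl⟩
  have hs := Exec.steps (h a) 0 c.size hcode none
  rw [← hP] at hs
  obtain ⟨n, hn, v, h1⟩ := hs
  have h2 := ((h0.trans (steps_read P _ _ _)).trans h1).trans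
    (Steps.single (steps_output P (V a) v))
  refine ⟨⟨1 + ((ea a).length + 1) + n + 1, ?_⟩, ?_⟩
  · simp only [Equiv.refl, Computability.encodeBool, Option.map_some]
    refine (congrArg _ (congrArg some ?_)).trans h2
    rw [← hinit]
    congr 1
    exact List.map_id _
  · simp only [Polynomial.eval_add, Polynomial.eval_X, Polynomial.eval_ofNat]
    omega

end SymmetryBreaking

/-! ### Trees on the stacks and closure properties of polynomial time -/

namespace SymmetryBreaking

open Function

theorem eval_mono (p : Polynomial ℕ) {m n : ℕ} (h : m ≤ n) : p.eval m ≤ p.eval n := by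
  simp only [Polynomial.eval_eq_sum, Polynomial.sum]
  exact Finset.sum_le_sum fun i _ => Nat.mul_le_mul_left _ (Nat.pow_le_pow_left h i)

/-! ### Binary trees on the stacks -/

/-- Binary trees serve as the universal data type: their preorder codes delimit themselves, so that
several trees can lie on one stack without separators. -/
inductive Tr : Type
  | nil
  | node (a b : Tr)

namespace Tr

/-- The preorder code of a tree. -/
def bits : Tr → List Bool
  | nil => [false]
  | node a b => true :: (a.bits ++ b.bits)

def size : Tr → ℕ
  | nil => 1
  | node a b => 1 + a.size + b.size

theorem length_bits (x : Tr) : x.bits.length = x.size := by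
  induction x <;> simp_all [bits, size]; omega

theorem size_pos (x : Tr) : 0 < x.size := by cases x <;> simp [size]

def code (x : Tr) : List Letter := x.bits.map .inl

@[simp] theorem code_nil : nil.code = [.inl false] := rfl

@[simp] theorem code_node (a b : Tr) : (node a b).code = .inl true :: (a.code ++ b.code) := by
  simp [code, bits]

end Tr

/-- The store with the given main, auxiliary, temporary and counting stack. -/
def st (m a b d : List Letter) : Store := ![m, a, b, d]

section store
variable (m a b d l : List Letter)

@[simp] theorem st_zero : st m a b d 0 = m := rfl
@[simp] theorem st_one : st m a b d 1 = a := rfl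
@[simp] theorem st_two : st m a b d 2 = b := rfl
@[simp] theorem st_three : st m a b d 3 = d := rfl

@[simp] theorem update_st_zero : update (st m a b d) 0 l = st l a b d := by
  funext k; fin_cases k <;> rfl
@[simp] theorem update_st_one : update (st m a b d) 1 l = st m l b d := by
  funext k; fin_cases k <;> rfl
@[simp] theorem update_st_two : update (st m a b d) 2 l = st m a l d := by
  funext k; fin_cases k <;> rfl
@[simp] theorem update_st_three : update (st m a b d) 3 l = st m a b l := by
  funext k; fin_cases k <;> rfl

theorem mainStore_eq : mainStore m = st m [] [] [] := by
  funext k; fin_cases k <;> rfl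

variable {m a b d l}

theorem exec_push_zero {s : Letter} : Exec (.push 0 s) (st m a b d) (st (s :: m) a b d) 1 := by
  simpa using Exec.push 0 s (st m a b d)
theorem exec_push_one {s : Letter} : Exec (.push 1 s) (st m a b d) (st m (s :: a) b d) 1 := by
  simpa using Exec.push 1 s (st m a b d)
theorem exec_push_two {s : Letter} : Exec (.push 2 s) (st m a b d) (st m a (s :: b) d) 1 := by
  simpa using Exec.push 2 s (st m a b d)
theorem exec_push_three {s : Letter} : Exec (.push 3 s) (st m a b d) (st m a b (s :: d)) 1 := by
  simpa using Exec.push 3 s (st m a b d)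

end store

/-- Reads a tree from the main stack and runs `cF` or `cT` after each bit. -/
def scanLoop (cF cT : Cmd) : Cmd :=
  .loop 3 .skip (.case 0 cF (.seq cT (.seq (.push 3 (.inl true)) (.push 3 (.inl true)))))

/-- The counting stack holds, in unary and above a marker, the number of subtrees still to be read.
Every round consumes one, and a node contributes two. -/
def scan (cF cT : Cmd) : Cmd :=
  .seq (.push 3 (.inr false)) (.seq (.push 3 (.inl true)) (scanLoop cF cT))

/-- Stated with a continuation: given a run of the loop from the situation after the tree, it is
extended to start before the tree. In this form the induction hypotheses for the two subtrees
compose. -/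
theorem exec_scanLoop {cF cT : Cmd} {κ : ℕ}
    {e : List Letter × List Letter → Bool → List Letter × List Letter}
    (hF : ∀ m a b d, Exec cF (st m a b d) (st m (e (a, b) false).1 (e (a, b) false).2 d) κ)
    (hT : ∀ m a b d, Exec cT (st m a b d) (st m (e (a, b) true).1 (e (a, b) true).2 d) κ) (x : Tr) :
    ∀ (r a b d : List Letter) (S : Store) (t : ℕ),
      Exec (scanLoop cF cT) (st r (x.bits.foldl e (a, b)).1 (x.bits.foldl e (a, b)).2 d) S t →
      Exec (scanLoop cF cT) (st (x.code ++ r) a b (.inl true :: d)) S (x.size * (κ + 4) + t) := by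
  induction x with
  | nil =>
    intro r a b d S t h
    refine (Exec.loop_true (l := d) (t := κ + 1) rfl ?_ h).mono (by simp only [Tr.size]; omega)
    refine Exec.case_false (l := r) rfl ?_
    simpa [Tr.bits] using hF _ _ _ _
  | node x y ihx ihy =>
    intro r a b d S t h
    have h1 : Exec (.case 0 cF (.seq cT (.seq (.push 3 (.inl true)) (.push 3 (.inl true)))))
        (st ((Tr.node x y).code ++ r) a b d)
        (st (x.code ++ (y.code ++ r)) (e (a, b) true).1 (e (a, b) true).2
          (.inl true :: .inl true :: d)) (κ + (1 + 1) + 1) := by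
      refine Exec.case_true (l := x.code ++ (y.code ++ r)) (by simp) ?_
      simpa using (hT _ _ _ _).seq (exec_push_three.seq exec_push_three)
    have h2 := ihx (y.code ++ r) (e (a, b) true).1 (e (a, b) true).2 (.inl true :: d) S _
      (ihy r _ _ d S t (by simpa [Tr.bits] using h))
    refine (Exec.loop_true (l := d) rfl (by simpa using h1) h2).mono ?_
    simp only [Tr.size]
    ring_nf
    omega

theorem exec_scan {cF cT : Cmd} {κ : ℕ}
    (e : List Letter × List Letter → Bool → List Letter × List Letter)
    (hF : ∀ m a b d, Exec cF (st m a b d) (st m (e (a, b) false).1 (e (a, b) false).2 d) κ)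
    (hT : ∀ m a b d, Exec cT (st m a b d) (st m (e (a, b) true).1 (e (a, b) true).2 d) κ) (x : Tr)
    (r a b d : List Letter) :
    Exec (scan cF cT) (st (x.code ++ r) a b d)
      (st r (x.bits.foldl e (a, b)).1 (x.bits.foldl e (a, b)).2 d) (x.size * (κ + 4) + 3) := by
  refine (exec_push_three.seq (exec_push_three.seq (exec_scanLoop hF hT x _ _ _ _ _ 1
    ?_))).mono (by omega)
  simpa [scanLoop] using Exec.loop_end (k := 3) (cF := .skip) (S := st r (x.bits.foldl e (a, b)).1
    (x.bits.foldl e (a, b)).2 (.inr false :: d)) (l := d) (b := false) rfl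

def dropCmd : Cmd := scan .skip .skip

theorem exec_drop (x : Tr) (r a b d : List Letter) :
    Exec dropCmd (st (x.code ++ r) a b d) (st r a b d) (x.size * 5 + 3) := by
  have := exec_scan (κ := 1) (fun s _ => s) (fun _ _ _ _ => .skip _) (fun _ _ _ _ => .skip _)
    x r a b d
  rwa [List.foldl_fixed] at this

/-- Moves a tree to the auxiliary stack, reversed and above a marker. -/
def toAux : Cmd := .seq (.push 1 (.inr false)) (scan (.push 1 (.inl false)) (.push 1 (.inl true)))

def toTmp : Cmd := .seq (.push 2 (.inr false)) (scan (.push 2 (.inl false)) (.push 2 (.inl true)))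

def toBoth : Cmd :=
  .seq (.push 1 (.inr false)) <| .seq (.push 2 (.inr false)) <|
    scan (.seq (.push 1 (.inl false)) (.push 2 (.inl false)))
      (.seq (.push 1 (.inl true)) (.push 2 (.inl true)))

theorem exec_toAux (x : Tr) (r a b d : List Letter) :
    Exec toAux (st (x.code ++ r) a b d) (st r (x.bits.reverse.map .inl ++ .inr false :: a) b d)
      (x.size * 5 + 4) := by
  have := exec_scan (κ := 1) (fun s b => (.inl b :: s.1, s.2)) (fun _ _ _ _ => exec_push_one)
    (fun _ _ _ _ => exec_push_one) x r (.inr false :: a) b d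
  have h : ∀ (l : List Bool) (s : List Letter × List Letter),
      l.foldl (fun s b => (Sum.inl b :: s.1, s.2)) s = (l.reverse.map .inl ++ s.1, s.2) := by
    intro l
    induction l <;> simp_all
  rw [h] at this
  exact (exec_push_one.seq this).mono (by omega)

theorem exec_toTmp (x : Tr) (r a b d : List Letter) :
    Exec toTmp (st (x.code ++ r) a b d) (st r a (x.bits.reverse.map .inl ++ .inr false :: b) d)
      (x.size * 5 + 4) := by
  have := exec_scan (κ := 1) (fun s b => (s.1, .inl b :: s.2)) (fun _ _ _ _ => exec_push_two)
    (fun _ _ _ _ => exec_push_two) x r a (.inr false :: b) d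
  have h : ∀ (l : List Bool) (s : List Letter × List Letter),
      l.foldl (fun s b => (s.1, Sum.inl b :: s.2)) s = (s.1, l.reverse.map .inl ++ s.2) := by
    intro l
    induction l <;> simp_all
  rw [h] at this
  exact (exec_push_two.seq this).mono (by omega)

theorem exec_toBoth (x : Tr) (r a b d : List Letter) :
    Exec toBoth (st (x.code ++ r) a b d) (st r (x.bits.reverse.map .inl ++ .inr false :: a)
      (x.bits.reverse.map .inl ++ .inr false :: b) d) (x.size * 6 + 5) := by
  have := exec_scan (κ := 1 + 1) (fun s b => (.inl b :: s.1, .inl b :: s.2))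
    (fun _ _ _ _ => exec_push_one.seq exec_push_two)
    (fun _ _ _ _ => exec_push_one.seq exec_push_two) x r (.inr false :: a) (.inr false :: b) d
  have h : ∀ (l : List Bool) (s : List Letter × List Letter),
      l.foldl (fun s b => (Sum.inl b :: s.1, Sum.inl b :: s.2)) s =
        (l.reverse.map .inl ++ s.1, l.reverse.map .inl ++ s.2) := by
    intro l
    induction l <;> simp_all
  rw [h] at this
  exact (exec_push_one.seq (exec_push_two.seq this)).mono (by omega)

/-- Trees arrive on the auxiliary stack reversed; popping them reverses once more, and the marker
below stops the loop. -/
def fromAux : Cmd := .loop 1 (.push 0 (.inl false)) (.push 0 (.inl true))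

def fromTmp : Cmd := .loop 2 (.push 0 (.inl false)) (.push 0 (.inl true))

theorem exec_fromAux (l : List Bool) (m a b d : List Letter) :
    Exec fromAux (st m (l.map .inl ++ .inr false :: a) b d) (st (l.reverse.map .inl ++ m) a b d)
      (l.length * 2 + 1) := by
  induction l generalizing m with
  | nil =>
    simpa [fromAux] using Exec.loop_end (k := 1) (cF := .push 0 (.inl false)) (cT := .push 0 (.inl true))
      (S := st m (.inr false :: a) b d) (l := a) (b := false) rfl
  | cons c l ih =>
    have ih := ih (.inl c :: m)
    refine Exec.mono (t := 1 + 1 + (l.length * 2 + 1)) ?_ (by simp; omega)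
    rw [show (List.map Sum.inl (c :: l).reverse ++ m : List Letter) =
      List.map Sum.inl l.reverse ++ Sum.inl c :: m by simp]
    cases c
    · refine Exec.loop_false (l := l.map .inl ++ .inr false :: a) rfl ?_ ih
      simpa using exec_push_zero
    · refine Exec.loop_true (l := l.map .inl ++ .inr false :: a) rfl ?_ ih
      simpa using exec_push_zero

theorem exec_fromTmp (l : List Bool) (m a b d : List Letter) :
    Exec fromTmp (st m a (l.map .inl ++ .inr false :: b) d) (st (l.reverse.map .inl ++ m) a b d)
      (l.length * 2 + 1) := by
  induction l generalizing m with
  | nil =>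
    simpa [fromTmp] using Exec.loop_end (k := 2) (cF := .push 0 (.inl false)) (cT := .push 0 (.inl true))
      (S := st m a (.inr false :: b) d) (l := b) (b := false) rfl
  | cons c l ih =>
    have ih := ih (.inl c :: m)
    refine Exec.mono (t := 1 + 1 + (l.length * 2 + 1)) ?_ (by simp; omega)
    rw [show (List.map Sum.inl (c :: l).reverse ++ m : List Letter) =
      List.map Sum.inl l.reverse ++ Sum.inl c :: m by simp]
    cases c
    · refine Exec.loop_false (l := l.map .inl ++ .inr false :: b) rfl ?_ ih
      simpa using exec_push_zero
    · refine Exec.loop_true (l := l.map .inl ++ .inr false :: b) rfl ?_ ih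
      simpa using exec_push_zero

def dupCmd : Cmd := .seq toBoth (.seq fromAux fromTmp)

theorem exec_dup (x : Tr) (r a b d : List Letter) :
    Exec dupCmd (st (x.code ++ r) a b d) (st (x.code ++ (x.code ++ r)) a b d)
      (x.size * 10 + 7) := by
  have h1 := exec_fromAux x.bits.reverse r a (x.bits.reverse.map .inl ++ .inr false :: b) d
  have h2 := exec_fromTmp x.bits.reverse (x.code ++ r) a b d
  simp only [List.reverse_reverse, List.length_reverse, Tr.length_bits] at h1 h2
  exact ((exec_toBoth x r a b d).seq (h1.seq h2)).mono (by omega)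

def swapCmd : Cmd := .seq toAux (.seq toTmp (.seq fromAux fromTmp))

theorem exec_swap (x y : Tr) (r a b d : List Letter) :
    Exec swapCmd (st (x.code ++ (y.code ++ r)) a b d) (st (y.code ++ (x.code ++ r)) a b d)
      ((x.size + y.size) * 7 + 10) := by
  have h1 := exec_fromAux x.bits.reverse r a (y.bits.reverse.map .inl ++ .inr false :: b) d
  have h2 := exec_fromTmp y.bits.reverse (x.code ++ r) a b d
  simp only [List.reverse_reverse, List.length_reverse, Tr.length_bits] at h1 h2
  exact ((exec_toAux x _ a b d).seq ((exec_toTmp y _ _ _ d).seq (h1.seq h2))).mono (by omega)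

/-! ### Polynomial-time functions on trees -/

/-- The trees `f a` are computed from the trees `e a` in polynomial time by a command that works on
top of the main stack and restores the other stacks. -/
def PolyTr {α : Type} (e f : α → Tr) : Prop :=
  ∃ (c : Cmd) (p : Polynomial ℕ), ∀ x : α, (f x).size ≤ p.eval (e x).size ∧ ∀ r a b d,
    Exec c (st ((e x).code ++ r) a b d) (st ((f x).code ++ r) a b d) (p.eval (e x).size)

namespace PolyTr

variable {α : Type} {e f g h : α → Tr}

/-- Nothing is required of `k`, because time is measured in the tree `e (k x)` on which the command
actually works. This permits restriction to subtypes, as in `ite`. -/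
theorem precomp {β : Type} (hf : PolyTr e f) (k : β → α) :
    PolyTr (fun x => e (k x)) (fun x => f (k x)) := by
  obtain ⟨c, p, hc⟩ := hf
  exact ⟨c, p, fun x => hc (k x)⟩

theorem refl : PolyTr e e :=
  ⟨.skip, Polynomial.X, fun x => ⟨by simp, fun r a b d => (Exec.skip _).mono (by
    have := (e x).size_pos; simp; omega)⟩⟩

theorem trans (hf : PolyTr e f) (hg : PolyTr f g) : PolyTr e g := by
  obtain ⟨c, p, hc⟩ := hg
  obtain ⟨d, q, hd⟩ := hf
  refine ⟨.seq d c, q + p.comp q, fun x => ?_⟩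
  simp only [Polynomial.eval_add, Polynomial.eval_comp]
  have := eval_mono p (hd x).1
  exact ⟨((hc x).1.trans this).trans (by omega), fun r a b e =>
    (((hd x).2 r a b e).seq ((hc x).2 r a b e)).mono (by omega)⟩

theorem nil : PolyTr e fun _ => .nil := by
  refine ⟨.seq dropCmd (.push 0 (.inl false)), 5 * Polynomial.X + 4, fun x => ?_⟩
  simp only [Polynomial.eval_add, Polynomial.eval_mul, Polynomial.eval_X, Polynomial.eval_ofNat]
  exact ⟨by simp [Tr.size], fun r a b d =>
    ((exec_drop (e x) r a b d).seq exec_push_zero).mono (by omega)⟩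

theorem fst : PolyTr (fun x => .node (f x) (g x)) f := by
  refine ⟨.case 0 .skip (.seq swapCmd dropCmd), 12 * Polynomial.X + 14, fun x => ?_⟩
  simp only [Polynomial.eval_add, Polynomial.eval_mul, Polynomial.eval_X, Polynomial.eval_ofNat]
  refine ⟨by simp [Tr.size]; omega, fun r a b d => ?_⟩
  refine (Exec.case_true (l := (f x).code ++ ((g x).code ++ r)) (by simp)
    (t := ((f x).size + (g x).size) * 7 + 10 + ((g x).size * 5 + 3)) ?_).mono ?_
  · simpa using (exec_swap (f x) (g x) r a b d).seq (exec_drop (g x) _ _ _ _)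
  · simp only [Tr.size]; omega

theorem snd : PolyTr (fun x => .node (f x) (g x)) g := by
  refine ⟨.case 0 .skip dropCmd, 12 * Polynomial.X + 14, fun x => ?_⟩
  simp only [Polynomial.eval_add, Polynomial.eval_mul, Polynomial.eval_X, Polynomial.eval_ofNat]
  refine ⟨by simp [Tr.size]; omega, fun r a b d => ?_⟩
  refine (Exec.case_true (l := (f x).code ++ ((g x).code ++ r)) (by simp)
    (t := (f x).size * 5 + 3) ?_).mono ?_
  · simpa using exec_drop (f x) _ _ _ _
  · simp only [Tr.size]; omega

theorem node (hf : PolyTr e f) (hg : PolyTr e g) : PolyTr e fun x => .node (f x) (g x) := by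
  obtain ⟨c, p, hc⟩ := hf
  obtain ⟨d, q, hd⟩ := hg
  refine ⟨.seq dupCmd (.seq c (.seq swapCmd (.seq d (.seq swapCmd (.push 0 (.inl true)))))),
    17 * Polynomial.X + 15 * p + 8 * q + 28, fun x => ?_⟩
  simp only [Polynomial.eval_add, Polynomial.eval_mul, Polynomial.eval_X, Polynomial.eval_ofNat]
  have hp := (hc x).1
  have hq := (hd x).1
  refine ⟨by simp only [Tr.size]; omega, fun r a b s => ?_⟩
  have := ((exec_dup (e x) r a b s).seq (((hc x).2 ((e x).code ++ r) a b s).seq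
    ((exec_swap (f x) (e x) r a b s).seq (((hd x).2 ((f x).code ++ r) a b s).seq
    ((exec_swap (g x) (f x) r a b s).seq (exec_push_zero (s := .inl true)))))))
  rw [show (Tr.node (f x) (g x)).code ++ r = .inl true :: ((f x).code ++ ((g x).code ++ r)) by
    simp]
  exact this.mono (by omega)

/-- Case distinction; the hypotheses on the branches need to cover their cases only. -/
theorem ite (hf : PolyTr e f)
    (hg : PolyTr (fun x : {x // f x = .nil} => e x) (fun x => h x))
    (hh : PolyTr (fun x : {x // f x ≠ .nil} => e x) (fun x => h x)) : PolyTr e h := by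
  obtain ⟨c, p, hc⟩ := hf
  obtain ⟨d, q, hd⟩ := hg
  obtain ⟨c', o, he⟩ := hh
  refine ⟨.seq dupCmd (.seq c (.case 0 d (.seq dropCmd (.seq dropCmd c')))),
    10 * Polynomial.X + 6 * p + q + o + 14, fun x => ?_⟩
  simp only [Polynomial.eval_add, Polynomial.eval_mul, Polynomial.eval_X, Polynomial.eval_ofNat]
  have hp := (hc x).1
  rcases hy : f x with _ | ⟨y, z⟩
  · have hd := hd ⟨x, hy⟩
    have hq := hd.1
    refine ⟨by simp only at hq; omega, fun r a b z => ?_⟩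
    refine ((exec_dup (e x) r a b z).seq (((hc x).2 ((e x).code ++ r) a b z).seq
      (Exec.case_false (l := (e x).code ++ r) (by simp [hy]) (t := q.eval (e x).size) ?_))).mono
      (by omega)
    simpa using hd.2 r a b z
  · have he := he ⟨x, by simp [hy]⟩
    have ho := he.1
    refine ⟨by simp only at ho; omega, fun r a b w => ?_⟩
    refine ((exec_dup (e x) r a b w).seq (((hc x).2 ((e x).code ++ r) a b w).seq
      (Exec.case_true (l := y.code ++ (z.code ++ ((e x).code ++ r))) (by simp [hy])
      (t := y.size * 5 + 3 + (z.size * 5 + 3 + o.eval (e x).size)) ?_))).mono ?_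
    · simpa using (exec_drop y _ a b w).seq ((exec_drop z _ a b w).seq (he.2 r a b w))
    · simp only [hy, Tr.size] at hp; omega

/-- Iterate `F` on the second component as often as the size of the first one. -/
theorem iterate {σ : Type} {s : σ → Tr} {F : σ → σ} (hF : PolyTr s fun x => s (F x))
    (n : α → Tr) (y : α → σ) (q : Polynomial ℕ)
    (hq : ∀ a k, k ≤ (n a).size →
      (s (F^[k] (y a))).size ≤ q.eval (Tr.node (n a) (s (y a))).size) :
    PolyTr (fun a => .node (n a) (s (y a))) (fun a => s (F^[(n a).size] (y a))) := by
  obtain ⟨c, p, hc⟩ := hF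
  have hloop : ∀ (B : ℕ) (l : List Bool) (y : σ) (r a b d : List Letter),
      (∀ k ≤ l.length, (s (F^[k] y)).size ≤ B) →
      Exec (.loop 1 c c) (st ((s y).code ++ r) (l.map .inl ++ .inr false :: a) b d)
        (st ((s (F^[l.length] y)).code ++ r) a b d) (l.length * (p.eval B + 1) + 1) := by
    intro B l
    induction l with
    | nil =>
      intro y r a b d _
      simpa using Exec.loop_end (k := 1) (cF := c) (cT := c)
        (S := st ((s y).code ++ r) (.inr false :: a) b d) (l := a) (b := false) rfl
    | cons u l ih =>
      intro y r a b d hB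
      have h1 := ((hc y).2 r (l.map .inl ++ .inr false :: a) b d).mono
        (eval_mono p (hB 0 (by omega)))
      have h2 := ih (F y) r a b d fun k hk => hB (k + 1) (by simpa using hk)
      refine Exec.mono (t := p.eval B + 1 + (l.length * (p.eval B + 1) + 1)) ?_ (by
        simp only [List.length_cons]; ring_nf; omega)
      cases u
      · exact Exec.loop_false (l := l.map .inl ++ .inr false :: a) rfl (by simpa using h1) h2
      · exact Exec.loop_true (l := l.map .inl ++ .inr false :: a) rfl (by simpa using h1) h2
  -- The bits of the first component serve as a clock only: both branches of the loop run `c`, so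
  -- `c` is run once per bit. The hypothesis `hq` is needed since iterating a polynomial-time
  -- function may produce trees of exponential size.
  refine ⟨.case 0 .skip (.seq toAux (.loop 1 c c)),
    q + Polynomial.X * (p.comp q + 1) + 5 * Polynomial.X + 6, fun x => ?_⟩
  simp only [Polynomial.eval_add, Polynomial.eval_mul, Polynomial.eval_X, Polynomial.eval_ofNat,
    Polynomial.eval_comp, Polynomial.eval_one]
  have hB := hq x
  refine ⟨(hB _ le_rfl).trans (by omega), fun r a b d => ?_⟩
  have h := hloop (q.eval (Tr.node (n x) (s (y x))).size) (n x).bits.reverse (y x) r a b d (by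
    simpa [Tr.length_bits] using hB)
  rw [List.length_reverse, Tr.length_bits] at h
  refine (Exec.case_true (l := (n x).code ++ ((s (y x)).code ++ r)) (by simp)
    (by simpa using (exec_toAux (n x) _ a b d).seq h)).mono ?_
  have : (n x).size * (p.eval (q.eval (Tr.node (n x) (s (y x))).size) + 1) ≤
      (Tr.node (n x) (s (y x))).size * (p.eval (q.eval (Tr.node (n x) (s (y x))).size) + 1) :=
    Nat.mul_le_mul_right _ (by simp [Tr.size]; omega)
  simp only [Tr.size] at *
  omega

end PolyTr

end SymmetryBreaking

/-! ### A calculus of polynomial-time functions on encoded data, and its verifiers -/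

namespace SymmetryBreaking

/-! ### Polynomial-time functions on encoded types -/

class Enc (α : Type) where
  tr : α → Tr
  inj : Function.Injective tr

def enc {α : Type} [Enc α] (a : α) : Tr := Enc.tr a

theorem enc_inj {α : Type} [Enc α] {a b : α} : enc a = enc b ↔ a = b := Enc.inj.eq_iff

abbrev esize {α : Type} [Enc α] (a : α) : ℕ := (enc a).size

section instances
variable {α β : Type} [Enc α] [Enc β]

instance : Enc Unit := ⟨fun _ => .nil, fun _ _ _ => rfl⟩

instance : Enc Bool := ⟨fun b => bif b then .node .nil .nil else .nil, fun a b => by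
  cases a <;> cases b <;> simp⟩

instance : Enc (α × β) := ⟨fun p => .node (enc p.1) (enc p.2), fun p q h => by
  simp only [Tr.node.injEq, enc_inj] at h
  exact Prod.ext h.1 h.2⟩

/-- A list is the right spine of a tree, so that `cons` is `Tr.node` and distinguishing the empty
list is a test for `Tr.nil`. -/
def encList : List α → Tr
  | [] => .nil
  | a :: l => .node (enc a) (encList l)

instance : Enc (List α) := ⟨encList, fun l => by
  induction l with
  | nil => intro m h; cases m <;> simp_all [encList]
  | cons a l ih =>
    intro m h
    cases m with
    | nil => simp [encList] at h
    | cons b m =>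
      simp only [encList, Tr.node.injEq, enc_inj] at h
      rw [h.1, ih h.2]⟩

/-- Numbers are in unary, so arithmetic reduces to operations on lists and a number bounds the size
of its own code. -/
instance : Enc ℕ := ⟨fun n => enc (List.replicate n ()), fun m n h => by
  simpa using congrArg List.length (enc_inj.1 h)⟩

@[simp] theorem enc_false : enc false = .nil := rfl
@[simp] theorem enc_true : enc true = .node .nil .nil := rfl
@[simp] theorem enc_unit (u : Unit) : enc u = .nil := rfl
@[simp] theorem enc_pair (a : α) (b : β) : enc (a, b) = .node (enc a) (enc b) := rfl
@[simp] theorem enc_list_nil : enc ([] : List α) = .nil := rfl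
@[simp] theorem enc_list_cons (a : α) (l : List α) : enc (a :: l) = .node (enc a) (enc l) := rfl
theorem enc_nat (n : ℕ) : enc n = enc (List.replicate n ()) := rfl

theorem esize_pair (a : α) (b : β) : esize (a, b) = 1 + esize a + esize b := rfl
theorem esize_cons (a : α) (l : List α) : esize (a :: l) = 1 + esize a + esize l := rfl
theorem esize_bool_le (b : Bool) : esize b ≤ 3 := by cases b <;> simp [esize, Tr.size]

theorem esize_append (l m : List α) : esize (l ++ m) + 1 = esize l + esize m := by
  induction l with
  | nil => simp [esize, Tr.size]; omega
  | cons a l ih => simp only [List.cons_append, esize_cons]; omega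

theorem esize_reverse (l : List α) : esize l.reverse = esize l := by
  induction l with
  | nil => rfl
  | cons a l ih =>
    have := esize_append l.reverse [a]
    have h1 : esize [a] = 1 + esize a + 1 := rfl
    rw [List.reverse_cons, esize_cons]
    omega

theorem esize_le_of_mem {a : α} {l : List α} (h : a ∈ l) : esize a ≤ esize l := by
  induction h with
  | head l => rw [esize_cons]; omega
  | tail b _ ih => rw [esize_cons]; omega

theorem length_le_esize (l : List α) : l.length ≤ esize l := by
  induction l with
  | nil => simp
  | cons a l ih => rw [esize_cons, List.length_cons]; omega

theorem esize_list_le {l : List α} {B : ℕ} (h : ∀ a ∈ l, esize a ≤ B) :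
    esize l ≤ l.length * (B + 1) + 1 := by
  induction l with
  | nil => simp [esize, Tr.size]
  | cons a l ih =>
    have h1 := h a (by simp)
    have h2 := ih fun b hb => h b (by simp [hb])
    rw [esize_cons, List.length_cons]
    ring_nf at *
    omega

theorem esize_sublist {l m : List α} (h : l.Sublist m) : esize l ≤ esize m := by
  induction h with
  | slnil => rfl
  | cons a _ ih => rw [esize_cons]; omega
  | cons_cons a _ ih => rw [esize_cons, esize_cons]; omega

theorem esize_nat (n : ℕ) : esize n = 2 * n + 1 := by
  induction n with
  | zero => rfl
  | succ n ih =>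
    change esize (() :: List.replicate n ()) = _
    rw [esize_cons]
    have : esize n = esize (List.replicate n ()) := rfl
    have : esize () = 1 := rfl
    omega

end instances

/-- `f` is computed in polynomial time. -/
@[fun_prop]
def Poly {α β : Type} [Enc α] [Enc β] (f : α → β) : Prop := PolyTr enc fun a => enc (f a)

namespace Poly

variable {α β γ δ σ : Type} [Enc α] [Enc β] [Enc γ] [Enc δ] [Enc σ]

@[fun_prop] theorem id : Poly fun a : α => a := PolyTr.refl

@[fun_prop] theorem comp {f : β → γ} {g : α → β} (hf : Poly f) (hg : Poly g) :
    Poly fun a => f (g a) :=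
  hg.trans (PolyTr.precomp hf g)

@[fun_prop] theorem const (b : β) : Poly fun _ : α => b := by
  have : ∀ x : Tr, PolyTr (enc : α → Tr) fun _ => x := by
    intro x
    induction x with
    | nil => exact PolyTr.nil
    | node x y hx hy => exact PolyTr.node hx hy
  exact this _

@[fun_prop] theorem pair {f : α → β} {g : α → γ} (hf : Poly f) (hg : Poly g) :
    Poly fun a => (f a, g a) :=
  PolyTr.node hf hg

@[fun_prop] theorem fst : Poly (Prod.fst : α × β → α) := PolyTr.fst

@[fun_prop] theorem snd : Poly (Prod.snd : α × β → β) := PolyTr.snd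

theorem esize_le {f : α → β} (hf : Poly f) :
    ∃ p : Polynomial ℕ, ∀ a, esize (f a) ≤ p.eval (esize a) := by
  obtain ⟨_, p, h⟩ := hf
  exact ⟨p, fun a => (h a).1⟩

@[fun_prop] theorem cond {b : α → Bool} {f g : α → β} (hb : Poly b) (hf : Poly f) (hg : Poly g) :
    Poly fun a => bif b a then f a else g a := by
  refine PolyTr.ite hb ?_ ?_
  · have : ∀ x : {x // enc (b x) = .nil}, b x = false := fun ⟨x, hx⟩ => by
      cases h : b x <;> simp_all
    simp only [this, cond_false]
    exact PolyTr.precomp hg _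
  · have : ∀ x : {x // enc (b x) ≠ .nil}, b x = true := fun ⟨x, hx⟩ => by
      cases h : b x <;> simp_all
    simp only [this, cond_true]
    exact PolyTr.precomp hf _

@[fun_prop] theorem and {f g : α → Bool} (hf : Poly f) (hg : Poly g) :
    Poly fun a => f a && g a := by
  have : ∀ a, (f a && g a) = bif f a then g a else false := fun a => by cases f a <;> rfl
  simp only [this]
  fun_prop

@[fun_prop] theorem or {f g : α → Bool} (hf : Poly f) (hg : Poly g) :
    Poly fun a => f a || g a := by
  have : ∀ a, (f a || g a) = bif f a then true else g a := fun a => by cases f a <;> rfl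
  simp only [this]
  fun_prop

@[fun_prop] theorem not {f : α → Bool} (hf : Poly f) : Poly fun a => !f a := by
  have : ∀ a, (!f a) = bif f a then false else true := fun a => by cases f a <;> rfl
  simp only [this]
  fun_prop

@[fun_prop] theorem cons {f : α → β} {g : α → List β} (hf : Poly f) (hg : Poly g) :
    Poly fun a => f a :: g a :=
  PolyTr.node hf hg

/-- Case distinction on a list. -/
theorem listCases {l : α → List β} {f : α → γ} {g : α → β → List β → γ} {h : α → γ} (hl : Poly l)
    (hf : Poly f) (hg : Poly fun p : α × β × List β => g p.1 p.2.1 p.2.2)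
    (h_nil : ∀ a, l a = [] → h a = f a) (h_cons : ∀ a b t, l a = b :: t → h a = g a b t) :
    Poly h := by
  refine PolyTr.ite hl ?_ ?_
  · have : ∀ x : {x // enc (l x) = .nil}, h x = f x := fun ⟨x, hx⟩ => h_nil x (by
      cases hx' : l x <;> simp_all)
    simp only [this]
    exact PolyTr.precomp hf _
  · have : ∀ x : {x // enc (l x) ≠ .nil}, ∃ b t, l x = b :: t := fun ⟨x, hx⟩ => by
      cases hx' : l x <;> simp_all
    choose b t hbt using this
    have h1 : ∀ x : {x // enc (l x) ≠ .nil}, h x = g x (b x) (t x) := fun x =>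
      h_cons _ _ _ (hbt x)
    simp only [h1]
    have h2 : PolyTr (fun x : {x // enc (l x) ≠ .nil} => enc x.1)
        fun x => .node (enc (b x)) (enc (t x)) := by
      have := PolyTr.precomp hl (fun x : {x // enc (l x) ≠ .nil} => x.1)
      simpa only [hbt, enc_list_cons] using this
    refine PolyTr.trans (PolyTr.node PolyTr.refl (PolyTr.node (h2.trans PolyTr.fst)
      (h2.trans PolyTr.snd))) ?_
    exact PolyTr.precomp hg (fun x => (x.1, b x, t x))

@[fun_prop] theorem tail {l : α → List β} (hl : Poly l) : Poly fun a => (l a).tail :=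
  listCases (f := fun _ => []) (g := fun _ _ t => t) hl (by fun_prop) (by fun_prop)
    (by simp_all) (by simp_all)

@[fun_prop] theorem headD {l : α → List β} {d : α → β} (hl : Poly l) (hd : Poly d) :
    Poly fun a => (l a).headD (d a) :=
  listCases (f := d) (g := fun _ b _ => b) hl (by fun_prop) (by fun_prop)
    (by simp_all) (by simp_all)

@[fun_prop] theorem isEmpty {l : α → List β} (hl : Poly l) : Poly fun a => (l a).isEmpty :=
  listCases (f := fun _ => true) (g := fun _ _ _ => false) hl (by fun_prop) (by fun_prop)
    (by simp_all) (by simp_all)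

/-- The argument `a` is carried along in the state. Otherwise the size of the starting state need
not bound `esize a`, in terms of which the bound `q` is stated. -/
theorem iterate {f : σ → σ} (hf : Poly f) {n : α → β} {i : α → σ} (hn : Poly n) (hi : Poly i)
    (q : Polynomial ℕ) (hq : ∀ a k, k ≤ esize (n a) → esize (f^[k] (i a)) ≤ q.eval (esize a)) :
    Poly fun a => f^[esize (n a)] (i a) := by
  refine PolyTr.trans (f := fun a => enc (a, n a, i a)) (pair id (pair hn hi)) ?_
  refine PolyTr.trans (f := fun a : α => .node (enc (n a)) (enc (a, i a))) ?_ ?_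
  · exact PolyTr.precomp (pair (α := α × β × σ) (f := fun x => x.2.1) (g := fun x => (x.1, x.2.2))
      (by fun_prop) (by fun_prop)) fun a => (a, n a, i a)
  have h := PolyTr.iterate (s := fun x : α × σ => enc x) (F := fun x => (x.1, f x.2))
    (pair (by fun_prop) (by fun_prop)) (fun a => enc (n a)) (fun a => (a, i a))
    (Polynomial.X + q + 1) (by
      intro a k hk
      have : (fun x : α × σ => (x.1, f x.2))^[k] (a, i a) = (a, f^[k] (i a)) := by
        clear hk
        induction k with
        | zero => rfl
        | succ k ih => rw [Function.iterate_succ_apply', Function.iterate_succ_apply', ih]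
      rw [this]
      have h1 := hq a k hk
      have h2 : esize a ≤ (Tr.node (enc (n a)) (enc (a, i a))).size := by
        simp only [esize, enc_pair, Tr.size]; omega
      have h3 := eval_mono q h2
      simp only [esize, enc_pair, Tr.size, Polynomial.eval_add, Polynomial.eval_X,
        Polynomial.eval_one] at *
      omega)
  refine h.trans ?_
  have : ∀ a k, (fun x : α × σ => (x.1, f x.2))^[k] (a, i a) = (a, f^[k] (i a)) := by
    intro a k
    induction k with
    | zero => rfl
    | succ k ih => rw [Function.iterate_succ_apply', Function.iterate_succ_apply', ih]
  simp only [this]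
  exact PolyTr.snd

/-- Iterates a step that consumes one element of the list. The clock `esize (l a)` is at least the
length of the list, and the surplus rounds do nothing. The intermediate states are the folds over
prefixes, which is why these have to be bounded. -/
theorem foldl {l : α → List β} {i : α → σ} {h : α → σ → β → σ} (hl : Poly l) (hi : Poly i)
    (hh : Poly fun p : α × σ × β => h p.1 p.2.1 p.2.2) (q : Polynomial ℕ)
    (hq : ∀ a l', l' <+: l a → esize (l'.foldl (h a) (i a)) ≤ q.eval (esize a)) :
    Poly fun a => (l a).foldl (h a) (i a) := by
  let step : α × List β × σ → α × List β × σ := fun x =>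
    match x.2.1 with
    | [] => x
    | b :: t => (x.1, t, h x.1 x.2.2 b)
  have hstep : Poly step :=
    listCases (l := fun x : α × List β × σ => x.2.1) (f := fun x => x)
      (g := fun x b t => (x.1, t, h x.1 x.2.2 b)) (by fun_prop) (by fun_prop) (by fun_prop)
      (fun a ha => by simp only [step, ha]) (fun a b t ha => by simp only [step, ha])
  have hiter : ∀ a k (l : List β) s, step^[k] (a, l, s) =
      (a, l.drop k, (l.take k).foldl (h a) s) := by
    intro a k
    induction k with
    | zero => simp
    | succ k ih =>
      intro l s
      rw [Function.iterate_succ_apply]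
      cases l with
      | nil => simp only [step]; rw [ih]; simp
      | cons b t => simp only [step]; rw [ih]; simp
  obtain ⟨p, hp⟩ := hl.esize_le
  have := iterate hstep (n := l) (i := fun a => (a, l a, i a)) hl (by fun_prop)
    (Polynomial.X + p + q + 2) (by
      intro a k _
      rw [hiter]
      have h1 := esize_sublist (List.drop_sublist k (l a))
      have h2 := hp a
      have h3 := hq a _ (List.take_prefix k (l a))
      simp only [esize_pair, Polynomial.eval_add, Polynomial.eval_X, Polynomial.eval_ofNat]
      omega)
  simp only [hiter] at this
  have h1 : ∀ a, (l a).take (esize (l a)) = l a := fun a =>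
    List.take_of_length_le (length_le_esize _)
  simp only [h1] at this
  exact comp (f := fun x : α × List β × σ => x.2.2) (by fun_prop) this

@[fun_prop] theorem reverse {l : α → List β} (hl : Poly l) : Poly fun a => (l a).reverse := by
  obtain ⟨p, hp⟩ := hl.esize_le
  have h : ∀ l acc : List β, l.foldl (fun acc b => b :: acc) acc = l.reverse ++ acc := by
    intro l
    induction l <;> simp_all
  have := foldl (i := fun _ => []) (h := fun _ acc b => b :: acc) hl (by fun_prop) (by fun_prop) p
    (by
      intro a l' hl'
      rw [h, List.append_nil, esize_reverse]
      exact (esize_sublist hl'.sublist).trans (hp a))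
  simpa only [h, List.append_nil] using this

theorem foldr {l : α → List β} {i : α → σ} {h : α → β → σ → σ} (hl : Poly l) (hi : Poly i)
    (hh : Poly fun p : α × β × σ => h p.1 p.2.1 p.2.2) (q : Polynomial ℕ)
    (hq : ∀ a l', l' <:+ l a → esize (l'.foldr (h a) (i a)) ≤ q.eval (esize a)) :
    Poly fun a => (l a).foldr (h a) (i a) := by
  have := foldl (l := fun a => (l a).reverse) (i := i) (h := fun a s b => h a b s) (by fun_prop) hi
    (comp (f := fun p : α × β × σ => h p.1 p.2.1 p.2.2)
      (g := fun p : α × σ × β => (p.1, p.2.2, p.2.1)) hh (by fun_prop)) q (by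
      intro a l' hl'
      have := hq a l'.reverse (by simpa using List.reverse_suffix.2 hl')
      rwa [List.foldr_reverse] at this)
  simpa only [List.foldl_reverse] using this

@[fun_prop] theorem append {f g : α → List β} (hf : Poly f) (hg : Poly g) :
    Poly fun a => f a ++ g a := by
  obtain ⟨p, hp⟩ := hf.esize_le
  obtain ⟨q, hq⟩ := hg.esize_le
  have := foldr (l := f) (i := g) (h := fun _ b s => b :: s) hf hg (by fun_prop) (p + q) (by
    intro a l' hl'
    rw [List.foldr_cons_eq_append]
    have h1 := esize_append (l'.map fun b => b) (g a)
    have h2 := esize_sublist hl'.sublist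
    have h3 := hp a
    have h4 := hq a
    simp only [List.map_id', Polynomial.eval_add] at *
    omega)
  convert this using 2 with a
  simp

@[fun_prop] theorem map {g : α → β → γ} {l : α → List β} (hl : Poly l)
    (hg : Poly fun p : α × β => g p.1 p.2) : Poly fun a => (l a).map (g a) := by
  obtain ⟨p, hp⟩ := hl.esize_le
  obtain ⟨q, hq⟩ := hg.esize_le
  have h : ∀ (a : α) (l : List β), l.foldr (fun b s => g a b :: s) [] = l.map (g a) := by
    intro a l
    induction l <;> simp_all
  have := foldr (l := l) (i := fun _ => []) (h := fun a b s => g a b :: s) hl (by fun_prop)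
    (by fun_prop) (p * (q.comp (Polynomial.X + p + 1) + 1) + 1) (by
      intro a l' hl'
      rw [h]
      have h1 : ∀ c ∈ l'.map (g a), esize c ≤ q.eval (esize a + p.eval (esize a) + 1) := by
        intro c hc
        obtain ⟨b, hb, rfl⟩ := List.mem_map.1 hc
        refine (hq (a, b)).trans (eval_mono q ?_)
        have := (esize_le_of_mem (hl'.sublist.subset hb)).trans (hp a)
        rw [esize_pair]
        omega
      refine (esize_list_le h1).trans ?_
      have h2 : (l'.map (g a)).length ≤ p.eval (esize a) := by
        rw [List.length_map]
        exact (hl'.length_le.trans (length_le_esize _)).trans (hp a)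
      simp only [Polynomial.eval_add, Polynomial.eval_mul, Polynomial.eval_comp,
        Polynomial.eval_X, Polynomial.eval_one]
      exact Nat.add_le_add_right (Nat.mul_le_mul_right _ h2) 1)
  simpa only [h] using this

@[fun_prop] theorem flatten {l : α → List (List β)} (hl : Poly l) :
    Poly fun a => (l a).flatten := by
  obtain ⟨p, hp⟩ := hl.esize_le
  have h : ∀ l : List (List β), l.foldr (fun b s => b ++ s) [] = l.flatten := by
    intro l
    induction l <;> simp_all
  have h' : ∀ l : List (List β), esize l.flatten ≤ esize l := by
    intro l
    induction l with
    | nil => rfl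
    | cons b l ih =>
      rw [List.flatten_cons, esize_cons]
      have := esize_append b l.flatten
      omega
  have := foldr (l := l) (i := fun _ => []) (h := fun _ b s => b ++ s) hl (by fun_prop)
    (by fun_prop) p (by
      intro a l' hl'
      rw [h]
      exact ((h' l').trans (esize_sublist hl'.sublist)).trans (hp a))
  simpa only [h] using this

@[fun_prop] theorem flatMap {g : α → β → List γ} {l : α → List β} (hl : Poly l)
    (hg : Poly fun p : α × β => g p.1 p.2) : Poly fun a => (l a).flatMap (g a) := by
  simp only [List.flatMap]
  fun_prop

theorem foldlBool {l : α → List β} {i : α → Bool} {h : α → Bool → β → Bool} (hl : Poly l)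
    (hi : Poly i) (hh : Poly fun p : α × Bool × β => h p.1 p.2.1 p.2.2) :
    Poly fun a => (l a).foldl (h a) (i a) :=
  foldl hl hi hh 3 fun _ _ _ => (esize_bool_le _).trans (by simp)

@[fun_prop] theorem all {g : α → β → Bool} {l : α → List β} (hl : Poly l)
    (hg : Poly fun p : α × β => g p.1 p.2) : Poly fun a => (l a).all (g a) := by
  have h : ∀ (a : α) (l : List β) (c : Bool), l.foldl (fun c b => c && g a b) c =
      (c && l.all (g a)) := by
    intro a l
    induction l with
    | nil => simp
    | cons b l ih => intro c; rw [List.foldl_cons, ih, List.all_cons, Bool.and_assoc]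
  have := foldlBool (i := fun _ => true) (h := fun a c b => c && g a b) hl (by fun_prop)
    (by fun_prop)
  simpa only [h, Bool.true_and] using this

@[fun_prop] theorem any {g : α → β → Bool} {l : α → List β} (hl : Poly l)
    (hg : Poly fun p : α × β => g p.1 p.2) : Poly fun a => (l a).any (g a) := by
  have h : ∀ (a : α) (l : List β) (c : Bool), l.foldl (fun c b => c || g a b) c =
      (c || l.any (g a)) := by
    intro a l
    induction l with
    | nil => simp
    | cons b l ih => intro c; rw [List.foldl_cons, ih, List.any_cons, Bool.or_assoc]
  have := foldlBool (i := fun _ => false) (h := fun a c b => c || g a b) hl (by fun_prop)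
    (by fun_prop)
  simpa only [h, Bool.false_or] using this

/-! #### Numbers -/

@[fun_prop] theorem replicate_unit {n : α → ℕ} (hn : Poly n) :
    Poly fun a => List.replicate (n a) () := hn

@[fun_prop] theorem length {l : α → List β} (hl : Poly l) : Poly fun a => (l a).length := by
  have : Poly fun a => (l a).map fun _ => () := by fun_prop
  simpa only [List.map_const', Poly, ← enc_nat] using this

@[fun_prop] theorem replicate {n : α → ℕ} {f : α → β} (hn : Poly n) (hf : Poly f) :
    Poly fun a => List.replicate (n a) (f a) := by
  have : Poly fun a => (List.replicate (n a) ()).map fun _ => f a := by fun_prop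
  simpa only [List.map_replicate] using this

@[fun_prop] theorem add {m n : α → ℕ} (hm : Poly m) (hn : Poly n) : Poly fun a => m a + n a := by
  have : Poly fun a => (List.replicate (m a) () ++ List.replicate (n a) ()).length := by fun_prop
  simpa only [List.length_append, List.length_replicate] using this

@[fun_prop] theorem mul {m n : α → ℕ} (hm : Poly m) (hn : Poly n) : Poly fun a => m a * n a := by
  have : Poly fun a => ((List.replicate (m a) ()).flatMap
    fun _ => List.replicate (n a) ()).length := by fun_prop
  simpa [List.length_flatMap] using this

@[fun_prop] theorem drop {n : α → ℕ} {l : α → List β} (hn : Poly n) (hl : Poly l) :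
    Poly fun a => (l a).drop (n a) := by
  obtain ⟨p, hp⟩ := hl.esize_le
  have h : ∀ (k : ℕ) (l : List β), (List.replicate k ()).foldl (fun l _ => l.tail) l =
      l.drop k := by
    intro k
    induction k with
    | zero => simp
    | succ k ih =>
      intro l
      rw [List.replicate_succ, List.foldl_cons, ih, List.drop_tail]
  have := foldl (l := fun a => List.replicate (n a) ()) (i := l) (h := fun _ l _ => l.tail)
    (by fun_prop) hl (by fun_prop) p (by
      intro a l' _
      rw [List.eq_replicate_of_mem (a := ()) (l := l') (by simp), h]
      exact (esize_sublist (List.drop_sublist _ _)).trans (hp a))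
  simpa only [h] using this

@[fun_prop] theorem getD {n : α → ℕ} {l : α → List β} {d : α → β} (hl : Poly l) (hn : Poly n)
    (hd : Poly d) : Poly fun a => (l a).getD (n a) (d a) := by
  have h : ∀ (l : List β) (k : ℕ) (d : β), l.getD k d = (l.drop k).headD d := by
    intro l
    induction l with
    | nil => simp
    | cons b l ih =>
      intro k d
      cases k with
      | zero => rfl
      | succ k => simp
  simp only [h]
  fun_prop

@[fun_prop] theorem range {n : α → ℕ} (hn : Poly n) : Poly fun a => List.range (n a) := by
  have h : ∀ k, (List.replicate k ()).foldr (fun _ (s : List ℕ) => s ++ [s.length]) [] =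
      List.range k := by
    intro k
    induction k with
    | zero => rfl
    | succ k ih => rw [List.replicate_succ, List.foldr_cons, ih, List.range_succ,
        List.length_range]
  obtain ⟨p, hp⟩ := hn.esize_le
  have := foldr (l := fun a => List.replicate (n a) ()) (i := fun _ => [])
    (h := fun _ _ (s : List ℕ) => s ++ [s.length]) (by fun_prop) (by fun_prop) (by fun_prop)
    (p * (2 * p + 2) + 1) (by
      intro a l' hl'
      rw [List.eq_replicate_of_mem (a := ()) (l := l') (by simp), h]
      have h1 : l'.length ≤ p.eval (esize a) := by
        have h2 := hl'.length_le
        rw [List.length_replicate] at h2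
        have h3 := hp a
        rw [esize_nat] at h3
        omega
      refine (esize_list_le (B := 2 * p.eval (esize a) + 1) fun k hk => ?_).trans ?_
      · rw [List.mem_range] at hk
        rw [esize_nat]
        omega
      · rw [List.length_range]
        simp only [Polynomial.eval_add, Polynomial.eval_mul, Polynomial.eval_ofNat,
          Polynomial.eval_one]
        exact Nat.add_le_add_right (Nat.mul_le_mul_right _ h1) 1)
  simpa only [h] using this

theorem eval_polynomial (p : Polynomial ℕ) {n : α → ℕ} (hn : Poly n) :
    Poly fun a => p.eval (n a) := by
  induction p using Polynomial.induction_on' with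
  | add p q hp hq => simp only [Polynomial.eval_add]; fun_prop
  | monomial k c =>
    simp only [Polynomial.eval_monomial]
    suffices Poly fun a => n a ^ k by fun_prop
    induction k with
    | zero => simp only [pow_zero]; fun_prop
    | succ k ih => simp only [pow_succ]; fun_prop

end Poly

/-! ### Equality -/

open Classical in
/-- Equality on `α` can be decided in polynomial time. -/
class PolyEq (α : Type) [Enc α] : Prop where
  eq : Poly fun p : α × α => decide (p.1 = p.2)

section equality
variable {α β : Type} [Enc α] [Enc β]

@[fun_prop] theorem Poly.decide_eq [PolyEq β] {f g : α → β} [∀ a, Decidable (f a = g a)]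
    (hf : Poly f) (hg : Poly g) : Poly fun a => decide (f a = g a) := by
  have := Poly.comp (g := fun a => (f a, g a)) (PolyEq.eq (α := β)) (by fun_prop)
  convert this

instance : PolyEq Unit := ⟨by
  have : Poly fun _ : Unit × Unit => true := by fun_prop
  simpa using this⟩

instance : PolyEq Bool := ⟨by
  have : Poly fun p : Bool × Bool => bif p.1 then p.2 else !p.2 := by fun_prop
  convert this using 2 with p
  rcases p with ⟨_ | _, _ | _⟩ <;> simp⟩

open Classical in
/-- One step of the comparison of two lists: compares with the head of the remaining list. -/
noncomputable def eqStep (s : Bool × List α) (a : α) : Bool × List α :=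
  match s.2 with
  | [] => (false, [])
  | b :: t => (s.1 && decide (a = b), t)

/-- If the second list is too short, the flag turns false and stays so; if it is too long, the
remainder is not empty. -/
theorem foldl_eqStep {α : Type} (l : List α) (s : Bool × List α) :
    ((l.foldl eqStep s).1 && (l.foldl eqStep s).2.isEmpty) = true ↔ s.1 = true ∧ l = s.2 := by
  induction l generalizing s with
  | nil => rcases s with ⟨_, _ | _⟩ <;> simp
  | cons a l ih =>
    rw [List.foldl_cons, ih]
    rcases s with ⟨c, _ | ⟨b, t⟩⟩ <;> simp [eqStep, and_assoc]

theorem esize_foldl_eqStep (l : List α) (s : Bool × List α) :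
    esize (l.foldl eqStep s) ≤ esize s + 3 := by
  suffices h : esize (l.foldl eqStep s) ≤ 4 + esize s.2 by
    have : esize s = 1 + esize s.1 + esize s.2 := rfl
    omega
  induction l generalizing s with
  | nil =>
    have : esize s = 1 + esize s.1 + esize s.2 := rfl
    have := esize_bool_le s.1
    simp only [List.foldl_nil]
    omega
  | cons a l ih =>
    rw [List.foldl_cons]
    refine (ih _).trans ?_
    rcases s with ⟨c, _ | ⟨b, t⟩⟩
    · simp [eqStep]
    · simp only [eqStep, esize_cons]
      omega

instance [PolyEq α] : PolyEq (List α) := ⟨by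
  classical
  have hstep : Poly fun p : (List α × List α) × (Bool × List α) × α => eqStep p.2.1 p.2.2 :=
    Poly.listCases (l := fun p : (List α × List α) × (Bool × List α) × α => p.2.1.2)
      (f := fun _ => (false, [])) (g := fun p b t => (p.2.1.1 && decide (p.2.2 = b), t))
      (by fun_prop) (by fun_prop) (by fun_prop)
      (fun a ha => by simp only [eqStep, ha]) (fun a b t ha => by simp only [eqStep, ha])
  have h := Poly.foldl (l := fun p : List α × List α => p.1) (i := fun p => (true, p.2))
    (h := fun _ s a => eqStep s a) (by fun_prop) (by fun_prop) hstep (Polynomial.X + 7) (by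
      intro p l' _
      refine (esize_foldl_eqStep _ _).trans ?_
      have h1 : esize p = 1 + esize p.1 + esize p.2 := rfl
      have h2 : esize (true, p.2) = 1 + 3 + esize p.2 := rfl
      rw [h2, Polynomial.eval_add, Polynomial.eval_X, Polynomial.eval_ofNat]
      omega)
  have h' : Poly fun p : List α × List α => (p.1.foldl eqStep (true, p.2)).1 &&
      (p.1.foldl eqStep (true, p.2)).2.isEmpty := by fun_prop
  convert h' using 2 with p
  rw [Bool.eq_iff_iff, foldl_eqStep]
  simp⟩

instance : PolyEq ℕ := ⟨by
  have : Poly fun p : ℕ × ℕ => decide (List.replicate p.1 () = List.replicate p.2 ()) := by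
    fun_prop
  convert this using 2 with p
  simp⟩

end equality

/-! ### Trees as data -/

instance : Enc Tr := ⟨fun x => x, fun _ _ h => h⟩

/-- The spine of a tree. -/
def Tr.toList : Tr → List Tr
  | nil => []
  | node a b => a :: b.toList

theorem enc_toList (x : Tr) : enc x.toList = x := by
  induction x with
  | nil => rfl
  | node a b _ ih => rw [Tr.toList, enc_list_cons, ih]; rfl

theorem toList_enc {α : Type} [Enc α] (l : List α) : (enc l).toList = l.map enc := by
  induction l with
  | nil => rfl
  | cons a l ih => rw [enc_list_cons, Tr.toList, ih, List.map_cons]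

section
variable {α β : Type} [Enc α] [Enc β]

@[fun_prop] theorem Poly.toList {f : α → Tr} (hf : Poly f) : Poly fun a => (f a).toList := by
  have : (fun a => enc (f a).toList) = fun a => enc (f a) := funext fun a => enc_toList _
  unfold Poly
  rw [this]
  exact hf

@[fun_prop] theorem Poly.encTree {f : α → β} (hf : Poly f) : Poly fun a => enc (f a) := hf

end

/-- Trees can be decoded in polynomial time, with arbitrary values for trees that are not codes. -/
class Dec (α : Type) [Enc α] where
  dec : Tr → α
  dec_enc (a : α) : dec (enc a) = a
  poly : Poly dec

attribute [fun_prop] Dec.poly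

section
variable {α β : Type} [Enc α] [Enc β] [Dec α] [Dec β]

instance : Dec Bool where
  dec x := !x.toList.isEmpty
  dec_enc b := by cases b <;> rfl
  poly := by fun_prop

instance : Dec ℕ where
  dec x := x.toList.length
  dec_enc n := by rw [enc_nat, toList_enc, List.length_map, List.length_replicate]
  poly := by fun_prop

instance : Dec (List α) where
  dec x := x.toList.map Dec.dec
  dec_enc l := by simp [toList_enc, Function.comp_def, Dec.dec_enc]
  poly := by fun_prop

instance : Dec (α × β) where
  dec x := (Dec.dec (x.toList.headD .nil), Dec.dec (enc x.toList.tail))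
  dec_enc p := by
    obtain ⟨a, b⟩ := p
    simp only [enc_pair, Tr.toList, List.headD_cons, List.tail_cons, enc_toList, Dec.dec_enc]
  poly := by fun_prop

end

/-! ### Parsing trees -/

/-- A preorder code is evaluated from right to left with a stack of finished trees: `false` pushes a
leaf, `true` joins the two top trees. A malformed word may empty the stack, which keeps the size
bound valid for all words. -/
def parseStep (b : Bool) (s : List Tr) : List Tr :=
  bif b then
    match s with
    | x :: y :: t => .node x y :: t
    | _ => []
  else .nil :: s

/-- The tree with the given code; an arbitrary tree if the word is not a code. -/
def parse (w : List Bool) : Tr := (w.foldr parseStep []).headD .nil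

theorem foldr_parseStep_bits (x : Tr) (s : List Tr) : x.bits.foldr parseStep s = x :: s := by
  induction x generalizing s with
  | nil => rfl
  | node x y hx hy => simp [Tr.bits, hx, hy, parseStep]

theorem parse_bits (x : Tr) : parse x.bits = x := by
  simp [parse, foldr_parseStep_bits]

theorem esize_foldr_parseStep (w : List Bool) :
    esize (w.foldr parseStep []) ≤ 2 * w.length + 1 := by
  induction w with
  | nil => simp [esize, Tr.size]
  | cons b w ih =>
    rw [List.foldr_cons, List.length_cons]
    generalize w.foldr parseStep [] = s at *
    cases b
    · have : esize (Tr.nil :: s) = 1 + 1 + esize s := rfl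
      simp only [parseStep, cond_false]
      omega
    · rcases s with _ | ⟨x, _ | ⟨y, t⟩⟩
      · simp only [parseStep, cond_true]; omega
      · have : esize ([] : List Tr) = 1 := rfl
        simp only [parseStep, cond_true]; omega
      · have h1 : esize (x :: y :: t) = 1 + x.size + (1 + y.size + esize t) := rfl
        have h2 : esize (Tr.node x y :: t) = 1 + (1 + x.size + y.size) + esize t := rfl
        simp only [parseStep, cond_true]; omega

theorem Poly.node {α : Type} [Enc α] {f g : α → Tr} (hf : Poly f) (hg : Poly g) :
    Poly fun a => Tr.node (f a) (g a) :=
  PolyTr.node hf hg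

@[fun_prop] theorem Poly.parse {α : Type} [Enc α] {w : α → List Bool} (hw : Poly w) :
    Poly fun a => parse (w a) := by
  have h1 : Poly fun p : α × Bool × List Tr => Tr.node (p.2.2.headD .nil)
    (p.2.2.tail.headD .nil) := Poly.node (by fun_prop) (by fun_prop)
  have hstep : Poly fun p : α × Bool × List Tr => parseStep p.2.1 p.2.2 := by
    have : Poly fun p : α × Bool × List Tr => bif p.2.1 then
      (bif p.2.2.tail.isEmpty then [] else
        Tr.node (p.2.2.headD .nil) (p.2.2.tail.headD .nil) :: p.2.2.tail.tail)
      else .nil :: p.2.2 := by fun_prop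
    convert this using 2 with p
    rcases p with ⟨_, _ | _, _ | ⟨_, _ | _⟩⟩ <;> rfl
  obtain ⟨p, hp⟩ := hw.esize_le
  have := Poly.foldr (l := w) (i := fun _ => []) (h := fun _ b s => parseStep b s) hw
    (by fun_prop) hstep (2 * p + 1) (by
      intro a l' hl'
      have h1 := (hl'.length_le.trans (length_le_esize _)).trans (hp a)
      refine (esize_foldr_parseStep l').trans ?_
      simp only [Polynomial.eval_add, Polynomial.eval_mul, Polynomial.eval_ofNat,
        Polynomial.eval_one]
      omega)
  unfold SymmetryBreaking.parse
  fun_prop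

/-! ### From functions on encoded types to machines -/

/-- Both bits have codes of length 5, consisting of the bit, its negation and constants. All letters
thus have codes of length 11 and of the same pattern, which the machine can emit by fixed pushes. -/
def encBit (b : Bool) : Tr :=
  bif b then .node (.node .nil .nil) .nil else .node .nil (.node .nil .nil)

def encLetter (s : Letter) : Tr :=
  s.elim (fun b => .node (encBit false) (encBit b)) (fun b => .node (encBit true) (encBit b))

instance : Enc Letter := ⟨encLetter, fun a b => by
  rcases a with (_ | _) | (_ | _) <;> rcases b with (_ | _) | (_ | _) <;> simp [encLetter, encBit]⟩

theorem code_encLetter (s : Letter) : (enc s).code = letterCode s := by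
  rcases s with (_ | _) | (_ | _) <;> rfl

theorem inputCode_eq (w : List Letter) :
    inputCode w [.inl false] = (enc w.reverse).code := by
  have : ∀ (w v : List Letter), inputCode w (enc v).code = (enc (w.reverse ++ v)).code := by
    intro w
    induction w with
    | nil => intro v; rfl
    | cons s w ih =>
      intro v
      have := ih (s :: v)
      rw [enc_list_cons, Tr.code_node, code_encLetter] at this
      rw [List.reverse_cons, List.append_assoc, List.singleton_append, ← this]
      rfl
  simpa using this w []

theorem Poly.polyTimeComputable {α : Type} {ea : α → List Letter} {V : α → Bool}
    {f : List Letter → Bool} (hf : Poly f) (h : ∀ a, f (ea a) = V a) :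
    PolyTimeComputable ea Computability.encodeBool V := by
  -- The reading phase leaves the input reversed on the main stack.
  have hr : Poly fun w : List Letter => f w.reverse := by fun_prop
  obtain ⟨c, p, hc⟩ := hr
  -- A letter contributes 11 for its tree and 1 for the node of the list; the empty list contributes
  -- 1.
  refine polyTimeComputable_of_exec c (p.comp (12 * Polynomial.X + 1)) fun a => ?_
  have := (hc (ea a).reverse).2 [] [] [] []
  simp only [List.reverse_reverse, h, List.append_nil] at this
  rw [inputCode_eq, mainStore_eq, mainStore_eq]
  have h1 : (enc (V a)).code = if V a then [.inl true, .inl false, .inl false]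
      else [.inl false] := by
    cases V a <;> rfl
  rw [← h1]
  refine this.mono ?_
  simp only [Polynomial.eval_comp, Polynomial.eval_add, Polynomial.eval_mul,
    Polynomial.eval_ofNat, Polynomial.eval_X, Polynomial.eval_one]
  refine eval_mono p ?_
  have h2 := esize_list_le (l := (ea a).reverse) (B := 11) (fun s _ => by
    rcases s with (_ | _) | (_ | _) <;> exact le_rfl)
  rw [List.length_reverse] at h2
  simp only [esize] at h2
  omega

theorem letter_isRight : Poly (Sum.isRight : Letter → Bool) := by
  have h : PolyTr (enc : Letter → Tr) fun s => encBit s.isRight := by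
    have h : (enc : Letter → Tr) = fun s =>
        .node (encBit s.isRight) (encBit (s.elim (fun b => b) fun b => b)) :=
      funext fun s => by cases s <;> rfl
    rw [h]
    exact PolyTr.fst
  refine h.trans ?_
  have h : (fun s : Letter => encBit s.isRight) = fun s =>
      .node (enc s.isRight) (enc !s.isRight) := funext fun s => by cases s.isRight <;> rfl
  rw [h]
  exact PolyTr.fst

theorem letter_bit : Poly fun s : Letter => s.elim (fun b => b) fun b => b := by
  have h : PolyTr (enc : Letter → Tr) fun s => encBit (s.elim (fun b => b) fun b => b) := by
    have h : (enc : Letter → Tr) = fun s =>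
        .node (encBit s.isRight) (encBit (s.elim (fun b => b) fun b => b)) :=
      funext fun s => by cases s <;> rfl
    rw [h]
    exact PolyTr.snd
  refine h.trans ?_
  have h : (fun s : Letter => encBit (s.elim (fun b => b) fun b => b)) = fun s =>
      .node (enc (s.elim (fun b => b) fun b => b)) (enc !(s.elim (fun b => b) fun b => b)) :=
    funext fun s => by rcases s with (_ | _) | (_ | _) <;> rfl
  rw [h]
  exact PolyTr.fst

/-- A problem is in NP if it has certificates of polynomial size that are checked by a
polynomial-time function. -/
theorem inNP_of_poly {α γ : Type} [Enc γ] [Dec γ] {e : α → List Bool} {L : Set α}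
    {R : List Bool × γ → Bool} (hR : Poly R) (q : Polynomial ℕ)
    (hL : ∀ x ∈ L, ∃ c, esize c ≤ q.eval (e x).length ∧ R (e x, c) = true)
    (hL' : ∀ x c, R (e x, c) = true → x ∈ L) : InNP e L := by
  -- A certificate is the preorder code of `c`, whose length is `esize c`. Any other word is also
  -- decoded to some value, which is harmless because `hL'` holds for all `c`.
  refine ⟨q, fun x => R (e x.1, Dec.dec (parse x.2)), ?_, fun x => ⟨fun hx => ?_, ?_⟩⟩
  · let bit : Letter → Bool := fun s => s.elim (fun b => b) fun b => b
    have hr := letter_isRight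
    have hb : Poly bit := letter_bit
    have hp : Poly fun w : List Letter =>
        R (w.flatMap fun s => bif s.isRight then [] else [bit s],
          Dec.dec (parse (w.flatMap fun s => bif s.isRight then [bit s] else []))) := by
      have h1 : Poly fun w : List Letter =>
        w.flatMap fun s => bif s.isRight then [] else [bit s] := by fun_prop
      have h2 : Poly fun w : List Letter =>
        (Dec.dec (parse (w.flatMap fun s => bif s.isRight then [bit s] else [])) : γ) := by fun_prop
      exact hR.comp (h1.pair h2)
    refine hp.polyTimeComputable fun x => ?_
    have h1 : ∀ l : List Bool, (l.map (Sum.inl : Bool → Letter)).flatMap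
        (fun s => bif s.isRight then [] else [bit s]) = l := by
      intro l; induction l <;> simp_all [bit]
    have h2 : ∀ l : List Bool, (l.map (Sum.inr : Bool → Letter)).flatMap
        (fun s => bif s.isRight then [] else [bit s]) = [] := by
      intro l; induction l <;> simp_all [bit]
    have h3 : ∀ l : List Bool, (l.map (Sum.inl : Bool → Letter)).flatMap
        (fun s => bif s.isRight then [bit s] else []) = [] := by
      intro l; induction l <;> simp_all [bit]
    have h4 : ∀ l : List Bool, (l.map (Sum.inr : Bool → Letter)).flatMap
        (fun s => bif s.isRight then [bit s] else []) = l := by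
      intro l; induction l <;> simp_all [bit]
    simp only [certWord, List.flatMap_append, h1, h2, h3, h4, List.append_nil, List.nil_append]
  · obtain ⟨c, hc, h⟩ := hL x hx
    exact ⟨(enc c).bits, by rwa [Tr.length_bits], by simpa only [parse_bits, Dec.dec_enc] using h⟩
  · rintro ⟨w, _, h⟩
    exact hL' x _ h

end SymmetryBreaking

/-! ### Simulation of arbitrary polynomial-time machines within the calculus -/

namespace SymmetryBreaking

open Function

/-! ### Finite types -/

/-- An encoding of a finite type. -/
@[reducible] noncomputable def finEnc (A : Type) [Finite A] : Enc A :=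
  ⟨fun a => enc (Finite.equivFin A a).val, fun a b h => by simpa [enc_inj, Fin.val_inj] using h⟩

theorem esize_bounded (A : Type) [Enc A] [Finite A] : ∃ B, ∀ a : A, esize a ≤ B := by
  cases nonempty_fintype A
  exact ⟨Finset.univ.sup esize, fun a => Finset.le_sup (f := esize) (Finset.mem_univ a)⟩

theorem PolyTr.ite_bool {α : Type} {e f g : α → Tr} {b : α → Bool}
    (hb : PolyTr e fun x => enc (b x)) (hf : PolyTr e f) (hg : PolyTr e g) :
    PolyTr e fun x => bif b x then f x else g x := by
  refine PolyTr.ite hb ?_ ?_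
  · have : ∀ x : {x // enc (b x) = .nil}, b x = false := fun ⟨x, hx⟩ => by
      cases h : b x <;> simp_all
    simp only [this, cond_false]
    exact PolyTr.precomp hg _
  · have : ∀ x : {x // enc (b x) ≠ .nil}, b x = true := fun ⟨x, hx⟩ => by
      cases h : b x <;> simp_all
    simp only [this, cond_true]
    exact PolyTr.precomp hf _

-- The tree `t` is fixed, so the comparison is a finite nest of case distinctions, built by
-- recursion on `t`, and needs no loop.
open Classical in
theorem PolyTr.decide_eq (t : Tr) {α : Type} (e : α → Tr) :
    PolyTr e fun a => enc (decide (e a = t)) := by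
  have hconst : ∀ {α : Type} (e : α → Tr) (b : Bool), PolyTr e fun _ => enc b := by
    intro α e b
    cases b
    · exact PolyTr.nil
    · exact PolyTr.node PolyTr.nil PolyTr.nil
  induction t generalizing α with
  | nil =>
    refine PolyTr.ite PolyTr.refl ?_ ?_
    · have : ∀ x : {x // e x = .nil}, decide (e x = .nil) = true := fun x => by simp [x.2]
      simp only [this]
      exact hconst _ _
    · have : ∀ x : {x // e x ≠ .nil}, decide (e x = .nil) = false := fun x => by simp [x.2]
      simp only [this]
      exact hconst _ _
  | node t t' ih ih' =>
    refine PolyTr.ite PolyTr.refl ?_ ?_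
    · have : ∀ x : {x // e x = .nil}, decide (e x = .node t t') = false := fun x => by simp [x.2]
      simp only [this]
      exact hconst _ _
    · have : ∀ x : {x // e x ≠ .nil}, ∃ y z, e x = .node y z := fun ⟨x, hx⟩ => by
        cases h : e x <;> simp_all
      choose y z hyz using this
      simp only [hyz, Tr.node.injEq, Bool.decide_and]
      have h1 : ∀ x, enc (decide (y x = t) && decide (z x = t')) =
          bif decide (y x = t) then enc (decide (z x = t')) else enc false := fun x => by
        cases decide (y x = t) <;> rfl
      simp only [h1]
      exact PolyTr.ite_bool (PolyTr.fst.trans (ih y)) (PolyTr.snd.trans (ih' z)) (hconst _ _)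

section
variable {α β γ : Type} [Enc α] [Enc β] [Enc γ] {A : Type} [Enc A] [Finite A]

/-- A chain of comparisons of the first component with the finitely many elements of `A`. Each `g a`
may have its own program and its own bound. -/
theorem Poly.finite_cases {g : A → β → γ} (hg : ∀ a, Poly (g a)) :
    Poly fun p : A × β => g p.1 p.2 := by
  classical
  cases nonempty_fintype A
  cases isEmpty_or_nonempty A with
  | inl h => exact ⟨.skip, 0, fun x => (h.false x.1).elim⟩
  | inr h =>
    obtain ⟨a₀⟩ := h
    have key : ∀ l : List A, ∃ f : A × β → γ, Poly f ∧ ∀ p, p.1 ∈ l → f p = g p.1 p.2 := by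
      intro l
      induction l with
      | nil => exact ⟨fun p => g a₀ p.2, (hg a₀).comp Poly.snd, by simp⟩
      | cons a l ih =>
        obtain ⟨f, hf, h⟩ := ih
        have hd : Poly fun p : A × β => decide (p.1 = a) := by
          have := (Poly.fst (α := A) (β := β)).trans
            ((PolyTr.decide_eq (enc a) (enc : A → Tr)).precomp Prod.fst)
          simp only [enc_inj] at this
          exact this
        refine ⟨fun p => bif decide (p.1 = a) then g a p.2 else f p,
          hd.cond ((hg a).comp Poly.snd) hf, fun p hp => ?_⟩
        by_cases hpa : p.1 = a
        · simp [hpa]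
        · simp only [hpa, decide_false, cond_false]
          exact h p (by simpa [hpa] using hp)
    obtain ⟨f, hf, h⟩ := key Finset.univ.toList
    have : (fun p : A × β => g p.1 p.2) = f := funext fun p => (h p (by simp)).symm
    rwa [this]

theorem Poly.of_finite (f : A → β) : Poly f := by
  have := Poly.finite_cases (β := Unit) (g := fun a _ => f a) fun a => by fun_prop
  exact this.comp (g := fun a => (a, ())) (by fun_prop)

instance : Enc (Option α) := ⟨fun o => enc o.toList, fun a b h => by
  cases a <;> cases b <;> simp_all [enc_inj]⟩

@[fun_prop] theorem Poly.head? {l : α → List β} (hl : Poly l) : Poly fun a => (l a).head? := by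
  have h : Poly fun a => (l a).head?.toList :=
    Poly.listCases (f := fun _ => []) (g := fun _ b _ => [b]) hl (by fun_prop) (by fun_prop)
      (by simp_all) (by simp_all)
  exact h

variable {K : Type} [Fintype K]

/-- The list of all values of a function on a finite type. -/
noncomputable def valueList {β : Type} (S : K → β) : List β :=
  List.ofFn (S ∘ (Fintype.equivFin K).symm)

noncomputable instance encFun : Enc (K → β) := ⟨fun S => enc (valueList S), fun S T h => by
  have := List.ofFn_injective (enc_inj.1 h)
  funext k
  simpa using congrFun this (Fintype.equivFin K k)⟩

theorem Poly.valueList : Poly (valueList : (K → β) → List β) := PolyTr.refl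

theorem getD_valueList {β : Type} (S : K → β) (k : K) (d : β) :
    (valueList S).getD (Fintype.equivFin K k).val d = S k := by
  rw [List.getD_eq_getElem _ _ (by simp [SymmetryBreaking.valueList])]
  simp [SymmetryBreaking.valueList]

theorem Poly.apply {S : α → K → List β} (hS : Poly S) (k : K) : Poly fun a => S a k := by
  have : Poly fun a => (SymmetryBreaking.valueList (S a)).getD (Fintype.equivFin K k).val [] :=
    Poly.getD (Poly.valueList.comp hS) (Poly.const _) (Poly.const _)
  simpa only [getD_valueList] using this

theorem Poly.update [DecidableEq K] {S : α → K → List β} {l : α → List β} (hS : Poly S) (k : K)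
    (hl : Poly l) : Poly fun a => update (S a) k (l a) := by
  have h : ∀ (s : α → List (List β)) (n m : ℕ), Poly s → Poly fun a => (List.range n).map fun i =>
      bif decide (i = m) then l a else (s a).getD i [] := by
    intro s n m hs
    fun_prop
  replace h := h (fun a => SymmetryBreaking.valueList (S a)) (Fintype.card K)
    (Fintype.equivFin K k).val (Poly.valueList.comp hS)
  have h' : ∀ a, SymmetryBreaking.valueList (Function.update (S a) k (l a)) =
      (List.range (Fintype.card K)).map fun i =>
      bif decide (i = (Fintype.equivFin K k).val) then l a
      else (SymmetryBreaking.valueList (S a)).getD i [] := by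
    intro a
    refine List.ext_getElem (by simp [SymmetryBreaking.valueList]) fun i hi _ => ?_
    simp only [SymmetryBreaking.valueList, List.length_ofFn] at hi
    obtain ⟨j, rfl⟩ : ∃ j, i = (Fintype.equivFin K j).val :=
      ⟨(Fintype.equivFin K).symm ⟨i, hi⟩, by simp⟩
    rw [List.getElem_map, List.getElem_range, getD_valueList]
    by_cases hj : j = k
    · subst hj; simp [SymmetryBreaking.valueList]
    · simp [SymmetryBreaking.valueList, hj, Fin.val_inj]
  simp only [← h'] at h
  exact h

theorem esize_fun (S : K → β) : esize S = 1 + ∑ k, (1 + esize (S k)) := by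
  have h : ∀ l : List β, esize l = 1 + (l.map fun b => 1 + esize b).sum := by
    intro l
    induction l with
    | nil => rfl
    | cons b l ih => rw [esize_cons, ih, List.map_cons, List.sum_cons]; omega
  have h1 : esize S = esize (valueList S) := rfl
  rw [h1, h, valueList, List.map_ofFn, List.sum_ofFn]
  congr 1
  exact Fintype.sum_equiv (Fintype.equivFin K).symm _ _ (fun _ => rfl)

theorem esize_update [DecidableEq K] (S : K → β) (k : K) (b : β) :
    esize (Function.update S k b) + esize (S k) = esize S + esize b := by
  rw [esize_fun, esize_fun, ← Finset.add_sum_erase _ _ (Finset.mem_univ k),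
    ← Finset.add_sum_erase _ (fun k => 1 + esize (S k)) (Finset.mem_univ k)]
  have : ∑ x ∈ Finset.univ.erase k, (1 + esize (Function.update S k b x)) =
      ∑ x ∈ Finset.univ.erase k, (1 + esize (S x)) :=
    Finset.sum_congr rfl fun x hx => by rw [Function.update_of_ne (Finset.ne_of_mem_erase hx)]
  rw [this, Function.update_self]
  omega

end

/-! ### Simulation of machines -/

section simulation

open Turing

variable {K : Type} [DecidableEq K] {Γ : K → Type} {Λ σ A : Type}
  (num : ∀ k, Γ k → A) (den : ∀ k, A → Option (Γ k))

/-- The effect of a statement, with letters represented by elements of `A`. -/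
def simAux : TM2.Stmt Γ Λ σ → σ × (K → List A) → Option Λ × σ × (K → List A)
  | .push k f q, p => simAux q (p.1, update p.2 k (num k (f p.1) :: p.2 k))
  | .peek k f q, p => simAux q (f p.1 ((p.2 k).head?.bind (den k)), p.2)
  | .pop k f q, p => simAux q (f p.1 ((p.2 k).head?.bind (den k)), update p.2 k (p.2 k).tail)
  | .load f q, p => simAux q (f p.1, p.2)
  | .branch f q q', p => bif f p.1 then simAux q p else simAux q' p
  | .goto f, p => (some (f p.1), p)
  | .halt, p => (none, p)

def simStep (M : Λ → TM2.Stmt Γ Λ σ) (c : Option Λ × σ × (K → List A)) :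
    Option Λ × σ × (K → List A) :=
  match c.1 with
  | none => c
  | some l => simAux num den (M l) c.2

/-- The letters that a statement can push. -/
def pushed {K : Type} {Γ : K → Type} {Λ σ : Type} : TM2.Stmt Γ Λ σ → Set (Σ k, Γ k)
  | .push k f q => Set.range (fun v => (⟨k, f v⟩ : Σ k, Γ k)) ∪ pushed q
  | .peek _ _ q => pushed q
  | .pop _ _ q => pushed q
  | .load _ q => pushed q
  | .branch _ q q' => pushed q ∪ pushed q'
  | .goto _ => ∅
  | .halt => ∅

/-- A `FinTM2` may have infinite alphabets on its work stacks, but what it pushes depends on a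
finite register, so only finitely many letters ever occur. -/
theorem finite_pushed {K : Type} {Γ : K → Type} {Λ σ : Type} [Finite σ] (q : TM2.Stmt Γ Λ σ) :
    (pushed q).Finite := by
  induction q with
  | push k f q ih => exact (Set.finite_range _).union ih
  | branch f q q' ih ih' => exact ih.union ih'
  | peek _ _ _ ih | pop _ _ _ ih | load _ _ ih => exact ih
  | goto | halt => exact Set.finite_empty

section
variable [Fintype K] [Enc A] [Finite A]

/-- A statement contains a fixed number of pushes, each of a letter of bounded size. -/
theorem esize_simAux_le (q : TM2.Stmt Γ Λ σ) :
    ∃ D, ∀ p, esize (simAux num den q p).2.2 ≤ esize p.2 + D := by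
  obtain ⟨B, hB⟩ := esize_bounded A
  induction q with
  | push k f q ih =>
    obtain ⟨D, hD⟩ := ih
    refine ⟨D + B + 1, fun p => (hD _).trans ?_⟩
    have h1 := esize_update p.2 k (num k (f p.1) :: p.2 k)
    have h2 := hB (num k (f p.1))
    rw [esize_cons] at h1
    simp only
    omega
  | pop k f q ih =>
    obtain ⟨D, hD⟩ := ih
    refine ⟨D, fun p => (hD _).trans ?_⟩
    have h1 := esize_update p.2 k (p.2 k).tail
    have h2 := esize_sublist (List.tail_sublist (p.2 k))
    simp only
    omega
  | branch f q q' ih ih' =>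
    obtain ⟨D, hD⟩ := ih
    obtain ⟨D', hD'⟩ := ih'
    refine ⟨D + D', fun p => ?_⟩
    have h1 := hD p
    have h2 := hD' p
    cases h : f p.1
    · simp only [simAux, h, cond_false]; omega
    · simp only [simAux, h, cond_true]; omega
  | peek k f q ih | load f q ih =>
    obtain ⟨D, hD⟩ := ih
    exact ⟨D, fun p => hD _⟩
  | goto | halt => exact ⟨0, fun p => le_rfl⟩

variable [Enc σ] [Enc Λ] [Finite σ]

theorem poly_simAux (q : TM2.Stmt Γ Λ σ) : Poly fun p : σ × (K → List A) => simAux num den q p := by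
  have hpop : ∀ (k : K) (f : σ → Option (Γ k) → σ),
      Poly fun p : σ × (K → List A) => f p.1 ((p.2 k).head?.bind (den k)) := by
    intro k f
    have h1 : Poly fun p : σ × Option A => f p.1 (p.2.bind (den k)) := Poly.of_finite _
    have h2 : Poly fun p : σ × (K → List A) => p.2 k := Poly.snd.apply k
    exact h1.comp (g := fun p : σ × (K → List A) => (p.1, (p.2 k).head?)) (by fun_prop)
  induction q with
  | push k f q ih =>
    have h1 : Poly fun v => num k (f v) := Poly.of_finite _
    have h2 : Poly fun p : σ × (K → List A) => p.2 k := Poly.snd.apply k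
    exact ih.comp (Poly.fst.pair (Poly.snd.update k ((h1.comp Poly.fst).cons h2)))
  | peek k f q ih => exact ih.comp ((hpop k f).pair Poly.snd)
  | pop k f q ih =>
    have h2 : Poly fun p : σ × (K → List A) => p.2 k := Poly.snd.apply k
    exact ih.comp ((hpop k f).pair (Poly.snd.update k (by fun_prop)))
  | load f q ih =>
    have h1 : Poly f := Poly.of_finite _
    exact ih.comp (g := fun p : σ × (K → List A) => (f p.1, p.2)) (by fun_prop)
  | branch f q q' ih ih' =>
    have h1 : Poly f := Poly.of_finite _
    exact (h1.comp Poly.fst).cond ih ih'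
  | goto f =>
    have h1 : Poly fun v => some (f v) := Poly.of_finite _
    exact (h1.comp Poly.fst).pair Poly.id
  | halt => exact (Poly.const _).pair Poly.id

variable [Finite Λ]

theorem poly_simStep (M : Λ → TM2.Stmt Γ Λ σ) : Poly (simStep num den M) := by
  refine Poly.finite_cases (g := fun l p => simStep num den M (l, p)) fun l => ?_
  cases l with
  | none => exact (Poly.const none).pair Poly.id
  | some l => exact poly_simAux num den (M l)

/-- Configurations grow at most linearly with the number of steps; this is the size bound that
`Poly.iterate` asks for. -/
theorem esize_simStep_iterate_le (M : Λ → TM2.Stmt Γ Λ σ) :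
    ∃ D, ∀ n c, esize ((simStep num den M)^[n] c) ≤ D + esize c.2.2 + n * D := by
  choose E hE using fun l => esize_simAux_le num den (M l)
  cases nonempty_fintype Λ
  obtain ⟨B, hB⟩ := esize_bounded (Option Λ × σ)
  have hstep : ∀ c, esize (simStep num den M c).2.2 ≤ esize c.2.2 + ∑ l, E l := by
    rintro ⟨_ | l, p⟩
    · exact Nat.le_add_right _ _
    · refine (hE l p).trans (Nat.add_le_add_left ?_ _)
      exact Finset.single_le_sum (f := E) (fun _ _ => Nat.zero_le _) (Finset.mem_univ l)
  have hiter : ∀ n c, esize ((simStep num den M)^[n] c).2.2 ≤ esize c.2.2 + n * ∑ l, E l := by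
    intro n
    induction n with
    | zero => simp
    | succ n ih =>
      intro c
      rw [iterate_succ_apply']
      have := hstep ((simStep num den M)^[n] c)
      have := ih c
      rw [add_mul, one_mul]
      omega
  refine ⟨B + 1 + ∑ l, E l, fun n c => ?_⟩
  have h1 := hiter n c
  generalize (simStep num den M)^[n] c = d at *
  have h2 := hB (d.1, d.2.1)
  have h3 : esize d = 1 + esize d.1 + (1 + esize d.2.1 + esize d.2.2) := rfl
  have h4 : esize (d.1, d.2.1) = 1 + esize d.1 + esize d.2.1 := rfl
  have h5 : n * ∑ l, E l ≤ n * (B + 1 + ∑ l, E l) := Nat.mul_le_mul_left _ (by omega)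
  omega

end

section
/-- The letters that are faithfully represented. -/
def Represented (k : K) (s : Γ k) : Prop := den k (num k s) = some s

def simCfg (c : TM2.Cfg Γ Λ σ) : Option Λ × σ × (K → List A) :=
  (c.l, c.var, fun k => (c.stk k).map (num k))

-- Faithful representation of all letters on the stacks is an invariant of the run; as long as it
-- holds, decoding the top letter recovers what the machine sees.
variable {num den} in
theorem simAux_eq (q : TM2.Stmt Γ Λ σ) (hq : ∀ k s, ⟨k, s⟩ ∈ pushed q → Represented num den k s)
    (v : σ) (S : ∀ k, List (Γ k)) (hS : ∀ k, ∀ s ∈ S k, Represented num den k s) :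
    simAux num den q (v, fun k => (S k).map (num k)) = simCfg num (TM2.stepAux q v S) ∧
      ∀ k, ∀ s ∈ (TM2.stepAux q v S).stk k, Represented num den k s := by
  have hpop : ∀ (S : ∀ k, List (Γ k)), (∀ k, ∀ s ∈ S k, Represented num den k s) →
      ∀ k, ((S k).map (num k)).head?.bind (den k) = (S k).head? := by
    intro S hS k
    have := hS k
    cases h : S k with
    | nil => rfl
    | cons s l => exact this s (by simp [h])
  have hupd : ∀ (S : ∀ k, List (Γ k)) k l, (fun j => (update S k l j).map (num j)) =
      update (fun k => (S k).map (num k)) k (l.map (num k)) := by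
    intro S k l
    funext j
    by_cases h : j = k
    · subst h; simp
    · simp [h]
  have hrep : ∀ (S : ∀ k, List (Γ k)) k l, (∀ k, ∀ s ∈ S k, Represented num den k s) →
      (∀ s ∈ l, Represented num den k s) →
      ∀ j, ∀ s ∈ update S k l j, Represented num den j s := by
    intro S k l hS hl j s hs
    by_cases h : j = k
    · subst h
      rw [update_self] at hs
      exact hl s hs
    · rw [update_of_ne h] at hs
      exact hS _ _ hs
  induction q generalizing v S with
  | push k f q ih =>
    have := ih (fun k s h => hq k s (.inr h)) v (update S k (f v :: S k))
      (hrep S k _ hS fun s hs => by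
        rcases List.mem_cons.1 hs with rfl | hs
        · exact hq _ _ (.inl ⟨v, rfl⟩)
        · exact hS _ _ hs)
    rw [hupd] at this
    exact this
  | peek k f q ih =>
    simp only [simAux, TM2.stepAux, hpop S hS]
    exact ih hq _ S hS
  | pop k f q ih =>
    have := ih hq (f v (S k).head?) (update S k (S k).tail)
      (hrep S k _ hS fun s hs => hS _ _ (List.mem_of_mem_tail hs))
    rw [hupd, List.map_tail] at this
    simp only [simAux, TM2.stepAux, hpop S hS]
    exact this
  | load f q ih => exact ih hq _ S hS
  | branch f q q' ih ih' =>
    simp only [simAux, TM2.stepAux]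
    cases f v
    · exact ih' (fun k s h => hq k s (.inr h)) v S hS
    · exact ih (fun k s h => hq k s (.inl h)) v S hS
  | goto f => exact ⟨rfl, hS⟩
  | halt => exact ⟨rfl, hS⟩

variable {num den} in
theorem simStep_iterate_eq (M : Λ → TM2.Stmt Γ Λ σ)
    (hM : ∀ l k s, ⟨k, s⟩ ∈ pushed (M l) → Represented num den k s) (n : ℕ)
    (c : TM2.Cfg Γ Λ σ) (hc : ∀ k, ∀ s ∈ c.stk k, Represented num den k s)
    (d : TM2.Cfg Γ Λ σ) (h : (flip bind (TM2.step M))^[n] (some c) = some d) :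
    (simStep num den M)^[n] (simCfg num c) = simCfg num d := by
  induction n generalizing c with
  | zero =>
    cases h
    rfl
  | succ n ih =>
    rw [iterate_succ_apply] at h ⊢
    rcases c with ⟨_ | l, v, S⟩
    · have hnone : ∀ n, (flip bind (TM2.step M))^[n] none = none := fun n =>
        (show IsFixedPt (flip bind (TM2.step M)) none from rfl).iterate n
      rw [show flip bind (TM2.step M) (some ⟨none, v, S⟩) = none from rfl, hnone] at h
      cases h
    · obtain ⟨h1, h2⟩ := simAux_eq (M l) (hM l) v S hc
      rw [show simStep num den M (simCfg num ⟨some l, v, S⟩) =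
        simAux num den (M l) (v, fun k => (S k).map (num k)) from rfl, h1]
      exact ih _ h2 h

theorem simStep_iterate_halted (M : Λ → TM2.Stmt Γ Λ σ) (p : σ × (K → List A)) (n : ℕ) :
    (simStep num den M)^[n] (none, p) = (none, p) :=
  (show IsFixedPt (simStep num den M) (none, p) from rfl).iterate n

end

/-- Every function that is computed by a polynomial-time machine extends to a polynomial-time
function on words. -/
theorem PolyTimeComputable.exists_poly {α β : Type} {ea : α → List Bool} {eb : β → List Bool}
    {f : α → β} (h : PolyTimeComputable ea eb f) :
    ∃ F : List Bool → List Bool, Poly F ∧ ∀ a, F (ea a) = eb (f a) := by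
  classical
  obtain ⟨⟨⟨M, inp, out⟩, time, hM⟩⟩ := h
  have := M.kFin
  have := M.ΛFin
  have := M.σFin
  have hfin : ∀ k, M.Γ k ≃ Bool → (Set.range fun s : M.Γ k => (⟨k, s⟩ : Σ k, M.Γ k)).Finite :=
    fun k e => by
      have := Finite.of_equiv _ e.symm
      exact Set.finite_range _
  -- Everything the machine can push, and the input and output alphabets. All other letters are
  -- represented by `none`; they do not occur.
  let U : Set (Σ k, M.Γ k) := (⋃ l, pushed (M.m l)) ∪ Set.range (fun s => ⟨M.k₀, s⟩) ∪
    Set.range (fun s => ⟨M.k₁, s⟩)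
  have hU : U.Finite := ((Set.finite_iUnion fun l => finite_pushed _).union (hfin _ inp)).union
    (hfin _ out)
  have : Finite U := hU
  let A := Option U
  let num : ∀ k, M.Γ k → A := fun k s => if h : ⟨k, s⟩ ∈ U then some ⟨⟨k, s⟩, h⟩ else none
  let den : ∀ k, A → Option (M.Γ k) := fun k a =>
    a.bind fun u => if h : u.1.1 = k then some (h ▸ u.1.2) else none
  have hrep : ∀ k s, ⟨k, s⟩ ∈ U → Represented num den k s := by
    intro k s h
    simp [Represented, num, den, h]
  let _ : Enc U := finEnc U
  let _ : Enc M.Λ := finEnc M.Λ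
  let _ : Enc M.σ := finEnc M.σ
  let start : List Bool → Option M.Λ × M.σ × (M.K → List A) := fun w =>
    (some M.main, M.initialState,
      update (fun _ => []) M.k₀ (w.map fun b => num M.k₀ (inp.symm b)))
  let result : Option M.Λ × M.σ × (M.K → List A) → List Bool := fun c =>
    (c.2.2 M.k₁).map fun a => (den M.k₁ a).elim false out
  have hstart : Poly start := by
    have h1 : Poly fun b => num M.k₀ (inp.symm b) := Poly.of_finite _
    exact (Poly.const _).pair ((Poly.const _).pair ((Poly.const _).update _
      (Poly.map Poly.id (h1.comp Poly.snd))))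
  have hresult : Poly result := by
    have h1 : Poly fun a => (den M.k₁ a).elim false out := Poly.of_finite _
    have h2 : Poly fun c : Option M.Λ × M.σ × (M.K → List A) => c.2.2 M.k₁ :=
      (Poly.snd.comp Poly.snd).apply _
    exact Poly.map h2 (h1.comp Poly.snd)
  have hsim : Poly (simStep num den M.m) := poly_simStep num den M.m
  obtain ⟨D, hD⟩ := esize_simStep_iterate_le num den M.m
  obtain ⟨p, hp⟩ := hstart.esize_le
  have htime : Poly fun w : List Bool => time.eval w.length :=
    Poly.eval_polynomial time (by fun_prop)
  obtain ⟨q, hq⟩ := htime.esize_le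
  -- The clock runs `2 * time + 1` rounds, at least as many as the machine needs. Halted
  -- configurations are fixed by `simStep`, so the excess does no harm, and on words that are not
  -- encodings the clock still enforces termination.
  have hrun : Poly fun w : List Bool =>
      (simStep num den M.m)^[esize (time.eval w.length)] (start w) := by
    refine Poly.iterate hsim htime hstart (Polynomial.C D + p + q * Polynomial.C D) ?_
    intro w k hk
    refine (hD k (start w)).trans ?_
    have h1 := hp w
    have h2 : esize (start w).2.2 ≤ esize (start w) := by
      have : esize (start w) = 1 + esize (start w).1 + (1 + esize (start w).2.1 +
        esize (start w).2.2) := rfl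
      omega
    have h3 : k * D ≤ q.eval (esize w) * D := Nat.mul_le_mul_right _ (hk.trans (hq w))
    simp only [Polynomial.eval_add, Polynomial.eval_mul, Polynomial.eval_C]
    omega
  refine ⟨_, hresult.comp hrun, fun a => ?_⟩
  obtain ⟨⟨n, hn⟩, hle⟩ := hM a
  have hinit : simCfg num (initList M ((ea a).map inp.invFun)) = start (ea a) := by
    refine Prod.ext rfl (Prod.ext rfl (funext fun k => ?_))
    by_cases hk : k = M.k₀
    · subst hk
      simp [simCfg, initList, start]
    · simp [simCfg, initList, start, hk]
  have hrun := simStep_iterate_eq (num := num) (den := den) M.m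
    (fun l k s h => hrep k s (.inl (.inl (Set.mem_iUnion.2 ⟨l, h⟩)))) n
    (initList M ((ea a).map inp.invFun)) (fun k s hs => by
      by_cases hk : k = M.k₀
      · subst hk
        exact hrep _ _ (.inl (.inr ⟨s, rfl⟩))
      · simp [initList, hk] at hs) _ hn
  have htime : n ≤ esize (time.eval (ea a).length) := by
    rw [esize_nat]
    simp only at hle
    omega
  obtain ⟨m, hm⟩ := Nat.exists_eq_add_of_le htime
  rw [hm, add_comm, iterate_add_apply, ← hinit, hrun]
  have hhalt : simCfg num (haltList M ((eb (f a)).map out.invFun)) =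
      (none, (simCfg num (haltList M ((eb (f a)).map out.invFun))).2) := rfl
  rw [hhalt, simStep_iterate_halted]
  have hden : ∀ s, den M.k₁ (num M.k₁ s) = some s := fun s => hrep _ _ (.inr ⟨s, rfl⟩)
  simp [result, simCfg, haltList, hden, Function.comp_def]

end simulation

end SymmetryBreaking

/-! ### The reachability lemma of Babai and Szemerédi -/

namespace SymmetryBreaking

/-! ### Short derivations of group elements from generators -/

section derivations

variable {G : Type} [Group G]

/-- Each element of the list is `1`, or in `S`, or a quotient `b * a⁻¹` of later elements. -/
def IsDerivation (S : Set G) : List G → Prop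
  | [] => True
  | h :: t => IsDerivation S t ∧ (h = 1 ∨ h ∈ S ∨ ∃ a ∈ t, ∃ b ∈ t, h * a = b)

/-- Two derivations that extend the same `t` can share it: inserting `m` only enlarges the supply of
earlier elements. -/
theorem IsDerivation.append {S : Set G} {l m t : List G} (hl : IsDerivation S (l ++ t))
    (hm : IsDerivation S (m ++ t)) : IsDerivation S (l ++ (m ++ t)) := by
  induction l with
  | nil => exact hm
  | cons h l ih =>
    obtain ⟨hl, hh⟩ := hl
    refine ⟨ih hl, hh.imp_right (Or.imp_right ?_)⟩
    rintro ⟨a, ha, b, hb, hab⟩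
    have : ∀ x ∈ l ++ t, x ∈ l ++ (m ++ t) := by
      intro x hx
      simp only [List.mem_append] at *
      tauto
    exact ⟨a, this a ha, b, this b hb, hab⟩

/-- `g` is obtained by at most `n` derivation steps after the derivation `t`. -/
def Derivable (S : Set G) (t : List G) (n : ℕ) (g : G) : Prop :=
  ∃ r : List G, r.length ≤ n ∧ IsDerivation S (r ++ t) ∧ g ∈ r ++ t

variable {S : Set G} {t : List G}

theorem derivable_of_mem (ht : IsDerivation S t) {g : G} (hg : g ∈ t) : Derivable S t 0 g :=
  ⟨[], le_rfl, ht, hg⟩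

theorem derivable_one (ht : IsDerivation S t) : Derivable S t 1 (1 : G) :=
  ⟨[1], le_rfl, ⟨ht, .inl rfl⟩, by simp⟩

theorem derivable_of_mem_set (ht : IsDerivation S t) {s : G} (hs : s ∈ S) : Derivable S t 1 s :=
  ⟨[s], le_rfl, ⟨ht, .inr (.inl hs)⟩, by simp⟩

theorem Derivable.mul_inv {m n : ℕ} {a b : G} (hb : Derivable S t m b) (ha : Derivable S t n a) :
    Derivable S t (m + n + 1) (b * a⁻¹) := by
  obtain ⟨r, hr, hd, hbr⟩ := hb
  obtain ⟨r', hr', hd', har'⟩ := ha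
  refine ⟨(b * a⁻¹) :: (r ++ r'), by simp; omega, ?_, by simp⟩
  rw [List.cons_append, List.append_assoc]
  refine ⟨hd.append hd', .inr (.inr ⟨a, List.mem_append_right _ har', b, ?_, by simp⟩)⟩
  simp only [List.mem_append] at *
  tauto

theorem Derivable.mul {m n : ℕ} {a b : G} (hb : Derivable S t m b) (ha : Derivable S t n a)
    (ht : IsDerivation S t) : Derivable S t (m + n + 3) (b * a) := by
  -- Quotients are the only rule, so `b * a` is obtained as `b * (1 * a⁻¹)⁻¹`; deriving `1` costs
  -- one step and the two quotients one step each.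
  have := hb.mul_inv ((derivable_one ht).mul_inv ha)
  rw [one_mul, inv_inv] at this
  obtain ⟨r, hr, h⟩ := this
  exact ⟨r, by omega, h⟩

/-- The products of subsequences of a list. -/
def cube [DecidableEq G] : List G → Finset G
  | [] => {1}
  | g :: l => cube l ∪ (cube l).image (g * ·)

theorem derivable_of_mem_cube [DecidableEq G] (ht : IsDerivation S t) {l : List G}
    (hl : ∀ g ∈ l, g ∈ t) {k : G} (hk : k ∈ cube l) : Derivable S t (3 * l.length + 1) k := by
  induction l generalizing k with
  | nil =>
    rw [cube, Finset.mem_singleton] at hk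
    rw [hk]
    exact derivable_one ht
  | cons g l ih =>
    have ih := fun {k} => ih (k := k) (fun g hg => hl g (by simp [hg]))
    rw [cube, Finset.mem_union, Finset.mem_image] at hk
    rcases hk with hk | ⟨k', hk', rfl⟩
    · obtain ⟨r, hr, h⟩ := ih hk
      exact ⟨r, by simp; omega, h⟩
    · obtain ⟨r, hr, h⟩ := (derivable_of_mem ht (hl g (by simp))).mul (ih hk') ht
      exact ⟨r, by simp; omega, h⟩

theorem one_mem_cube [DecidableEq G] (l : List G) : 1 ∈ cube l := by
  induction l with
  | nil => simp [cube]
  | cons g l ih => simp [cube, ih]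

/-- The quotients of elements of the cube contain the generated subgroup if they are closed under
multiplication by the generators. -/
theorem closure_subset_of_mul_mem [Finite G] {T : Set G} (h1 : (1 : G) ∈ T)
    (hT : ∀ s ∈ S, ∀ x ∈ T, s * x ∈ T) {g : G} (hg : g ∈ Subgroup.closure S) : g ∈ T := by
  suffices h : ∀ x ∈ T, g * x ∈ T by simpa using h 1 h1
  induction hg using Subgroup.closure_induction with
  | mem s hs => exact hT s hs
  | one => simp
  | mul a b _ _ ha hb => exact fun x hx => by rw [mul_assoc]; exact ha _ (hb x hx)
  | inv a _ ha =>
    intro x hx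
    -- Left multiplication by `a` is an injective map of the finite set `T` to itself, hence
    -- surjective, so `T` is also closed under `a⁻¹`.
    let φ : T → T := fun y => ⟨a * y, ha y y.2⟩
    have hφ : Function.Injective φ := fun y z h => Subtype.ext (by
      simpa [φ] using congrArg Subtype.val h)
    obtain ⟨y, hy⟩ := Finite.surjective_of_injective hφ ⟨x, hx⟩
    have : a * y.1 = x := congrArg Subtype.val hy
    rw [← this, inv_mul_cancel_left]
    exact y.2

/-- The reachability lemma of Babai and Szemerédi: there is a short derivation from which every
element of the generated subgroup is derivable in a few steps. -/
theorem exists_derivation [Finite G] (S : Set G) {n : ℕ} (hn : Nat.card G < 2 ^ n) :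
    ∃ t : List G, IsDerivation S t ∧ t.length ≤ n * (6 * n + 7) ∧
      ∀ g ∈ Subgroup.closure S, Derivable S t (6 * n + 3) g := by
  classical
  by_contra hcon
  -- With `T` the set of quotients of elements of the cube, either `T` is closed under the
  -- generators and contains the generated subgroup, or some `s * x` outside `T` doubles the cube.
  -- The latter cannot happen `n` times. An element of `T` costs `2 * (3 * i + 1) + 1 = 6 * i + 3`
  -- steps, and `s * x` four more.
  have key : ∀ i ≤ n, ∃ (l t : List G), IsDerivation S t ∧ (∀ g ∈ l, g ∈ t) ∧ l.length = i ∧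
      t.length ≤ i * (6 * n + 7) ∧ (cube l).card = 2 ^ i := by
    intro i hi
    induction i with
    | zero => exact ⟨[], [], trivial, by simp, rfl, by simp, by simp [cube]⟩
    | succ i ih =>
      obtain ⟨l, t, ht, hlt, hl, htl, hc⟩ := ih (by omega)
      let T : Set G := {x | ∃ a ∈ cube l, ∃ b ∈ cube l, x = b * a⁻¹}
      have hder : ∀ x ∈ T, Derivable S t (6 * i + 3) x := by
        rintro x ⟨a, ha, b, hb, rfl⟩
        obtain ⟨r, hr, h⟩ := (derivable_of_mem_cube ht hlt hb).mul_inv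
          (derivable_of_mem_cube ht hlt ha)
        exact ⟨r, by omega, h⟩
      by_cases hT : ∀ s ∈ S, ∀ x ∈ T, s * x ∈ T
      · refine False.elim (hcon ?_)
        refine ⟨t, ht, htl.trans (Nat.mul_le_mul_right _ (by omega)), fun g hg => ?_⟩
        obtain ⟨r, hr, h⟩ := hder g (closure_subset_of_mul_mem (T := T)
          ⟨1, one_mem_cube l, 1, one_mem_cube l, by simp⟩ hT hg)
        exact ⟨r, by omega, h⟩
      · push Not at hT
        obtain ⟨s, hs, x, hx, hsx⟩ := hT
        obtain ⟨r, hr, hd, hmem⟩ := (derivable_of_mem_set ht hs).mul (hder x hx) ht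
        refine ⟨(s * x) :: l, r ++ t, hd, ?_, by simp [hl], ?_, ?_⟩
        · intro g hg
          rcases List.mem_cons.1 hg with rfl | hg
          · exact hmem
          · exact List.mem_append_right _ (hlt g hg)
        · rw [List.length_append, add_mul]
          omega
        · rw [cube, Finset.card_union_of_disjoint, Finset.card_image_of_injective _
            (mul_right_injective _), hc, pow_succ, mul_two]
          -- A common element `b = s * x * a` of the cube and its translate would give `s * x = b *
          -- a⁻¹`, an element of `T`.
          rw [Finset.disjoint_left]
          intro b hb hb'
          obtain ⟨a, ha, hab⟩ := Finset.mem_image.1 hb'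
          exact hsx ⟨a, ha, b, hb, eq_mul_inv_of_mul_eq hab⟩
  obtain ⟨l, _, _, _, _, _, hc⟩ := key n le_rfl
  have := Fintype.ofFinite G
  have h := Finset.card_le_univ (cube l)
  rw [hc, ← Nat.card_eq_fintype_card] at h
  omega

theorem exists_derivation_of_list [Finite G] (S : Set G) {n : ℕ} (hn : Nat.card G < 2 ^ n)
    (l : List G) (hl : ∀ g ∈ l, g ∈ Subgroup.closure S) :
    ∃ t : List G, IsDerivation S t ∧ (∀ g ∈ l, g ∈ t) ∧
      t.length ≤ n * (6 * n + 7) + l.length * (6 * n + 3) := by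
  obtain ⟨t, ht, htl, hder⟩ := exists_derivation S hn
  suffices h : ∃ r : List G, IsDerivation S (r ++ t) ∧ (∀ g ∈ l, g ∈ r ++ t) ∧
      r.length ≤ l.length * (6 * n + 3) by
    obtain ⟨r, h1, h2, h3⟩ := h
    exact ⟨r ++ t, h1, h2, by rw [List.length_append]; omega⟩
  induction l with
  | nil => exact ⟨[], ht, by simp, by simp⟩
  | cons g l ih =>
    obtain ⟨r, h1, h2, h3⟩ := ih fun g hg => hl g (by simp [hg])
    obtain ⟨r', h1', h2', h3'⟩ := hder g (hl g (by simp))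
    refine ⟨r' ++ r, ?_, ?_, ?_⟩
    · rw [List.append_assoc]
      exact h2'.append h1
    · intro x hx
      rw [List.append_assoc]
      rcases List.mem_cons.1 hx with rfl | hx
      · simp only [List.mem_append] at *
        tauto
      · exact List.mem_append_right _ (h2 x hx)
    · rw [List.length_append, List.length_cons, add_mul]
      omega

end derivations

end SymmetryBreaking

/-! ### Permutations, matrices, circuits and graphs as lists that can be checked -/

namespace SymmetryBreaking

/-! ### Permutations as lists -/

def permList {n : ℕ} (g : Equiv.Perm (Fin n)) : List ℕ := List.ofFn fun i => (g i : ℕ)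

def compList (h a : List ℕ) : List ℕ := a.map fun i => h.getD i 0

theorem length_permList {n : ℕ} (g : Equiv.Perm (Fin n)) : (permList g).length = n := by
  simp [permList]

theorem getD_ofFn {α : Type} {n : ℕ} (f : Fin n → α) (i : Fin n) (d : α) :
    (List.ofFn f).getD i d = f i := by
  rw [List.getD_eq_getElem _ _ (by simp)]
  simp

theorem compList_permList {n : ℕ} (g h : Equiv.Perm (Fin n)) :
    compList (permList g) (permList h) = permList (g * h) := by
  simp only [compList, permList, List.map_ofFn]
  congr 1
  funext i
  exact getD_ofFn (fun i => (g i : ℕ)) (h i) 0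

theorem permList_one (n : ℕ) : permList (1 : Equiv.Perm (Fin n)) = List.range n := by
  refine List.ext_getElem (by simp [permList]) fun i _ _ => by simp [permList]

/-- As `a` is a permutation, the equation determines `h` at all `n` positions. Hence the verifier
can check a quotient by a composition and never has to invert. -/
theorem eq_permList_of_compList {n : ℕ} {h : List ℕ} (hl : h.length = n)
    {a b : Equiv.Perm (Fin n)} (hab : compList h (permList a) = permList b) :
    h = permList (b * a⁻¹) := by
  refine List.ext_getElem (by simp [permList, hl]) fun i hi _ => ?_
  have h1 := congrArg (fun l => l.getD (a⁻¹ ⟨i, hl ▸ hi⟩).val 0) hab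
  simp only [compList, permList, List.map_ofFn, getD_ofFn, Function.comp_apply] at h1
  rw [show a (a⁻¹ _) = _ from a.apply_symm_apply _, List.getD_eq_getElem _ _ hi] at h1
  rw [h1]
  simp [permList]

def derivStepOk (n : ℕ) (gens : List (List ℕ)) (h : List ℕ) (t : List (List ℕ)) : Bool :=
  decide (h = List.range n) || gens.any (fun g => decide (h = g)) ||
    (decide (h.length = n) && t.any fun a => t.any fun b => decide (compList h a = b))

/-- A test at every position instead of a recursion, so that it is assembled from functions known to
be in `Poly`. -/
def derivOk (n : ℕ) (gens P : List (List ℕ)) : Bool :=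
  (List.range P.length).all fun i => derivStepOk n gens (P.getD i []) (P.drop (i + 1))

theorem derivOk_cons (n : ℕ) (gens : List (List ℕ)) (h : List ℕ) (t : List (List ℕ)) :
    derivOk n gens (h :: t) = (derivStepOk n gens h t && derivOk n gens t) := by
  simp [derivOk, List.range_succ_eq_map, Function.comp_def]

theorem exists_of_derivOk {n : ℕ} {gens : List (Equiv.Perm (Fin n))} {P : List (List ℕ)}
    (hP : derivOk n (gens.map permList) P = true) :
    ∀ h ∈ P, ∃ g ∈ Subgroup.closure {g | g ∈ gens}, h = permList g := by
  induction P with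
  | nil => simp
  | cons h t ih =>
    rw [derivOk_cons, Bool.and_eq_true] at hP
    have ih := ih hP.2
    intro h' hh'
    rcases List.mem_cons.1 hh' with rfl | hh'
    · have := hP.1
      simp only [derivStepOk, Bool.or_eq_true, Bool.and_eq_true, List.any_eq_true,
        decide_eq_true_eq] at this
      rcases this with (rfl | ⟨g, hg, rfl⟩) | ⟨hl, a, ha, b, hb, hab⟩
      · exact ⟨1, one_mem _, (permList_one n).symm⟩
      · obtain ⟨g, hg', rfl⟩ := List.mem_map.1 hg
        exact ⟨g, Subgroup.subset_closure hg', rfl⟩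
      · obtain ⟨a, ha', rfl⟩ := ih a ha
        obtain ⟨b, hb', rfl⟩ := ih b hb
        exact ⟨b * a⁻¹, mul_mem hb' (inv_mem ha'), eq_permList_of_compList hl hab⟩
    · exact ih h' hh'

theorem derivOk_of_isDerivation {n : ℕ} {gens : List (Equiv.Perm (Fin n))}
    {l : List (Equiv.Perm (Fin n))} (hl : IsDerivation {g | g ∈ gens} l) :
    derivOk n (gens.map permList) (l.map permList) = true := by
  induction l with
  | nil => rfl
  | cons h t ih =>
    rw [List.map_cons, derivOk_cons, ih hl.1, Bool.and_true]
    simp only [derivStepOk, Bool.or_eq_true, Bool.and_eq_true, List.any_eq_true,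
      decide_eq_true_eq]
    rcases hl.2 with rfl | hh | ⟨a, ha, b, hb, hab⟩
    · exact .inl (.inl (permList_one n))
    · exact .inl (.inr ⟨_, List.mem_map_of_mem hh, rfl⟩)
    · exact .inr ⟨length_permList _, _, List.mem_map_of_mem ha, _, List.mem_map_of_mem hb, by
        rw [compList_permList, hab]⟩

def swapList (n i j : ℕ) : List ℕ :=
  (List.range n).map fun k => bif decide (k = i) then j else bif decide (k = j) then i else k

theorem swapList_eq {n : ℕ} (i j : Fin n) : swapList n i j = permList (Equiv.swap i j) := by
  refine List.ext_getElem (by simp [swapList, permList]) fun k _ hk => ?_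
  rw [length_permList] at hk
  simp only [swapList, permList, List.getElem_map, List.getElem_range, List.getElem_ofFn]
  have h1 : ∀ l : Fin n, decide (k = l) = decide ((⟨k, hk⟩ : Fin n) = l) := fun l => by
    simp [Fin.ext_iff]
  rw [h1, h1, Equiv.swap_apply_def]
  split_ifs with h2 h3
  · simp [h2]
  · have : ¬ j = i := h3 ▸ h2
    simp [h3, this]
  · simp [h2, h3]

/-! ### Matrices as lists of rows -/

section matrices

variable {m n : ℕ}

def matList (τ : Fin m × Fin n → Bool) : List (List Bool) :=
  List.ofFn fun i => List.ofFn fun j => τ (i, j)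

def entry (D : List (List Bool)) (i j : ℕ) : Bool := (D.getD i []).getD j false

theorem entry_matList (τ : Fin m × Fin n → Bool) (i : Fin m) (j : Fin n) :
    entry (matList τ) i j = τ (i, j) := by
  rw [entry, matList, getD_ofFn, getD_ofFn]

theorem matList_injective : Function.Injective (matList (m := m) (n := n)) := fun τ τ' h => by
  funext ⟨i, j⟩
  rw [← entry_matList τ, h, entry_matList]

def isMat (m n : ℕ) (D : List (List Bool)) : Bool :=
  decide (D.length = m) && D.all fun r => decide (r.length = n)

theorem isMat_iff (D : List (List Bool)) :
    isMat m n D = true ↔ ∃ τ : Fin m × Fin n → Bool, D = matList τ := by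
  simp only [isMat, Bool.and_eq_true, decide_eq_true_eq, List.all_eq_true]
  constructor
  · rintro ⟨rfl, h⟩
    refine ⟨fun p => entry D p.1 p.2, ?_⟩
    refine List.ext_getElem (by simp [matList]) fun i hi _ => ?_
    refine List.ext_getElem (by simp [matList, h]) fun j hj _ => ?_
    simp only [matList, List.getElem_ofFn, entry]
    rw [List.getD_eq_getElem _ _ hi, List.getD_eq_getElem _ _ hj]
  · rintro ⟨τ, rfl⟩
    refine ⟨by simp [matList], fun r hr => ?_⟩
    simp only [matList, List.mem_ofFn] at hr
    obtain ⟨i, rfl⟩ := hr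
    simp

def pullList (x y : List ℕ) (D : List (List Bool)) : List (List Bool) :=
  x.map fun i => y.map fun j => entry D i j

theorem pullList_permList (g : Equiv.Perm (Fin m)) (h : Equiv.Perm (Fin n))
    (τ : Fin m × Fin n → Bool) :
    pullList (permList g) (permList h) (matList τ) =
      matList (τ ∘ gridHom (Fin m) (Fin n) (g, h)) := by
  simp only [pullList, permList, List.map_ofFn, matList]
  congr 1
  funext i
  simp only [Function.comp_apply]
  congr 1
  funext j
  exact entry_matList τ (g i) (h j)

/-- `D` is obtained from `D'` by a listed permutation of the rows and one of the columns. -/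
def related (PX PY : List (List ℕ)) (D D' : List (List Bool)) : Bool :=
  PX.any fun x => PY.any fun y => decide (D = pullList x y D')

/-- Only transpositions are tested. They generate the symmetric groups, and there are just
quadratically many of them. -/
def closedOk (m n : ℕ) (PX PY : List (List ℕ)) (S : List (List (List Bool))) : Bool :=
  S.all fun D =>
    ((List.range m).all fun i => (List.range m).all fun j => S.any fun D' =>
      related PX PY (pullList (swapList m i j) (List.range n) D) D') &&
    ((List.range n).all fun i => (List.range n).all fun j => S.any fun D' =>
      related PX PY (pullList (List.range m) (swapList n i j) D) D')

end matrices

/-! ### Circuits as lists of triples -/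

def gateTriple {m n : ℕ} : Gate ((Fin m × Fin n) ⊕ ℕ) → ℕ × ℕ × ℕ
  | .input (.inl ij) => (0, ij.1, ij.2)
  | .input (.inr k) => (1, k, 0)
  | .not i => (2, i, 0)
  | .and i j => (3, i, j)
  | .or i j => (4, i, j)

/-- Every tag other than 0, 1, 2, 3 stands for a disjunction, both here and in `tripleVal`, so a
certificate with unexpected tags gains nothing. -/
def tripleWord (g : ℕ × ℕ × ℕ) : List Bool :=
  bif decide (g.1 = 0) then false :: false :: false :: (natWord g.2.1 ++ natWord g.2.2)
  else bif decide (g.1 = 1) then false :: false :: true :: natWord g.2.1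
  else bif decide (g.1 = 2) then false :: true :: natWord g.2.1
  else bif decide (g.1 = 3) then true :: false :: (natWord g.2.1 ++ natWord g.2.2)
  else true :: true :: (natWord g.2.1 ++ natWord g.2.2)

def tripleVal (D : List (List Bool)) (y vals : List Bool) (g : ℕ × ℕ × ℕ) : Bool :=
  bif decide (g.1 = 0) then entry D g.2.1 g.2.2
  else bif decide (g.1 = 1) then y.getD g.2.1 false
  else bif decide (g.1 = 2) then !(vals.getD g.2.1 false)
  else bif decide (g.1 = 3) then vals.getD g.2.1 false && vals.getD g.2.2 false
  else vals.getD g.2.1 false || vals.getD g.2.2 false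

def tripleValues (D : List (List Bool)) (y : List Bool) (c : List (ℕ × ℕ × ℕ)) : List Bool :=
  c.foldl (fun vals g => vals ++ [tripleVal D y vals g]) []

def tripleEval (D : List (List Bool)) (y : List Bool) (c : List (ℕ × ℕ × ℕ)) : Bool :=
  (tripleValues D y c).reverse.headD false

theorem tripleWord_gateTriple {m n : ℕ} (g : Gate ((Fin m × Fin n) ⊕ ℕ)) :
    tripleWord (gateTriple g) = gateWord g := by
  rcases g with (_ | _) | _ | _ | _ <;> simp [tripleWord, gateTriple, gateWord]

/-! ### Graphs as lists of rows -/

def rowsWord (A : List (List Bool)) : List Bool := natWord A.length ++ A.flatten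

/-- The incidence matrix of vertices and ordered pairs of vertices. -/
def incidenceList (A : List (List Bool)) : List (List Bool) :=
  (List.range A.length).map fun w => (List.range A.length).flatMap fun u =>
    (List.range A.length).map fun v => entry A u v && (decide (w = u) || decide (w = v))

/-! ### Polynomial time -/

section poly

variable {α : Type} [Enc α]

theorem natWord_eq (k : ℕ) : natWord k = List.replicate k true ++ [false] := by
  have : Computability.unaryEncodeNat k = List.replicate k true := by
    induction k with
    | zero => rfl
    | succ k ih => rw [Computability.unaryEncodeNat, ih, List.replicate_succ]
  rw [natWord, this]

@[fun_prop] theorem poly_natWord {k : α → ℕ} (hk : Poly k) : Poly fun a => natWord (k a) := by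
  simp only [natWord_eq]
  fun_prop

@[fun_prop] theorem poly_listWord {β : Type} [Enc β] {e : β → List Bool} {l : α → List β}
    (he : Poly e) (hl : Poly l) : Poly fun a => listWord e (l a) := by
  unfold listWord
  fun_prop

@[fun_prop] theorem poly_compList {h a : α → List ℕ} (hh : Poly h) (ha : Poly a) :
    Poly fun x => compList (h x) (a x) := by
  unfold compList
  fun_prop

@[fun_prop] theorem poly_derivStepOk {n : α → ℕ} {gens t : α → List (List ℕ)} {h : α → List ℕ}
    (hn : Poly n) (hgens : Poly gens) (hh : Poly h) (ht : Poly t) :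
    Poly fun x => derivStepOk (n x) (gens x) (h x) (t x) := by
  unfold derivStepOk
  fun_prop

@[fun_prop] theorem poly_derivOk {n : α → ℕ} {gens P : α → List (List ℕ)} (hn : Poly n)
    (hgens : Poly gens) (hP : Poly P) : Poly fun x => derivOk (n x) (gens x) (P x) := by
  unfold derivOk
  fun_prop

@[fun_prop] theorem poly_swapList {n i j : α → ℕ} (hn : Poly n) (hi : Poly i) (hj : Poly j) :
    Poly fun x => swapList (n x) (i x) (j x) := by
  unfold swapList
  fun_prop

@[fun_prop] theorem poly_entry {D : α → List (List Bool)} {i j : α → ℕ} (hD : Poly D)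
    (hi : Poly i) (hj : Poly j) : Poly fun x => entry (D x) (i x) (j x) := by
  unfold entry
  fun_prop

@[fun_prop] theorem poly_isMat {m n : α → ℕ} {D : α → List (List Bool)} (hm : Poly m)
    (hn : Poly n) (hD : Poly D) : Poly fun x => isMat (m x) (n x) (D x) := by
  unfold isMat
  fun_prop

@[fun_prop] theorem poly_pullList {x y : α → List ℕ} {D : α → List (List Bool)} (hx : Poly x)
    (hy : Poly y) (hD : Poly D) : Poly fun a => pullList (x a) (y a) (D a) := by
  unfold pullList
  fun_prop

@[fun_prop] theorem poly_related {PX PY : α → List (List ℕ)} {D D' : α → List (List Bool)}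
    (hPX : Poly PX) (hPY : Poly PY) (hD : Poly D) (hD' : Poly D') :
    Poly fun a => related (PX a) (PY a) (D a) (D' a) := by
  unfold related
  fun_prop

@[fun_prop] theorem poly_closedOk {m n : α → ℕ} {PX PY : α → List (List ℕ)}
    {S : α → List (List (List Bool))} (hm : Poly m) (hn : Poly n)
    (hPX : Poly PX) (hPY : Poly PY) (hS : Poly S) :
    Poly fun a => closedOk (m a) (n a) (PX a) (PY a) (S a) := by
  unfold closedOk
  fun_prop

@[fun_prop] theorem poly_tripleWord {g : α → ℕ × ℕ × ℕ} (hg : Poly g) :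
    Poly fun a => tripleWord (g a) := by
  unfold tripleWord
  fun_prop

@[fun_prop] theorem poly_tripleVal {D : α → List (List Bool)} {y vals : α → List Bool}
    {g : α → ℕ × ℕ × ℕ} (hD : Poly D) (hy : Poly y) (hvals : Poly vals) (hg : Poly g) :
    Poly fun a => tripleVal (D a) (y a) (vals a) (g a) := by
  unfold tripleVal
  fun_prop

theorem esize_listBool_le (l : List Bool) : esize l ≤ 4 * l.length + 1 := by
  have := esize_list_le (l := l) (B := 3) fun b _ => esize_bool_le b
  omega

@[fun_prop] theorem poly_tripleEval {D : α → List (List Bool)} {y : α → List Bool}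
    {c : α → List (ℕ × ℕ × ℕ)} (hD : Poly D) (hy : Poly y) (hc : Poly c) :
    Poly fun a => tripleEval (D a) (y a) (c a) := by
  have hlen : ∀ (D : List (List Bool)) (y : List Bool) (c : List (ℕ × ℕ × ℕ)) (v : List Bool),
      (c.foldl (fun vals g => vals ++ [tripleVal D y vals g]) v).length =
        v.length + c.length := by
    intro D y c
    induction c with
    | nil => simp
    | cons g c ih => intro v; rw [List.foldl_cons, ih]; simp; omega
  obtain ⟨p, hp⟩ := hc.esize_le
  have : Poly fun a => tripleValues (D a) (y a) (c a) := by
    refine Poly.foldl (h := fun a vals g => vals ++ [tripleVal (D a) (y a) vals g]) hc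
      (Poly.const _) (by fun_prop) (4 * p + 1) fun a l' hl' => ?_
    refine (esize_listBool_le _).trans ?_
    rw [hlen]
    have h1 := (hl'.length_le.trans (length_le_esize _)).trans (hp a)
    simp only [List.length_nil, Polynomial.eval_add, Polynomial.eval_mul, Polynomial.eval_ofNat,
      Polynomial.eval_one]
    omega
  unfold tripleEval
  fun_prop

@[fun_prop] theorem poly_rowsWord {A : α → List (List Bool)} (hA : Poly A) :
    Poly fun a => rowsWord (A a) := by
  unfold rowsWord
  fun_prop

@[fun_prop] theorem poly_incidenceList {A : α → List (List Bool)} (hA : Poly A) :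
    Poly fun a => incidenceList (A a) := by
  unfold incidenceList
  fun_prop

end poly

end SymmetryBreaking

/-! ### Unique readability, incidence matrices, and sets closed under transpositions -/

namespace SymmetryBreaking

/-! ### Injectivity of the words -/

/-- Injectivity with arbitrary remainders expresses that the code is prefix-free, and so carries
over to concatenations. -/
theorem natWord_append_inj {a b : ℕ} {r s : List Bool} (h : natWord a ++ r = natWord b ++ s) :
    a = b ∧ r = s := by
  simp only [natWord_eq, List.append_assoc, List.singleton_append] at h
  induction a generalizing b with
  | zero => cases b <;> simp_all [List.replicate_succ]
  | succ a ih =>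
    cases b with
    | zero => simp [List.replicate_succ] at h
    | succ b =>
      simp only [List.replicate_succ, List.cons_append, List.cons.injEq, true_and] at h
      simpa using ih h

theorem listWord_append_inj {α β : Type} {e : α → List Bool} {e' : β → List Bool}
    {R : α → β → Prop} {l : List α} {l' : List β} {r s : List Bool}
    (hR : ∀ a ∈ l, ∀ b ∈ l', ∀ r s, e a ++ r = e' b ++ s → R a b ∧ r = s)
    (h : listWord e l ++ r = listWord e' l' ++ s) : List.Forall₂ R l l' ∧ r = s := by
  induction l generalizing l' with
  | nil =>
    cases l' with
    | nil => simpa [listWord] using h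
    | cons b l' => simp [listWord] at h
  | cons a l ih =>
    cases l' with
    | nil => simp [listWord] at h
    | cons b l' =>
      have h' : e a ++ (listWord e l ++ r) = e' b ++ (listWord e' l' ++ s) := by
        simpa [listWord] using h
      obtain ⟨hab, h1⟩ := hR a (by simp) b (by simp) _ _ h'
      obtain ⟨h2, h3⟩ := ih (fun a ha b hb => hR a (by simp [ha]) b (by simp [hb])) h1
      exact ⟨.cons hab h2, h3⟩

theorem flatMap_natWord_append_inj {l l' : List ℕ} (hl : l.length = l'.length) {r s : List Bool}
    (h : l.flatMap natWord ++ r = l'.flatMap natWord ++ s) : l = l' ∧ r = s := by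
  induction l generalizing l' with
  | nil =>
    obtain rfl : l' = [] := List.length_eq_zero_iff.1 hl.symm
    simpa using h
  | cons a l ih =>
    cases l' with
    | nil => simp at hl
    | cons b l' =>
      simp only [List.flatMap_cons, List.append_assoc] at h
      obtain ⟨rfl, h1⟩ := natWord_append_inj h
      obtain ⟨rfl, h2⟩ := ih (by simpa using hl) h1
      exact ⟨rfl, h2⟩

theorem permWord_eq {n : ℕ} (g : Equiv.Perm (Fin n)) :
    permWord g = (permList g).flatMap natWord := by
  simp [permWord, permList, List.ofFn_eq_map, List.flatMap_map]

theorem eq_map_permList {n : ℕ} {l : List (List ℕ)} {gens : List (Equiv.Perm (Fin n))}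
    (hl : ∀ g ∈ l, g.length = n)
    (h : listWord (fun g => g.flatMap natWord) l = listWord permWord gens) :
    l = gens.map permList := by
  have h1 := (listWord_append_inj (e := fun g : List ℕ => g.flatMap natWord)
    (e' := permWord) (r := []) (s := []) (l := l) (l' := gens) (R := fun a b => a = permList b)
    (fun a ha b _ r s hab => by
      rw [permWord_eq] at hab
      exact flatMap_natWord_append_inj (by rw [hl a ha, length_permList]) hab)
    (by rw [h])).1
  rw [← List.forall₂_eq_eq_eq, List.forall₂_map_right_iff]
  exact h1

/-- The triple is not determined by the word, as the tag of a disjunction and unused components are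
free. The value of the gate is determined, and this suffices. -/
theorem tripleWord_append_inj {m n : ℕ} {a : ℕ × ℕ × ℕ} {g : Gate ((Fin m × Fin n) ⊕ ℕ)}
    {r s : List Bool} (h : tripleWord a ++ r = gateWord g ++ s) :
    (∀ (τ : Fin m × Fin n → Bool) (y vals : List Bool),
      tripleVal (matList τ) y vals a = g.eval (Sum.elim τ fun k => y.getD k false) vals) ∧
      r = s := by
  obtain ⟨t, i, j⟩ := a
  have ht : t = 0 ∨ t = 1 ∨ t = 2 ∨ t = 3 ∨ (t ≠ 0 ∧ t ≠ 1 ∧ t ≠ 2 ∧ t ≠ 3) := by omega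
  rcases ht with rfl | rfl | rfl | rfl | ⟨h0, h1, h2, h3⟩ <;>
    rcases g with (⟨i', j'⟩ | k) | i' | ⟨i', j'⟩ | ⟨i', j'⟩ <;>
    simp only [tripleWord, gateWord, decide_true, decide_false, cond_true, cond_false,
      one_ne_zero, OfNat.ofNat_ne_zero, OfNat.ofNat_ne_one, Nat.reduceEqDiff, List.cons_append,
      List.append_assoc, List.nil_append, List.cons.injEq, Bool.false_eq_true, Bool.true_eq_false,
      true_and, false_and, and_false, reduceCtorEq, *] at h
  · obtain ⟨hi, h'⟩ := natWord_append_inj h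
    obtain ⟨hj, h''⟩ := natWord_append_inj h'
    exact ⟨fun τ y vals => by simp [tripleVal, Gate.eval, hi, hj, entry_matList], h''⟩
  · obtain ⟨hi, h'⟩ := natWord_append_inj h
    exact ⟨fun τ y vals => by simp [tripleVal, Gate.eval, hi], h'⟩
  · obtain ⟨hi, h'⟩ := natWord_append_inj h
    exact ⟨fun τ y vals => by simp [tripleVal, Gate.eval, hi], h'⟩
  · obtain ⟨hi, h'⟩ := natWord_append_inj h
    obtain ⟨hj, h''⟩ := natWord_append_inj h'
    exact ⟨fun τ y vals => by simp [tripleVal, Gate.eval, hi, hj], h''⟩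
  · obtain ⟨hi, h'⟩ := natWord_append_inj h
    obtain ⟨hj, h''⟩ := natWord_append_inj h'
    exact ⟨fun τ y vals => by simp [tripleVal, Gate.eval, h0, h1, h2, h3, hi, hj], h''⟩

theorem tripleEval_eq_of_forall₂ {m n : ℕ} {l : List (ℕ × ℕ × ℕ)}
    {c : Circuit ((Fin m × Fin n) ⊕ ℕ)} {τ : Fin m × Fin n → Bool} {y : List Bool}
    (h : List.Forall₂ (fun a g => ∀ vals, tripleVal (matList τ) y vals a =
      g.eval (Sum.elim τ fun k => y.getD k false) vals) l c) :
    tripleEval (matList τ) y l = c.eval (Sum.elim τ fun k => y.getD k false) := by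
  have h1 : ∀ v, l.foldl (fun vals g => vals ++ [tripleVal (matList τ) y vals g]) v =
      c.foldl (fun vals g => vals ++ [g.eval (Sum.elim τ fun k => y.getD k false) vals]) v := by
    induction h with
    | nil => exact fun _ => rfl
    | cons hab _ ih => exact fun v => by rw [List.foldl_cons, List.foldl_cons, hab, ih]
  rw [tripleEval, Circuit.eval, tripleValues, Circuit.values, h1]
  generalize List.foldl _ _ c = v
  simp [List.headD_eq_head?_getD, List.getLastD_eq_getLast?]

theorem tripleEval_eq {m n : ℕ} {l : List (ℕ × ℕ × ℕ)} {c : Circuit ((Fin m × Fin n) ⊕ ℕ)}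
    (h : listWord tripleWord l = circuitWord c) (τ : Fin m × Fin n → Bool) (y : List Bool) :
    tripleEval (matList τ) y l = c.eval (Sum.elim τ fun k => y.getD k false) := by
  have h1 := (listWord_append_inj (e := tripleWord) (e' := gateWord) (r := []) (s := [])
    (fun a _ b _ r s hab => tripleWord_append_inj hab)
    (show listWord tripleWord l ++ [] = listWord gateWord c ++ [] by rw [h]; rfl)).1
  exact tripleEval_eq_of_forall₂ (h1.imp fun a b hab => hab τ y)

theorem rowsWord_append_inj {A B : List (List Bool)} (hA : ∀ r ∈ A, r.length = A.length)
    (hB : ∀ r ∈ B, r.length = B.length) {r s : List Bool}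
    (h : rowsWord A ++ r = rowsWord B ++ s) : A = B ∧ r = s := by
  simp only [rowsWord, List.append_assoc] at h
  obtain ⟨hl, h⟩ := natWord_append_inj h
  have key : ∀ (n : ℕ) (A B : List (List Bool)), A.length = B.length →
      (∀ r ∈ A, r.length = n) → (∀ r ∈ B, r.length = n) →
      A.flatten ++ r = B.flatten ++ s → A = B ∧ r = s := by
    intro n A
    induction A with
    | nil =>
      intro B hl _ _ h
      obtain rfl : B = [] := List.length_eq_zero_iff.1 hl.symm
      simpa using h
    | cons a A ih =>
      intro B hl hA hB h
      cases B with
      | nil => simp at hl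
      | cons b B =>
        simp only [List.flatten_cons, List.append_assoc] at h
        obtain ⟨rfl, h'⟩ := List.append_inj h (by rw [hA a (by simp), hB b (by simp)])
        obtain ⟨rfl, h''⟩ := ih B (by simpa using hl) (fun r hr => hA r (by simp [hr]))
          (fun r hr => hB r (by simp [hr])) h'
        exact ⟨rfl, h''⟩
  exact key A.length A B hl hA (fun r hr => by rw [hB r hr, hl]) h

/-! ### Incidence matrices -/

section incidence

variable {n : ℕ}

open Classical in
noncomputable def adjMat (G : SimpleGraph (Fin n)) (p : Fin n × Fin n) : Bool :=
  decide (G.Adj p.1 p.2)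

/-- Each column belongs to an ordered pair of vertices, and contains these vertices if they are
adjacent. -/
noncomputable def incMat (G : SimpleGraph (Fin n)) (p : Fin n × Fin (n * n)) : Bool :=
  adjMat G (p.2.divNat, p.2.modNat) && (decide (p.1 = p.2.divNat) || decide (p.1 = p.2.modNat))

theorem graphWord_eq (Γ : FinGraph) : graphWord Γ = rowsWord (matList (adjMat Γ.graph)) := by
  simp [graphWord, rowsWord, matList, adjMat, List.ofFn_eq_map, List.flatMap]

theorem length_of_mem_matList {m : ℕ} {τ : Fin m × Fin n → Bool} {r : List Bool}
    (hr : r ∈ matList τ) : r.length = n := by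
  obtain ⟨i, rfl⟩ := List.mem_ofFn.1 hr
  simp

theorem length_matList {m : ℕ} (τ : Fin m × Fin n → Bool) : (matList τ).length = m := by
  simp [matList]

theorem incidenceList_matList (G : SimpleGraph (Fin n)) :
    incidenceList (matList (adjMat G)) = matList (incMat G) := by
  have hr : ∀ {β : Type} (f : ℕ → β), (List.range n).map f = List.ofFn fun i : Fin n => f i := by
    intro β f
    refine List.ext_getElem (by simp) fun i _ _ => by simp
  simp only [incidenceList, length_matList, List.flatMap, hr]
  conv_rhs => unfold matList
  congr 1
  funext w
  rw [List.ofFn_mul]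
  congr 2
  funext u
  congr 1
  funext v
  have h1 : Fin.divNat (⟨u * n + v, by
      calc u * n + v < u * n + n := Nat.add_lt_add_left v.2 _
        _ = (u + 1) * n := by ring
        _ ≤ n * n := Nat.mul_le_mul_right _ u.2⟩ : Fin (n * n)) = u := by
    refine Fin.ext ?_
    simp only [Fin.divNat]
    rw [mul_comm, Nat.mul_add_div (Nat.zero_lt_of_lt v.2), Nat.div_eq_of_lt v.2, add_zero]
  have h2 : Fin.modNat (⟨u * n + v, by
      calc u * n + v < u * n + n := Nat.add_lt_add_left v.2 _
        _ = (u + 1) * n := by ring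
        _ ≤ n * n := Nat.mul_le_mul_right _ u.2⟩ : Fin (n * n)) = v := by
    refine Fin.ext ?_
    simp only [Fin.modNat]
    rw [mul_comm, Nat.mul_add_mod, Nat.mod_eq_of_lt v.2]
  simp only [incMat, h1, h2, entry_matList, Fin.ext_iff]

/-- Columns of non-adjacent pairs are zero, and a nonzero column contains exactly the ends of an
edge. So the matrix determines the graph in a way that does not depend on the order of its columns.
-/
theorem adj_iff_incMat (G : SimpleGraph (Fin n)) (u v : Fin n) :
    G.Adj u v ↔ u ≠ v ∧ ∃ c, incMat G (u, c) = true ∧ incMat G (v, c) = true := by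
  simp only [incMat, adjMat, Bool.and_eq_true, Bool.or_eq_true, decide_eq_true_eq]
  constructor
  · intro h
    refine ⟨h.ne, finProdFinEquiv (u, v), ?_⟩
    have h1 : finProdFinEquiv.symm (finProdFinEquiv (u, v)) = (u, v) := by simp
    have h2 : (finProdFinEquiv (u, v)).divNat = u := congrArg Prod.fst h1
    have h3 : (finProdFinEquiv (u, v)).modNat = v := congrArg Prod.snd h1
    rw [h2, h3]
    exact ⟨⟨h, .inl rfl⟩, ⟨h, .inr rfl⟩⟩
  · rintro ⟨hne, c, ⟨h, hu⟩, ⟨_, hv⟩⟩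
    rcases hu with rfl | rfl <;> rcases hv with rfl | rfl
    · exact absurd rfl hne
    · exact h
    · exact h.symm
    · exact absurd rfl hne

/-- An isomorphism acts on pairs of vertices and thus on the columns. Conversely, the permutation of
the rows alone preserves adjacency, because adjacency is the existence of a common column. -/
theorem nonempty_iso_iff (G H : SimpleGraph (Fin n)) :
    Nonempty (G ≃g H) ↔ ∃ π ρ, incMat H = incMat G ∘ gridHom (Fin n) (Fin (n * n)) (π, ρ) := by
  constructor
  · rintro ⟨φ⟩
    let ρ : Equiv.Perm (Fin (n * n)) := finProdFinEquiv.symm.trans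
      ((Equiv.prodCongr φ.symm.toEquiv φ.symm.toEquiv).trans finProdFinEquiv)
    refine ⟨φ.symm.toEquiv, ρ, funext fun ⟨w, c⟩ => ?_⟩
    have h1 : finProdFinEquiv.symm (ρ c) = (φ.symm c.divNat, φ.symm c.modNat) := by
      simp [ρ]
    have h2 : (ρ c).divNat = φ.symm c.divNat := congrArg Prod.fst h1
    have h3 : (ρ c).modNat = φ.symm c.modNat := congrArg Prod.snd h1
    have h4 : gridHom (Fin n) (Fin (n * n)) (φ.symm.toEquiv, ρ) (w, c) = (φ.symm w, ρ c) := rfl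
    rw [Function.comp_apply, h4]
    simp only [incMat, adjMat]
    rw [h2, h3]
    simp only [φ.symm.injective.eq_iff]
    congr 1
    exact decide_eq_decide.2 φ.symm.map_adj_iff.symm
  · rintro ⟨π, ρ, h⟩
    -- The assignments are pulled back, so `π` maps vertices of `H` to vertices of `G`.
    refine ⟨⟨π.symm, fun {u v} => ?_⟩⟩
    have h1 : ∀ w c, incMat H (w, c) = incMat G (π w, ρ c) := fun w c => congrFun h (w, c)
    rw [adj_iff_incMat, adj_iff_incMat]
    simp only [h1, Equiv.apply_symm_apply, ne_eq, EmbeddingLike.apply_eq_iff_eq]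
    exact and_congr_right fun _ => (ρ.surjective.exists
      (p := fun c => incMat G (u, c) = true ∧ incMat G (v, c) = true)).symm

end incidence

/-! ### Closed sets of representatives -/

section orbits

variable {A B : Type} {X : Subgroup (Equiv.Perm A)} {Y : Subgroup (Equiv.Perm B)}

theorem comp_gridHom_mul (τ : A × B → Bool) (g g' : Equiv.Perm A) (h h' : Equiv.Perm B) :
    τ ∘ gridHom A B (g * g', h * h') = (τ ∘ gridHom A B (g, h)) ∘ gridHom A B (g', h') := rfl

theorem mem_assignmentOrbit_iff (τ τ' : A × B → Bool) :
    τ' ∈ assignmentOrbit (gridGroup X Y) τ ↔ ∃ g ∈ X, ∃ h ∈ Y, τ = τ' ∘ gridHom A B (g, h) := by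
  constructor
  · rintro ⟨_, ⟨⟨g, h⟩, ⟨hg, hh⟩, rfl⟩, rfl⟩
    refine ⟨g, hg, h, hh, ?_⟩
    rw [Function.comp_assoc, ← Equiv.Perm.coe_mul, inv_mul_cancel]
    rfl
  · rintro ⟨g, hg, h, hh, rfl⟩
    refine ⟨gridHom A B (g, h), ⟨(g, h), ⟨hg, hh⟩, rfl⟩, ?_⟩
    rw [Function.comp_assoc, ← Equiv.Perm.coe_mul, mul_inv_cancel]
    rfl

/-- If a set of assignments is closed, up to the action of `X × Y`, under transpositions of rows and
of columns, then its orbits under `X × Y` are closed under all permutations of rows and columns. -/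
theorem exists_comp_gridHom_eq [Finite A] [Finite B] [DecidableEq A] [DecidableEq B]
    {S : Set (A × B → Bool)}
    (hA : ∀ D ∈ S, ∀ i j, ∃ D' ∈ S, ∃ g ∈ X, ∃ h ∈ Y,
      D ∘ gridHom A B (Equiv.swap i j, 1) = D' ∘ gridHom A B (g, h))
    (hB : ∀ D ∈ S, ∀ i j, ∃ D' ∈ S, ∃ g ∈ X, ∃ h ∈ Y,
      D ∘ gridHom A B (1, Equiv.swap i j) = D' ∘ gridHom A B (g, h))
    (π : Equiv.Perm A) (ρ : Equiv.Perm B) :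
    ∀ D ∈ S, ∀ x ∈ X, ∀ y ∈ Y, ∃ D' ∈ S, ∃ g ∈ X, ∃ h ∈ Y,
      D ∘ gridHom A B (x * π, y * ρ) = D' ∘ gridHom A B (g, h) := by
  have hπ : ∀ D ∈ S, ∀ x ∈ X, ∀ y ∈ Y, ∃ D' ∈ S, ∃ g ∈ X, ∃ h ∈ Y,
      D ∘ gridHom A B (x * π, y) = D' ∘ gridHom A B (g, h) := by
    induction π using Equiv.Perm.swap_induction_on with
    | one => exact fun D hD x hx y hy => ⟨D, hD, x, hx, y, hy, by rw [mul_one]⟩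
    | swap_mul f i j _ ih =>
      intro D hD x hx y hy
      -- Since `x * swap i j = swap (x i) (x j) * x`, the transposition can be moved to the left of
      -- `x`, where closedness of `S` applies; the new group elements `g`, `h` are absorbed into
      -- `x`, `y`.
      obtain ⟨D', hD', g, hg, h, hh, e⟩ := hA D hD (x i) (x j)
      obtain ⟨D'', hD'', g', hg', h', hh', e'⟩ := ih D' hD' (g * x) (mul_mem hg hx) (h * y)
        (mul_mem hh hy)
      refine ⟨D'', hD'', g', hg', h', hh', ?_⟩
      rw [← e', mul_assoc g, comp_gridHom_mul D', ← e, ← comp_gridHom_mul, one_mul, ← mul_assoc,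
        ← mul_assoc, Equiv.mul_swap_eq_swap_mul]
  intro D hD x hx y hy
  obtain ⟨D', hD', g, hg, h, hh, e⟩ := hπ D hD x hx y hy
  have hρ : ∀ D ∈ S, ∀ x ∈ X, ∀ y ∈ Y, ∃ D' ∈ S, ∃ g ∈ X, ∃ h ∈ Y,
      D ∘ gridHom A B (x, y * ρ) = D' ∘ gridHom A B (g, h) := by
    clear e
    induction ρ using Equiv.Perm.swap_induction_on with
    | one => exact fun D hD x hx y hy => ⟨D, hD, x, hx, y, hy, by rw [mul_one]⟩
    | swap_mul f i j _ ih =>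
      intro D hD x hx y hy
      obtain ⟨D', hD', g, hg, h, hh, e⟩ := hB D hD (y i) (y j)
      obtain ⟨D'', hD'', g', hg', h', hh', e'⟩ := ih D' hD' (g * x) (mul_mem hg hx) (h * y)
        (mul_mem hh hy)
      refine ⟨D'', hD'', g', hg', h', hh', ?_⟩
      rw [← e', mul_assoc h, comp_gridHom_mul D', ← e, ← comp_gridHom_mul, one_mul, ← mul_assoc,
        ← mul_assoc, Equiv.mul_swap_eq_swap_mul]
  obtain ⟨D'', hD'', g', hg', h', hh', e'⟩ := hρ D' hD' g hg h hh
  refine ⟨D'', hD'', g', hg', h', hh', ?_⟩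
  rw [← e']
  -- The actions on rows and on columns are split, so that `ρ` can be applied after the rows have
  -- been dealt with.
  have h1 := comp_gridHom_mul D (x * π) 1 y ρ
  have h2 := comp_gridHom_mul D' g 1 h ρ
  rw [mul_one] at h1 h2
  rw [h1, h2, e]

end orbits

end SymmetryBreaking

/-! ### The verifier for matrices in different orbits, and its soundness -/

namespace SymmetryBreaking

/-! ### Checking that two matrices lie in different orbits -/

/-- `YS` is one common pool of assignments of the additional variables; it need not be recorded
which of them belongs to `D`. -/
def satOk (YS : List (List Bool)) (C : List (ℕ × ℕ × ℕ)) (D : List (List Bool)) : Bool :=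
  YS.any fun y => tripleEval D y C

def gensOk (n : ℕ) (w : List Bool) (G : List (List ℕ)) : Bool :=
  (G.all fun g => decide (g.length = n)) &&
    decide (listWord (fun g : List ℕ => g.flatMap natWord) G = w)

/-- `GX`, `GY` are the generators of the groups written in `WX`, `WY`, and `PX`, `PY` are elements of
these groups; `C` is the circuit written in `WC`. -/
def groupsOk (m n : ℕ) (WX WY WC : List Bool) (GX GY : List (List ℕ)) (C : List (ℕ × ℕ × ℕ))
    (PX PY : List (List ℕ)) : Bool :=
  gensOk m WX GX && gensOk n WY GY && decide (listWord tripleWord C = WC) && derivOk m GX PX &&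
    derivOk n GY PY

/-- `S` contains a representative of `D₁`, but not the representative `E` of `D₂`. -/
def orbitsOk (m n : ℕ) (C : List (ℕ × ℕ × ℕ)) (PX PY : List (List ℕ)) (YS : List (List Bool))
    (S : List (List (List Bool))) (E D₁ D₂ : List (List Bool)) : Bool :=
  (S.all fun D => isMat m n D && satOk YS C D) && (S.any fun D => related PX PY D₁ D) &&
    closedOk m n PX PY S && (isMat m n E && satOk YS C E) && related PX PY D₂ E &&
    S.all fun D => !decide (E = D)

section poly

variable {α : Type} [Enc α]

@[fun_prop] theorem poly_satOk {YS : α → List (List Bool)} {C : α → List (ℕ × ℕ × ℕ)}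
    {D : α → List (List Bool)} (hYS : Poly YS) (hC : Poly C) (hD : Poly D) :
    Poly fun a => satOk (YS a) (C a) (D a) := by
  unfold satOk
  fun_prop

@[fun_prop] theorem poly_gensOk {n : α → ℕ} {w : α → List Bool} {G : α → List (List ℕ)}
    (hn : Poly n) (hw : Poly w) (hG : Poly G) : Poly fun a => gensOk (n a) (w a) (G a) := by
  unfold gensOk
  fun_prop

@[fun_prop] theorem poly_groupsOk {m n : α → ℕ} {WX WY WC : α → List Bool}
    {GX GY PX PY : α → List (List ℕ)} {C : α → List (ℕ × ℕ × ℕ)} (hm : Poly m) (hn : Poly n)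
    (hWX : Poly WX) (hWY : Poly WY) (hWC : Poly WC) (hGX : Poly GX) (hGY : Poly GY) (hC : Poly C)
    (hPX : Poly PX) (hPY : Poly PY) : Poly fun a =>
      groupsOk (m a) (n a) (WX a) (WY a) (WC a) (GX a) (GY a) (C a) (PX a) (PY a) := by
  unfold groupsOk
  fun_prop

@[fun_prop] theorem poly_orbitsOk {m n : α → ℕ} {C : α → List (ℕ × ℕ × ℕ)}
    {PX PY : α → List (List ℕ)} {YS E D₁ D₂ : α → List (List Bool)}
    {S : α → List (List (List Bool))} (hm : Poly m) (hn : Poly n) (hC : Poly C) (hPX : Poly PX)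
    (hPY : Poly PY) (hYS : Poly YS) (hS : Poly S) (hE : Poly E) (hD₁ : Poly D₁) (hD₂ : Poly D₂) :
    Poly fun a => orbitsOk (m a) (n a) (C a) (PX a) (PY a) (YS a) (S a) (E a) (D₁ a) (D₂ a) := by
  unfold orbitsOk
  fun_prop

end poly

section soundness

variable {m n : ℕ} {gX : List (Equiv.Perm (Fin m))} {gY : List (Equiv.Perm (Fin n))}

theorem exists_of_related {PX PY : List (List ℕ)}
    (hX : ∀ x ∈ PX, ∃ g ∈ Subgroup.closure {g | g ∈ gX}, x = permList g)
    (hY : ∀ y ∈ PY, ∃ h ∈ Subgroup.closure {h | h ∈ gY}, y = permList h)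
    {τ τ' : Fin m × Fin n → Bool} (h : related PX PY (matList τ) (matList τ') = true) :
    ∃ g ∈ Subgroup.closure {g | g ∈ gX}, ∃ h ∈ Subgroup.closure {h | h ∈ gY},
      τ = τ' ∘ gridHom _ _ (g, h) := by
  simp only [related, List.any_eq_true, decide_eq_true_eq] at h
  obtain ⟨x, hx, y, hy, h⟩ := h
  obtain ⟨g, hg, rfl⟩ := hX x hx
  obtain ⟨k, hk, rfl⟩ := hY y hy
  rw [pullList_permList] at h
  exact ⟨g, hg, k, hk, matList_injective h⟩

theorem satisfiableAt_of_satOk {YS : List (List Bool)} {C : List (ℕ × ℕ × ℕ)}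
    {c : Circuit ((Fin m × Fin n) ⊕ ℕ)} (hC : listWord tripleWord C = circuitWord c)
    {τ : Fin m × Fin n → Bool} (h : satOk YS C (matList τ) = true) : SatisfiableAt c τ := by
  obtain ⟨y, _, hy⟩ := List.any_eq_true.1 h
  rw [tripleEval_eq hC] at hy
  exact ⟨_, hy⟩

theorem IsCompleteSymmetryBreaking.eq {A B : Type} {X : Subgroup (Equiv.Perm A)}
    {Y : Subgroup (Equiv.Perm B)} {c : Circuit ((A × B) ⊕ ℕ)}
    (hc : IsCompleteSymmetryBreaking (gridGroup X Y) c) {τ τ₁ τ₂ : A × B → Bool}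
    (h₁ : SatisfiableAt c τ₁) (h₂ : SatisfiableAt c τ₂)
    (h₁' : ∃ g ∈ X, ∃ h ∈ Y, τ = τ₁ ∘ gridHom A B (g, h))
    (h₂' : ∃ g ∈ X, ∃ h ∈ Y, τ = τ₂ ∘ gridHom A B (g, h)) : τ₁ = τ₂ := by
  obtain ⟨τ', _, _, h⟩ := hc.2 τ
  have key : ∀ σ, SatisfiableAt c σ → (∃ g ∈ X, ∃ h ∈ Y, τ = σ ∘ gridHom A B (g, h)) → σ = τ' :=
    fun σ hσ hσ' => by
      by_contra hne
      exact h σ ((mem_assignmentOrbit_iff τ σ).2 hσ') hne hσ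
  rw [key τ₁ h₁ h₁', key τ₂ h₂ h₂']

theorem IsCompleteSymmetryBreaking.exists {A B : Type} {X : Subgroup (Equiv.Perm A)}
    {Y : Subgroup (Equiv.Perm B)} {c : Circuit ((A × B) ⊕ ℕ)}
    (hc : IsCompleteSymmetryBreaking (gridGroup X Y) c) (τ : A × B → Bool) :
    ∃ τ', SatisfiableAt c τ' ∧ ∃ g ∈ X, ∃ h ∈ Y, τ = τ' ∘ gridHom A B (g, h) := by
  obtain ⟨τ', h, hs, _⟩ := hc.2 τ
  exact ⟨τ', hs, (mem_assignmentOrbit_iff τ τ').1 h⟩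

/-- Suppose `β = α ∘ (π, ρ)`. Some `δ` in `S` lies in the X × Y-orbit of `α`, and closedness under
transpositions yields `δ'` in `S` in the X × Y-orbit of `β`. Both `δ'` and `E` are satisfiable
representatives of that orbit, hence equal, although `E` is not in `S`. Completeness of `S` is never
needed. -/
theorem ne_comp_gridHom_of_check {c : Circuit ((Fin m × Fin n) ⊕ ℕ)}
    (hc : IsCompleteSymmetryBreaking
      (gridGroup (Subgroup.closure {g | g ∈ gX}) (Subgroup.closure {h | h ∈ gY})) c)
    {GX GY PX PY : List (List ℕ)} {C : List (ℕ × ℕ × ℕ)} {YS E : List (List Bool)}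
    {S : List (List (List Bool))} {α β : Fin m × Fin n → Bool}
    (h₁ : groupsOk m n (listWord permWord gX) (listWord permWord gY) (circuitWord c)
      GX GY C PX PY = true)
    (h₂ : orbitsOk m n C PX PY YS S E (matList α) (matList β) = true)
    (π : Equiv.Perm (Fin m)) (ρ : Equiv.Perm (Fin n)) : β ≠ α ∘ gridHom _ _ (π, ρ) := by
  simp only [groupsOk, gensOk, Bool.and_eq_true, decide_eq_true_eq, List.all_eq_true] at h₁
  obtain ⟨⟨⟨⟨⟨lX, hGX⟩, lY, hGY⟩, hC⟩, hPX⟩, hPY⟩ := h₁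
  rw [eq_map_permList lX hGX] at hPX
  rw [eq_map_permList lY hGY] at hPY
  have hX := exists_of_derivOk hPX
  have hY := exists_of_derivOk hPY
  simp only [orbitsOk, closedOk, Bool.and_eq_true, List.all_eq_true, List.any_eq_true,
    List.mem_range, isMat_iff, Bool.not_eq_true', decide_eq_false_iff_not] at h₂
  obtain ⟨⟨⟨⟨⟨hS, D, hD, hα⟩, hcl⟩, ⟨ε, rfl⟩, hE⟩, hβ⟩, hES⟩ := h₂
  set T : Set (Fin m × Fin n → Bool) := {τ | matList τ ∈ S} with hT
  have hTr : ∀ τ, (∃ D ∈ S, related PX PY (matList τ) D = true) → ∃ D' ∈ T,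
      ∃ g ∈ Subgroup.closure {g | g ∈ gX}, ∃ h ∈ Subgroup.closure {h | h ∈ gY},
        τ = D' ∘ gridHom _ _ (g, h) := by
    rintro τ ⟨D, hD, h⟩
    obtain ⟨⟨δ, rfl⟩, _⟩ := hS D hD
    exact ⟨δ, hD, exists_of_related hX hY h⟩
  rintro rfl
  obtain ⟨δ, hδ, x, hx, y, hy, e⟩ := hTr α ⟨D, hD, hα⟩
  obtain ⟨δ', hδ', hr⟩ := exists_comp_gridHom_eq (S := T) (fun τ hτ i j => hTr _ (by
      obtain ⟨D', hD', h⟩ := (hcl _ hτ).1 i i.2 j j.2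
      refine ⟨D', hD', ?_⟩
      rwa [swapList_eq, ← permList_one, pullList_permList] at h)) (fun τ hτ i j => hTr _ (by
      obtain ⟨D', hD', h⟩ := (hcl _ hτ).2 i i.2 j j.2
      refine ⟨D', hD', ?_⟩
      rwa [swapList_eq, ← permList_one, pullList_permList] at h)) π ρ δ hδ x hx y hy
  rw [comp_gridHom_mul, ← e] at hr
  have := hc.eq (satisfiableAt_of_satOk hC hE) (satisfiableAt_of_satOk hC (hS _ hδ').2)
    (exists_of_related hX hY hβ) hr
  exact hES _ hδ' (congrArg matList this)

end soundness

end SymmetryBreaking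

/-! ### Size bounds and the number of representatives -/

namespace SymmetryBreaking

/-! ### Sizes -/

section sizes

variable {m n : ℕ}

theorem length_lt_length_listWord {α : Type} (e : α → List Bool) (l : List α) :
    l.length < (listWord e l).length := by
  induction l with
  | nil => simp [listWord]
  | cons a l ih =>
    simp only [listWord, List.flatMap_cons, List.length_append, List.length_cons] at ih ⊢
    omega

theorem length_lt_length_listWord_of_mem {α : Type} (e : α → List Bool) {l : List α} {a : α}
    (h : a ∈ l) : (e a).length < (listWord e l).length := by
  induction h with
  | head l =>
    simp only [listWord, List.flatMap_cons, List.length_append, List.length_cons]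
    omega
  | tail b _ ih =>
    simp only [listWord, List.flatMap_cons, List.length_append, List.length_cons] at ih ⊢
    omega

theorem length_natWord (k : ℕ) : (natWord k).length = k + 1 := by simp [natWord_eq]

theorem esize_permList_le (g : Equiv.Perm (Fin n)) : esize (permList g) ≤ n * (2 * n + 2) + 1 := by
  have := esize_list_le (l := permList g) (B := 2 * n + 1) fun i hi => by
    obtain ⟨j, rfl⟩ := List.mem_ofFn.1 hi
    rw [esize_nat]
    omega
  rwa [length_permList] at this

theorem esize_map_permList_le {k K : ℕ} {l : List (Equiv.Perm (Fin n))} (hn : n ≤ K)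
    (hk : l.length ≤ k) : esize (l.map permList) ≤ k * (K * (2 * K + 2) + 2) + 1 := by
  refine (esize_list_le (B := K * (2 * K + 2) + 1) fun g hg => ?_).trans ?_
  · obtain ⟨g, _, rfl⟩ := List.mem_map.1 hg
    exact (esize_permList_le g).trans (by gcongr)
  · rw [List.length_map]
    gcongr

theorem esize_matList_le {K : ℕ} (τ : Fin m × Fin n → Bool) (hm : m ≤ K) (hn : n ≤ K) :
    esize (matList τ) ≤ K * (4 * K + 2) + 1 := by
  refine (esize_list_le (B := 4 * K + 1) fun r hr => ?_).trans ?_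
  · refine (esize_listBool_le r).trans ?_
    rw [length_of_mem_matList hr]
    omega
  · rw [length_matList]
    gcongr

theorem esize_gateTriple_le (g : Gate ((Fin m × Fin n) ⊕ ℕ)) :
    esize (gateTriple g) ≤ 4 * (gateWord g).length + 13 := by
  rcases g with (⟨i, j⟩ | k) | i | ⟨i, j⟩ | ⟨i, j⟩ <;>
    simp only [gateTriple, gateWord, esize_pair, esize_nat, List.length_append, length_natWord,
      List.length_cons] <;> omega

theorem esize_map_gateTriple_le (c : Circuit ((Fin m × Fin n) ⊕ ℕ)) {K : ℕ}
    (hK : (circuitWord c).length ≤ K) :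
    esize (c.map gateTriple) ≤ K * (4 * K + 14) + 1 := by
  refine (esize_list_le (B := 4 * K + 13) fun g hg => ?_).trans ?_
  · obtain ⟨g, hg', rfl⟩ := List.mem_map.1 hg
    have h1 := esize_gateTriple_le g
    have h2 := length_lt_length_listWord_of_mem gateWord hg'
    have h3 : (listWord gateWord c).length ≤ K := hK
    omega
  · rw [List.length_map]
    have := (length_lt_length_listWord gateWord c).le.trans hK
    gcongr

theorem card_perm_lt {K : ℕ} (hn : n ≤ K) : Nat.card (Equiv.Perm (Fin n)) < 2 ^ (K * K + 1) := by
  rw [Nat.card_eq_fintype_card, Fintype.card_perm, Fintype.card_fin]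
  calc n.factorial ≤ n ^ n := Nat.factorial_le_pow n
    _ ≤ (2 ^ n) ^ n := Nat.pow_le_pow_left Nat.lt_two_pow_self.le n
    _ = 2 ^ (n * n) := (pow_mul 2 n n).symm
    _ ≤ 2 ^ (K * K) := Nat.pow_le_pow_right two_pos (Nat.mul_le_mul hn hn)
    _ < 2 ^ (K * K + 1) := Nat.pow_lt_pow_right one_lt_two (Nat.lt_succ_self _)

end sizes

/-! ### Satisfying assignments of polynomial length -/

section satisfiability

variable {m n : ℕ}

theorem Circuit.eval_congr {V : Type} {c : Circuit V} {θ θ' : V → Bool}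
    (h : ∀ v, Gate.input v ∈ c → θ v = θ' v) : c.eval θ = c.eval θ' := by
  suffices key : ∀ vals, c.foldl (fun vals g => vals ++ [g.eval θ vals]) vals =
      c.foldl (fun vals g => vals ++ [g.eval θ' vals]) vals by
    rw [Circuit.eval, Circuit.eval, Circuit.values, Circuit.values, key]
  induction c with
  | nil => exact fun _ => rfl
  | cons g c ih =>
    intro vals
    have hg : g.eval θ vals = g.eval θ' vals := by
      cases g with
      | input v => exact h v (by simp)
      | _ => rfl
    rw [List.foldl_cons, List.foldl_cons, hg, ih fun v hv => h v (by simp [hv])]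

theorem listWord_map_gateTriple (c : Circuit ((Fin m × Fin n) ⊕ ℕ)) :
    listWord tripleWord (c.map gateTriple) = circuitWord c := by
  simp only [listWord, circuitWord, List.flatMap_map, tripleWord_gateTriple]

theorem exists_tripleEval_of_satisfiableAt {c : Circuit ((Fin m × Fin n) ⊕ ℕ)}
    {τ : Fin m × Fin n → Bool} (h : SatisfiableAt c τ) : ∃ y : List Bool,
      y.length = (circuitWord c).length ∧ tripleEval (matList τ) y (c.map gateTriple) = true := by
  obtain ⟨y, hy⟩ := h
  -- Indices of additional variables are written in unary, so those that occur are smaller than the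
  -- length of the word of the circuit, and `y` may be cut off there.
  refine ⟨(List.range (circuitWord c).length).map y, by simp, ?_⟩
  rw [tripleEval_eq (listWord_map_gateTriple c), ← hy]
  refine Circuit.eval_congr fun v hv => ?_
  rcases v with p | k
  · rfl
  · have h1 := length_lt_length_listWord_of_mem gateWord hv
    have hk : k < (circuitWord c).length := by
      simp only [gateWord, List.length_append, length_natWord] at h1
      change k < (listWord gateWord c).length
      omega
    simp only [Sum.elim_inr]
    rw [List.getD_eq_getElem _ _ (by simpa using hk)]
    simp

end satisfiability

/-! ### Counting representatives -/

/-- Map a representative `α ∘ (π, ρ)` to the cosets of `π` modulo `X` and of `ρ` modulo `Y`. Two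
representatives with the same cosets lie in one X × Y-orbit and so coincide. -/
theorem IsCompleteSymmetryBreaking.ncard_le {A B : Type} [Finite A] [Finite B]
    {X : Subgroup (Equiv.Perm A)}
    {Y : Subgroup (Equiv.Perm B)} {c : Circuit ((A × B) ⊕ ℕ)}
    (hc : IsCompleteSymmetryBreaking (gridGroup X Y) c) (α : A × B → Bool) :
    {τ | SatisfiableAt c τ ∧ ∃ π ρ, τ = α ∘ gridHom A B (π, ρ)}.ncard ≤ X.index * Y.index := by
  choose! π ρ h using fun (τ : A × B → Bool)
    (hτ : τ ∈ {τ | SatisfiableAt c τ ∧ ∃ π ρ, τ = α ∘ gridHom A B (π, ρ)}) => hτ.2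
  have hle := Set.ncard_le_ncard_of_injOn (t := (Set.univ :
      Set ((Equiv.Perm A ⧸ X) × (Equiv.Perm B ⧸ Y))))
    (fun τ => ((π τ : Equiv.Perm A ⧸ X), (ρ τ : Equiv.Perm B ⧸ Y)))
    (s := {τ | SatisfiableAt c τ ∧ ∃ π ρ, τ = α ∘ gridHom A B (π, ρ)}) (fun _ _ => Set.mem_univ _)
    (by
      intro τ hτ τ' hτ' e
      simp only [Prod.mk.injEq, QuotientGroup.eq] at e
      refine hc.eq hτ.1 hτ'.1 (τ := τ') ⟨_, e.1, _, e.2, ?_⟩ ⟨1, one_mem _, 1, one_mem _, rfl⟩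
      have e' := comp_gridHom_mul α (π τ) ((π τ)⁻¹ * π τ') (ρ τ) ((ρ τ)⁻¹ * ρ τ')
      rwa [mul_inv_cancel_left, mul_inv_cancel_left, ← h τ hτ, ← h τ' hτ'] at e') (Set.toFinite _)
  rwa [Set.ncard_univ, Nat.card_prod] at hle

end SymmetryBreaking

/-! ### Existence of short certificates for matrices in different orbits -/

namespace SymmetryBreaking

/-! ### Certificates for matrices in different orbits -/

/-- The lists `GX`, `GY`, `C`, then `PX`, `PY`, and finally `YS`, `S`, `E`. -/
abbrev OrbitCert : Type :=
  (List (List ℕ) × List (List ℕ) × List (ℕ × ℕ × ℕ)) × (List (List ℕ) × List (List ℕ)) ×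
    (List (List Bool) × List (List (List Bool)) × List (List Bool))

def certOk (m n : ℕ) (WX WY WC : List Bool) (D₁ D₂ : List (List Bool)) (v : OrbitCert) : Bool :=
  groupsOk m n WX WY WC v.1.1 v.1.2.1 v.1.2.2 v.2.1.1 v.2.1.2 &&
    orbitsOk m n v.1.2.2 v.2.1.1 v.2.1.2 v.2.2.1 v.2.2.2.1 v.2.2.2.2 D₁ D₂

@[fun_prop] theorem poly_certOk {α : Type} [Enc α] {m n : α → ℕ} {WX WY WC : α → List Bool}
    {D₁ D₂ : α → List (List Bool)} {v : α → OrbitCert} (hm : Poly m) (hn : Poly n)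
    (hWX : Poly WX) (hWY : Poly WY) (hWC : Poly WC) (hD₁ : Poly D₁) (hD₂ : Poly D₂) (hv : Poly v) :
    Poly fun a => certOk (m a) (n a) (WX a) (WY a) (WC a) (D₁ a) (D₂ a) (v a) := by
  unfold certOk
  fun_prop

section completeness

variable {m n : ℕ} {gX : List (Equiv.Perm (Fin m))} {gY : List (Equiv.Perm (Fin n))}

theorem gensOk_map_permList (gX : List (Equiv.Perm (Fin m))) :
    gensOk m (listWord permWord gX) (gX.map permList) = true := by
  simp only [gensOk, Bool.and_eq_true, List.all_eq_true, decide_eq_true_eq]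
  refine ⟨fun g hg => ?_, ?_⟩
  · obtain ⟨g, _, rfl⟩ := List.mem_map.1 hg
    exact length_permList g
  · simp only [listWord, List.flatMap_map, permWord_eq]

theorem related_permList {PX : List (Equiv.Perm (Fin m))} {PY : List (Equiv.Perm (Fin n))}
    {g : Equiv.Perm (Fin m)} {h : Equiv.Perm (Fin n)} (hg : g ∈ PX) (hh : h ∈ PY)
    {τ τ' : Fin m × Fin n → Bool} (e : τ = τ' ∘ gridHom _ _ (g, h)) :
    related (PX.map permList) (PY.map permList) (matList τ) (matList τ') = true := by
  simp only [related, List.any_eq_true, decide_eq_true_eq]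
  exact ⟨_, List.mem_map_of_mem hg, _, List.mem_map_of_mem hh, by rw [pullList_permList, e]⟩

/-- The images of `τ` under the transpositions of rows and of columns. -/
def swaps (τ : Fin m × Fin n → Bool) : List (Fin m × Fin n → Bool) :=
  ((List.finRange m).flatMap fun i => (List.finRange m).map fun j =>
      τ ∘ gridHom _ _ (Equiv.swap i j, 1)) ++
    (List.finRange n).flatMap fun i => (List.finRange n).map fun j =>
      τ ∘ gridHom _ _ (1, Equiv.swap i j)

theorem length_swaps (τ : Fin m × Fin n → Bool) : (swaps τ).length = m * m + n * n := by
  simp [swaps, List.length_flatMap]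

theorem swap_one_mem_swaps (τ : Fin m × Fin n → Bool) (i j : Fin m) :
    τ ∘ gridHom _ _ (Equiv.swap i j, 1) ∈ swaps τ := by
  refine List.mem_append_left _ (List.mem_flatMap.2 ⟨i, List.mem_finRange i, ?_⟩)
  exact List.mem_map.2 ⟨j, List.mem_finRange j, rfl⟩

theorem one_swap_mem_swaps (τ : Fin m × Fin n → Bool) (i j : Fin n) :
    τ ∘ gridHom _ _ (1, Equiv.swap i j) ∈ swaps τ := by
  refine List.mem_append_right _ (List.mem_flatMap.2 ⟨i, List.mem_finRange i, ?_⟩)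
  exact List.mem_map.2 ⟨j, List.mem_finRange j, rfl⟩

theorem exists_of_mem_swaps {τ τ' : Fin m × Fin n → Bool} (h : τ' ∈ swaps τ) :
    ∃ π ρ, τ' = τ ∘ gridHom _ _ (π, ρ) := by
  rcases List.mem_append.1 h with h | h <;> obtain ⟨i, _, h⟩ := List.mem_flatMap.1 h <;>
    obtain ⟨j, _, rfl⟩ := List.mem_map.1 h
  · exact ⟨_, _, rfl⟩
  · exact ⟨_, _, rfl⟩

theorem closedOk_of_swaps {PX PY : List (List ℕ)} {T : List (Fin m × Fin n → Bool)}
    (h : ∀ τ ∈ T, ∀ τ' ∈ swaps τ, ∃ D ∈ T, related PX PY (matList τ') (matList D) = true) :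
    closedOk m n PX PY (T.map matList) = true := by
  simp only [closedOk, Bool.and_eq_true, List.all_eq_true, List.any_eq_true, List.mem_range,
    List.mem_map, forall_exists_index, and_imp, forall_apply_eq_imp_iff₂]
  refine fun τ hτ => ⟨fun i hi j hj => ?_, fun i hi j hj => ?_⟩
  · obtain ⟨D, hD, e⟩ := h τ hτ _ (swap_one_mem_swaps τ ⟨i, hi⟩ ⟨j, hj⟩)
    rw [← pullList_permList, permList_one, ← swapList_eq] at e
    exact ⟨_, ⟨D, hD, rfl⟩, e⟩
  · obtain ⟨D, hD, e⟩ := h τ hτ _ (one_swap_mem_swaps τ ⟨i, hi⟩ ⟨j, hj⟩)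
    rw [← pullList_permList, permList_one, ← swapList_eq] at e
    exact ⟨_, ⟨D, hD, rfl⟩, e⟩

/-- A polynomial bound for the size of a certificate. -/
def certBound {R : Type} [Semiring R] (K : R) : R :=
  2 * (K * (K * (2 * K + 2) + 2) + 1) + (K * (4 * K + 14) + 1) +
    2 * (((K * K + 1) * (6 * (K * K + 1) + 7) + (K * K * (K * K + K * K) + 2) *
      (6 * (K * K + 1) + 3)) * (K * (2 * K + 2) + 2) + 1) +
    ((K * K + 1) * (4 * K + 2) + 1) + (K * K * (K * (4 * K + 2) + 2) + 1) +
    (K * (4 * K + 2) + 1) + 10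

/-- The honest certificate: `T` consists of all representatives in the full orbit of `α`, and `D β`
is the representative of `β`. The parameter `K` bounds the dimensions, the indices and the lengths
of all words at once. -/
theorem exists_certOk {c : Circuit ((Fin m × Fin n) ⊕ ℕ)}
    (hc : IsCompleteSymmetryBreaking
      (gridGroup (Subgroup.closure {g | g ∈ gX}) (Subgroup.closure {h | h ∈ gY})) c)
    {K : ℕ} (hm : m ≤ K) (hn : n ≤ K) (hX : (Subgroup.closure {g | g ∈ gX}).index ≤ K)
    (hY : (Subgroup.closure {g | g ∈ gY}).index ≤ K) (hgX : (listWord permWord gX).length ≤ K)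
    (hgY : (listWord permWord gY).length ≤ K) (hcK : (circuitWord c).length ≤ K)
    {α β : Fin m × Fin n → Bool} (h : ∀ π ρ, β ≠ α ∘ gridHom _ _ (π, ρ)) :
    ∃ v : OrbitCert, esize v ≤ certBound K ∧
      certOk m n (listWord permWord gX) (listWord permWord gY) (circuitWord c)
        (matList α) (matList β) v = true := by
  classical
  choose D hDs x hx y hy hD using hc.exists
  choose! z hzl hz using fun τ (hτ : SatisfiableAt c τ) => exists_tripleEval_of_satisfiableAt hτ
  have hfin := Set.toFinite {τ | SatisfiableAt c τ ∧ ∃ π ρ, τ = α ∘ gridHom _ _ (π, ρ)}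
  obtain ⟨T, hT, hTl⟩ : ∃ T : List (Fin m × Fin n → Bool),
      (∀ τ, τ ∈ T ↔ SatisfiableAt c τ ∧ ∃ π ρ, τ = α ∘ gridHom _ _ (π, ρ)) ∧
        T.length ≤ K * K := by
    refine ⟨hfin.toFinset.toList, fun τ => by simp, ?_⟩
    rw [Finset.length_toList, ← Set.ncard_eq_toFinset_card _ hfin]
    exact (hc.ncard_le α).trans (Nat.mul_le_mul hX hY)
  -- A matrix and its representative differ by an element of X × Y, so they lie in the same full
  -- orbit.
  have hDT : ∀ π ρ, D (α ∘ gridHom _ _ (π, ρ)) ∈ T := fun π ρ => by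
    refine (hT _).2 ⟨hDs _, π * (x (α ∘ gridHom _ _ (π, ρ)))⁻¹,
      ρ * (y (α ∘ gridHom _ _ (π, ρ)))⁻¹, ?_⟩
    generalize hτ : α ∘ gridHom _ _ (π, ρ) = τ
    rw [comp_gridHom_mul, hτ]
    conv_rhs => enter [1]; rw [hD τ]
    rw [← comp_gridHom_mul, mul_inv_cancel, mul_inv_cancel]
    rfl
  have hDα : D α ∈ T := hDT 1 1
  have hDβ : D β ∉ T := fun hβ => by
    obtain ⟨_, π, ρ, e⟩ := (hT _).1 hβ
    refine h (π * x β) (ρ * y β) ?_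
    rw [comp_gridHom_mul, ← e]
    exact hD β
  -- The matrices for which the verifier looks for a relation to a representative. The derivations
  -- have to contain the permutations `x τ`, `y τ` for these `τ` only.
  set Q := α :: β :: T.flatMap swaps with hQ
  have hQl : Q.length ≤ K * K * (K * K + K * K) + 2 := by
    have h1 : (T.flatMap swaps).length = T.length * (m * m + n * n) := by
      simp [List.length_flatMap, length_swaps]
    rw [hQ, List.length_cons, List.length_cons, h1, add_assoc]
    gcongr
  obtain ⟨tX, hdX, hQX, hlX⟩ := exists_derivation_of_list {g | g ∈ gX} (card_perm_lt hm) (Q.map x)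
    fun g hg => by
      obtain ⟨τ, _, rfl⟩ := List.mem_map.1 hg
      exact hx τ
  obtain ⟨tY, hdY, hQY, hlY⟩ := exists_derivation_of_list {g | g ∈ gY} (card_perm_lt hn) (Q.map y)
    fun g hg => by
      obtain ⟨τ, _, rfl⟩ := List.mem_map.1 hg
      exact hy τ
  have hrel : ∀ τ ∈ Q,
      related (tX.map permList) (tY.map permList) (matList τ) (matList (D τ)) = true :=
    fun τ hτ => related_permList (hQX _ (List.mem_map_of_mem hτ)) (hQY _ (List.mem_map_of_mem hτ))
      (hD τ)
  have hsat : ∀ τ ∈ D β :: T,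
      satOk ((D β :: T).map z) (c.map gateTriple) (matList τ) = true := fun τ hτ => by
    refine List.any_eq_true.2 ⟨z τ, List.mem_map_of_mem hτ, hz τ ?_⟩
    rcases List.mem_cons.1 hτ with rfl | hτ
    · exact hDs β
    · exact ((hT τ).1 hτ).1
  have hmat : ∀ τ : Fin m × Fin n → Bool, isMat m n (matList τ) = true :=
    fun τ => (isMat_iff _).2 ⟨τ, rfl⟩
  refine ⟨((gX.map permList, gY.map permList, c.map gateTriple),
    (tX.map permList, tY.map permList), ((D β :: T).map z, T.map matList, matList (D β))), ?_, ?_⟩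
  · rw [List.length_map] at hlX hlY
    have b1 := esize_map_permList_le (l := gX) hm
      ((length_lt_length_listWord permWord gX).le.trans hgX)
    have b2 := esize_map_permList_le (l := gY) hn
      ((length_lt_length_listWord permWord gY).le.trans hgY)
    have b3 := esize_map_gateTriple_le c hcK
    have b4 := esize_map_permList_le (l := tX) hm
      (hlX.trans (Nat.add_le_add_left (Nat.mul_le_mul_right _ hQl) _))
    have b5 := esize_map_permList_le (l := tY) hn
      (hlY.trans (Nat.add_le_add_left (Nat.mul_le_mul_right _ hQl) _))
    have b6 : esize ((D β :: T).map z) ≤ (K * K + 1) * (4 * K + 2) + 1 := by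
      refine (esize_list_le (B := 4 * K + 1) fun w hw => ?_).trans ?_
      · obtain ⟨τ, hτ, rfl⟩ := List.mem_map.1 hw
        refine (esize_listBool_le _).trans ?_
        rw [hzl τ (by
          rcases List.mem_cons.1 hτ with rfl | hτ
          · exact hDs β
          · exact ((hT τ).1 hτ).1)]
        omega
      · rw [List.length_map, List.length_cons]
        gcongr
    have b7 : esize (T.map matList) ≤ K * K * (K * (4 * K + 2) + 2) + 1 := by
      refine (esize_list_le (B := K * (4 * K + 2) + 1) fun w hw => ?_).trans ?_
      · obtain ⟨τ, hτ, rfl⟩ := List.mem_map.1 hw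
        exact esize_matList_le τ hm hn
      · rw [List.length_map]
        gcongr
    have b8 := esize_matList_le (D β) hm hn
    simp only [esize_pair, certBound]
    omega
  · simp only [certOk, groupsOk, Bool.and_eq_true, decide_eq_true_eq, gensOk_map_permList,
      listWord_map_gateTriple, derivOk_of_isDerivation hdX, derivOk_of_isDerivation hdY, true_and]
    simp only [orbitsOk, Bool.and_eq_true, List.all_eq_true, List.any_eq_true, List.mem_map,
      forall_exists_index, and_imp, forall_apply_eq_imp_iff₂, hmat, true_and, Bool.not_eq_true',
      decide_eq_false_iff_not]
    refine ⟨⟨⟨⟨⟨fun τ hτ => hsat τ (by simp [hτ]), _, ⟨_, hDα, rfl⟩, hrel α (by simp [hQ])⟩, ?_⟩,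
      hsat _ (by simp)⟩, hrel β (by simp [hQ])⟩, fun τ hτ e => hDβ ?_⟩
    · refine closedOk_of_swaps fun τ hτ τ' hτ' => ⟨D τ', ?_, hrel τ' (by
        rw [hQ]
        exact List.mem_cons_of_mem _ (List.mem_cons_of_mem _ (List.mem_flatMap.2 ⟨τ, hτ, hτ'⟩)))⟩
      obtain ⟨_, π, ρ, rfl⟩ := (hT τ).1 hτ
      obtain ⟨π', ρ', rfl⟩ := exists_of_mem_swaps hτ'
      exact hDT (π * π') (ρ * ρ')
    · rw [matList_injective e]
      exact hτ

end completeness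

end SymmetryBreaking

/-! ### Certificates of non-isomorphism and the conclusion -/

namespace SymmetryBreaking

/-! ### Certificates for pairs of graphs that are not isomorphic -/

/-- The adjacency matrices are part of the certificate and are compared with the input word.
Different numbers of vertices are accepted at once. Two graphs without vertices are isomorphic, and
rejecting them keeps the indices of the families positive. -/
def nonisoOk (FX FY FC : List Bool → List Bool) (w : List Bool) (A B : List (List Bool))
    (v : OrbitCert) : Bool :=
  decide (w = rowsWord A ++ rowsWord B) && isMat A.length A.length A &&
    isMat B.length B.length B && (!decide (A.length = B.length) || (!decide (A.length = 0) &&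
      certOk A.length (A.length * A.length) (FX (natWord A.length))
        (FY (natWord (A.length * A.length)))
        (FC (natWord A.length ++ natWord (A.length * A.length)))
        (incidenceList A) (incidenceList B) v))

theorem poly_nonisoOk {FX FY FC : List Bool → List Bool} (hX : Poly FX) (hY : Poly FY)
    (hC : Poly FC) :
    Poly fun x : List Bool × List (List Bool) × List (List Bool) × OrbitCert =>
      nonisoOk FX FY FC x.1 x.2.1 x.2.2.1 x.2.2.2 := by
  unfold nonisoOk
  fun_prop

section

variable {FX FY FC : List Bool → List Bool} {X Y : PermFamily}
  {gX gY : (n : ℕ+) → List (Equiv.Perm (Fin n))}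
  {c : (s : ℕ+ × ℕ+) → Circuit ((Fin s.1 × Fin s.2) ⊕ ℕ)}

theorem graphPairWord_eq (P : FinGraph × FinGraph) : graphPairWord P =
    rowsWord (matList (adjMat P.1.graph)) ++ rowsWord (matList (adjMat P.2.graph)) := by
  rw [graphPairWord, graphWord_eq, graphWord_eq]

theorem isMat_matList {m n : ℕ} (τ : Fin m × Fin n → Bool) : isMat m n (matList τ) = true :=
  (isMat_iff _).2 ⟨τ, rfl⟩

theorem not_mem_GI_of_nonisoOk (hgX : ∀ n, Subgroup.closure {g | g ∈ gX n} = X n)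
    (hgY : ∀ n, Subgroup.closure {g | g ∈ gY n} = Y n)
    (hc : ∀ s, IsCompleteSymmetryBreaking (gridGroup (X s.1) (Y s.2)) (c s))
    (hX : ∀ n : ℕ+, FX (natWord n) = listWord permWord (gX n))
    (hY : ∀ n : ℕ+, FY (natWord n) = listWord permWord (gY n))
    (hC : ∀ s : ℕ+ × ℕ+, FC (natWord s.1 ++ natWord s.2) = circuitWord (c s))
    {P : FinGraph × FinGraph} {A B : List (List Bool)} {v : OrbitCert}
    (h : nonisoOk FX FY FC (graphPairWord P) A B v = true) : P ∉ GI := by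
  simp only [nonisoOk, Bool.and_eq_true, decide_eq_true_eq, Bool.or_eq_true, Bool.not_eq_true',
    decide_eq_false_iff_not, graphPairWord_eq] at h
  obtain ⟨⟨⟨hw, hA⟩, hB⟩, h⟩ := h
  have hsq : ∀ {A : List (List Bool)}, isMat A.length A.length A = true →
      ∀ r ∈ A, r.length = A.length := fun {A} hA r hr => by
    simp only [isMat, Bool.and_eq_true, List.all_eq_true, decide_eq_true_eq] at hA
    exact hA.2 r hr
  obtain ⟨⟨n, G⟩, ⟨n', H⟩⟩ := P
  have hadj : ∀ {n : ℕ} (G : SimpleGraph (Fin n)),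
      ∀ r ∈ matList (adjMat G), r.length = (matList (adjMat G)).length := fun G r hr => by
    rw [length_of_mem_matList hr, length_matList]
  obtain ⟨rfl, hw'⟩ := rowsWord_append_inj (hadj G) (hsq hA) hw
  obtain ⟨rfl, -⟩ := rowsWord_append_inj (r := []) (s := []) (hadj H) (hsq hB) (by
    rw [← hw'])
  simp only [length_matList] at h
  rintro ⟨φ⟩
  obtain rfl : n = n' := by simpa using Fintype.card_congr φ.toEquiv
  rcases h with h | ⟨h0, h⟩
  · exact h rfl
  · let k : ℕ+ := ⟨n, Nat.pos_of_ne_zero h0⟩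
    have hck := hc (k, k * k)
    rw [← hgX, ← hgY] at hck
    rw [incidenceList_matList, incidenceList_matList, certOk, Bool.and_eq_true] at h
    obtain ⟨π, ρ, e⟩ := (nonempty_iso_iff G H).1 ⟨φ⟩
    have hX' : FX (natWord n) = _ := hX k
    have hY' : FY (natWord (n * n)) = _ := hY (k * k)
    have hC' : FC (natWord n ++ natWord (n * n)) = _ := hC (k, k * k)
    rw [hX', hY', hC'] at h
    exact ne_comp_gridHom_of_check (m := n) (n := n * n) hck h.1 h.2 π ρ e

/-- Here `l` is the length of the input, which exceeds the number n of vertices of the first graph.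
`K` adds up bounds for all parameters of `exists_certOk`; those for the family `Y` are taken at `l *
l` because of the n² columns. -/
theorem exists_nonisoOk (hgX : ∀ n, Subgroup.closure {g | g ∈ gX n} = X n)
    (hgY : ∀ n, Subgroup.closure {g | g ∈ gY n} = Y n)
    (hc : ∀ s, IsCompleteSymmetryBreaking (gridGroup (X s.1) (Y s.2)) (c s))
    (hX : ∀ n : ℕ+, FX (natWord n) = listWord permWord (gX n))
    (hY : ∀ n : ℕ+, FY (natWord n) = listWord permWord (gY n))
    (hC : ∀ s : ℕ+ × ℕ+, FC (natWord s.1 ++ natWord s.2) = circuitWord (c s))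
    {pX pY qX qY qC : Polynomial ℕ}
    (hpX : ∀ n : ℕ+, (X n).index < pX.eval (n : ℕ)) (hpY : ∀ n : ℕ+, (Y n).index < pY.eval (n : ℕ))
    (hqX : ∀ w, (FX w).length ≤ qX.eval w.length) (hqY : ∀ w, (FY w).length ≤ qY.eval w.length)
    (hqC : ∀ w, (FC w).length ≤ qC.eval w.length) {P : FinGraph × FinGraph} (hP : P ∉ GI)
    {l K : ℕ} (hl : (graphPairWord P).length = l)
    (hK : K = l + l * l + pX.eval l + pY.eval (l * l) + qX.eval l + qY.eval (l * l) +
      qC.eval (l + l * l)) :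
    ∃ A B v, esize (A, B, v) ≤ 2 * (l * (4 * l + 2) + 1) + certBound K + 2 ∧
      nonisoOk FX FY FC (graphPairWord P) A B v = true := by
  obtain ⟨⟨n, G⟩, ⟨n', H⟩⟩ := P
  have hn : n + 1 ≤ l ∧ n' ≤ l := by
    rw [← hl]
    simp only [graphPairWord, graphWord, List.length_append, length_natWord]
    omega
  suffices h : ∃ v : OrbitCert, esize v ≤ certBound K ∧ (n = n' → n ≠ 0 ∧
      certOk n (n * n) (FX (natWord n)) (FY (natWord (n * n)))
        (FC (natWord n ++ natWord (n * n))) (incidenceList (matList (adjMat G)))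
        (incidenceList (matList (adjMat H))) v = true) by
    obtain ⟨v, hv, h⟩ := h
    refine ⟨matList (adjMat G), matList (adjMat H), v, ?_, ?_⟩
    · have h1 := esize_matList_le (K := l) (adjMat G) (by omega) (by omega)
      have h2 := esize_matList_le (K := l) (adjMat H) (by omega) (by omega)
      simp only [esize_pair]
      omega
    · simp only [nonisoOk, Bool.and_eq_true, decide_eq_true_eq, Bool.or_eq_true, Bool.not_eq_true',
        decide_eq_false_iff_not, graphPairWord_eq, length_matList, isMat_matList, true_and]
      by_cases hnn : n = n'
      · exact .inr (h hnn)
      · exact .inl hnn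
  by_cases hnn : n = n'
  · subst hnn
    have h0 : n ≠ 0 := fun h0 => by
      subst h0
      exact hP ⟨⟨Equiv.refl _, fun {u} => u.elim0⟩⟩
    have hπ : ∀ π ρ, incMat H ≠ incMat G ∘ gridHom _ _ (π, ρ) := fun π ρ e =>
      hP ((nonempty_iso_iff G H).2 ⟨π, ρ, e⟩)
    let k : ℕ+ := ⟨n, Nat.pos_of_ne_zero h0⟩
    have hck := hc (k, k * k)
    rw [← hgX, ← hgY] at hck
    have hnl : n * n + 1 ≤ l * l := by nlinarith
    have hX' : FX (natWord n) = listWord permWord (gX k) := hX k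
    have hY' : FY (natWord (n * n)) = listWord permWord (gY (k * k)) := hY (k * k)
    have hC' : FC (natWord n ++ natWord (n * n)) = circuitWord (c (k, k * k)) := hC (k, k * k)
    have b1 : (FX (natWord n)).length ≤ qX.eval l :=
      (hqX _).trans (eval_mono _ (by rw [length_natWord]; omega))
    have b2 : (FY (natWord (n * n))).length ≤ qY.eval (l * l) :=
      (hqY _).trans (eval_mono _ (by rw [length_natWord]; omega))
    have b3 : (FC (natWord n ++ natWord (n * n))).length ≤ qC.eval (l + l * l) :=
      (hqC _).trans (eval_mono _ (by rw [List.length_append, length_natWord, length_natWord]; omega))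
    have b4 : (X k).index ≤ pX.eval l := (hpX k).le.trans (eval_mono _ (by change n ≤ l; omega))
    have b5 : (Y (k * k)).index ≤ pY.eval (l * l) :=
      (hpY (k * k)).le.trans (eval_mono _ (by change n * n ≤ l * l; omega))
    rw [hX'] at b1
    rw [hY'] at b2
    rw [hC'] at b3
    rw [← hgX] at b4
    rw [← hgY] at b5
    obtain ⟨v, hv, h⟩ := exists_certOk (m := n) (n := n * n) (K := K) hck (by omega) (by omega)
      (b4.trans (by omega)) (b5.trans (by omega)) (b1.trans (by omega)) (b2.trans (by omega))
      (b3.trans (by omega)) hπ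
    refine ⟨v, hv, fun _ => ⟨h0, ?_⟩⟩
    rw [incidenceList_matList, incidenceList_matList, hX', hY', hC']
    exact h
  · refine ⟨(([], [], []), ([], []), ([], [], [])), ?_, fun h => absurd h hnn⟩
    have h1 : ∀ {α : Type} [Enc α], esize ([] : List α) = 1 := rfl
    simp only [esize_pair, h1, certBound]
    omega

end

theorem inCoNP_GI {X Y : PermFamily} (hX : X.IsGivenByGenerators) (hY : Y.IsGivenByGenerators)
    (hXindex : X.HasPolynomialIndex) (hYindex : Y.HasPolynomialIndex)
    (hbreak : EfficientCompleteSymmetryBreaking X Y) : InCoNP graphPairWord GI := by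
  obtain ⟨gX, hgX, hX⟩ := hX
  obtain ⟨gY, hgY, hY⟩ := hY
  obtain ⟨c, hc, hC⟩ := hbreak
  obtain ⟨pX, hpX⟩ := hXindex
  obtain ⟨pY, hpY⟩ := hYindex
  obtain ⟨FX, hFX, hX⟩ := hX.exists_poly
  obtain ⟨FY, hFY, hY⟩ := hY.exists_poly
  obtain ⟨FC, hFC, hC⟩ := hC.exists_poly
  have hlen : ∀ {F : List Bool → List Bool}, Poly F →
      ∃ q : Polynomial ℕ, ∀ w, (F w).length ≤ q.eval w.length := fun {F} hF => by
    obtain ⟨q, hq⟩ := hF.esize_le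
    refine ⟨q.comp (4 * .X + 1), fun w => ?_⟩
    refine (length_le_esize _).trans ((hq w).trans ?_)
    simpa using eval_mono q (esize_listBool_le w)
  obtain ⟨qX, hqX⟩ := hlen hFX
  obtain ⟨qY, hqY⟩ := hlen hFY
  obtain ⟨qC, hqC⟩ := hlen hFC
  refine inNP_of_poly (poly_nonisoOk hFX hFY hFC)
    -- `certBound` makes sense in every semiring: here it is formed from polynomials, and evaluation
    -- turns it into the numerical bound for the certificate.
    (2 * (.X * (4 * .X + 2) + 1) + certBound (.X + .X * .X + pX + pY.comp (.X * .X) + qX +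
      qY.comp (.X * .X) + qC.comp (.X + .X * .X)) + 2) (fun P hP => ?_)
    fun P v h => not_mem_GI_of_nonisoOk hgX hgY hc hX hY hC h
  obtain ⟨A, B, v, hv, h⟩ := exists_nonisoOk hgX hgY hc hX hY hC hpX hpY hqX hqY hqC hP rfl rfl
  exact ⟨(A, B, v), hv.trans_eq (by simp [certBound]), h⟩

end SymmetryBreaking

theorem mainTheorem11 (X Y : SymmetryBreaking.PermFamily)
    (hX : X.IsGivenByGenerators) (hY : Y.IsGivenByGenerators)
    (hXindex : X.HasPolynomialIndex) (hYindex : Y.HasPolynomialIndex)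
    (hbreak : SymmetryBreaking.EfficientCompleteSymmetryBreaking X Y) :
    SymmetryBreaking.InCoNP SymmetryBreaking.graphPairWord SymmetryBreaking.GI :=
  SymmetryBreaking.inCoNP_GI hX hY hXindex hYindex hbreak
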